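/- Let $n\ge 1$ and equip $\mathbb R^n$ with the uniform norm $\|x\|=\max_i|x_i|$; distances, diameters and lengths of curves are measured in this norm. Let $\Omega\subset\mathbb R^n$ be an arbitrary domain (nonempty, open, connected), let $n<p<\infty$, $\alpha=\frac{p-n}{p-1}\in(0,1]$ and $\eta\ge 41$. For $x,y\in\Omega$ let $d_{\alpha,\Omega}(x,y)=\inf_\gamma\int_\gamma \operatorname{dist}(z,\partial\Omega)^{\alpha-1}\,ds(z)$, the infimum being over all rectifiable curves $\gamma\subset\Omega$ joining $x$ to $y$ (with $\operatorname{dist}(z,\emptyset)=\infty$). Let $\Omega_\alpha$ be the Cauchy completion of $\Omega$ in the metric $\delta_\alpha(x,y)=d_{\alpha,\Omega}(x,y)+\|x-y\|^\alpha$, and let the $\alpha$-boundary $\partial_\alpha\Omega$ be the boundary of $\Omega$ as a subset of $\Omega_\alpha$. For $\omega\in\Omega_\alpha$ let $\ell(\omega)\in\overline\Omega$ be the common limit in $\mathbb R^n$ of the sequences in $\Omega$ that converge to $\omega$ in $\Omega_\alpha$, and for $\omega_1,\omega_2\in\Omega_\alpha$ let $d_{\alpha,\overline\Omega}(\omega_1,\omega_2)=\lim_i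 d_{\alpha,\Omega}(x_i,y_i)$ for any sequences $x_i\to\omega_1$, $y_i\to\omega_2$ in $\Omega$. Let $L^1_p(\Omega)$ be the homogeneous Sobolev space of functions on $\Omega$ whose distributional gradient is in $L_p(\Omega)$, with seminorm $\|F\|_{L^1_p(\Omega)}=\|\nabla F\|_{L_p(\Omega)}$. A function $f:\partial_\alpha\Omega\to\mathbb R$ is the trace of a continuous $F\in L^1_p(\Omega)$ if for each $\omega\in\partial_\alpha\Omega$ one has $F(x)\to f(\omega)$ as $x\in\Omega$ tends to $\omega$ in $\Omega_\alpha$; the trace norm $\|f\|_{\mathrm{tr}}$ is the infimum of $\|F\|_{L^1_p(\Omega)}$ over all continuous $F\in L^1_p(\Omega)$ with trace $f$. A cube is a closed cube of positive side length with sides parallel to the coordinate axes, and $\eta Q$ is the dilation of $Q$ about its center $x_Q$ by the factor $\eta$. For a cube $Q\subset\Omega$, an element $\omega\in\partial_\alpha\Omega$ is called $(\alpha,Q)$-visible if (i) for each $y\in Q$ the semi-open segment $(\ell(\omega),y]$ lies in $\Omega$, and (ii) some sequence of points of $(\ell(\omega),x_Q]$ converges to $\omega$ in $\Omega_\alpha$.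 Then a function $f:\partial_\alpha\Omega\to\mathbb R$ is the trace of a continuous function $F\in L^1_p(\Omega)$ if and only if $f$ is continuous with respect to $d_{\alpha,\overline\Omega}$ and there is a constant $\lambda>0$ such that $$\sum_{i=1}^m\frac{|f(\omega_i^{(1)})-f(\omega_i^{(2)})|^p}{(\operatorname{diam}Q_i)^{p-n}}\le\lambda\qquad(*)$$ for every finite family $\{Q_i\}_{i=1}^m$ of pairwise disjoint cubes in $\Omega$ and every choice of $(\alpha,Q_i)$-visible elements $\omega_i^{(1)},\omega_i^{(2)}\in\partial_\alpha\Omega$ with $\ell(\omega_i^{(1)}),\ell(\omega_i^{(2)})\in(\eta Q_i)\cap\partial\Omega$. Moreover, there is a constant $C\ge 1$ depending only on $n$, $p$ and $\eta$ such that for every such $\Omega$ and every such trace $f$ $$C^{-1}\inf\lambda^{1/p}\le\|f\|_{\mathrm{tr}}\le C\inf\lambda^{1/p},$$ the infimum being over all $\lambda>0$ for which $(*)$ holds in all these cases. -/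

import Mathlib

open Set Filter Topology MeasureTheory UniformSpace
open scoped ENNReal

noncomputable section

/-! Throughout, `ℝⁿ` is `Fin n → ℝ` with the uniform norm `‖x‖ = max |x i|`; distances, diameters
and lengths of curves are measured in this norm. -/

/-- A domain in `ℝⁿ`: a nonempty connected open set. -/
structure SpaceDomain (n : ℕ) where
  /-- The underlying set. -/
  carrier : Set (Fin n → ℝ)
  isOpen : IsOpen carrier
  isConnected : IsConnected carrier

namespace SpaceDomain

variable {n : ℕ}

/-- `γ` on `[0, L]` is a rectifiable curve in `Ω` from `x` to `y`, parametrized by arc length. -/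
structure IsArcLengthCurve (Ω : SpaceDomain n) (x y : Fin n → ℝ) (L : ℝ)
    (γ : ℝ → Fin n → ℝ) : Prop where
  nonneg : 0 ≤ L
  unitSpeed : HasUnitSpeedOn γ (Icc 0 L)
  source : γ 0 = x
  target : γ L = y
  mapsTo : MapsTo γ (Icc 0 L) Ω.carrier

/-- The subhyperbolic length `∫_γ dist(z, ∂Ω)^(α - 1) ds(z)` of a curve `γ` of length `L`
parametrized by arc length (the distance to the empty set is `∞`). -/
def subhypLength (Ω : SpaceDomain n) (α : ℝ) (L : ℝ) (γ : ℝ → Fin n → ℝ) : ℝ≥0∞ :=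
  ∫⁻ s in Icc 0 L, (Metric.infEDist (γ s) (frontier Ω.carrier)) ^ (α - 1)

/-- The subhyperbolic distance `d_{α,Ω}` with values in `[0, ∞]`: the infimum of the subhyperbolic
lengths of the rectifiable curves in `Ω` that join `x` to `y`. -/
def subhypEDist (Ω : SpaceDomain n) (α : ℝ) (x y : Fin n → ℝ) : ℝ≥0∞ :=
  ⨅ (L : ℝ) (γ : ℝ → Fin n → ℝ) (_ : Ω.IsArcLengthCurve x y L γ), Ω.subhypLength α L γ

/-- The subhyperbolic metric `d_{α,Ω}` (its finiteness on `Ω` is `subhypEDist_ne_top` below). -/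
def subhypDist (Ω : SpaceDomain n) (α : ℝ) (x y : Fin n → ℝ) : ℝ :=
  (Ω.subhypEDist α x y).toReal

/-! ### The metric axioms for `d_{α,Ω}` -/

theorem subhypEDist_self (Ω : SpaceDomain n) (α : ℝ) {x : Fin n → ℝ} (hx : x ∈ Ω.carrier) :
    Ω.subhypEDist α x x = 0 := by
  have h : Ω.IsArcLengthCurve x x 0 (fun _ => x) :=
    ⟨le_rfl, hasConstantSpeedOnWith_of_subsingleton _ (by simp) 1, rfl, rfl, fun _ _ => hx⟩
  have h0 : Ω.subhypLength α 0 (fun _ => x) = 0 := by simp [subhypLength]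
  exact le_antisymm (h0 ▸ iInf₂_le_of_le 0 _ (iInf_le _ h)) bot_le

theorem IsArcLengthCurve.reverse {Ω : SpaceDomain n} {x y : Fin n → ℝ} {L : ℝ}
    {γ : ℝ → Fin n → ℝ} (h : Ω.IsArcLengthCurve x y L γ) :
    Ω.IsArcLengthCurve y x L (fun s => γ (L - s)) := by
  refine ⟨h.nonneg, ?_, by simpa using h.target, by simpa using h.source, fun s hs => ?_⟩
  · refine hasConstantSpeedOnWith_iff_ordered.2 fun a ha b hb hab => ?_
    have e : Icc 0 L ∩ Icc a b = Icc a b := inter_eq_right.2 (Icc_subset_Icc ha.1 hb.2)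
    have hb' : L - b ∈ Icc 0 L := ⟨by linarith [hb.2], by linarith [hb.1]⟩
    have ha' : L - a ∈ Icc 0 L := ⟨by linarith [ha.2], by linarith [ha.1]⟩
    have h1 := h.unitSpeed hb' ha'
    have e' : Icc 0 L ∩ Icc (L - b) (L - a) = Icc (L - b) (L - a) :=
      inter_eq_right.2 (Icc_subset_Icc (by linarith [hb.2]) (by linarith [ha.1]))
    rw [e'] at h1
    have h2 := eVariationOn.comp_eq_of_antitoneOn γ (t := Icc a b) (fun s => L - s)
      (fun _ _ _ _ h => sub_le_sub_left h L)
    rw [image_const_sub_Icc, h1] at h2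
    rw [e]
    refine Eq.trans h2 ?_
    congr 2
    ring
  · exact h.mapsTo ⟨by linarith [hs.2], by linarith [hs.1]⟩

theorem subhypLength_reverse (Ω : SpaceDomain n) (α L : ℝ) (γ : ℝ → Fin n → ℝ) :
    Ω.subhypLength α L (fun s => γ (L - s)) = Ω.subhypLength α L γ := by
  unfold subhypLength
  rw [← lintegral_indicator measurableSet_Icc, ← lintegral_indicator measurableSet_Icc,
    ← lintegral_sub_left_eq_self _ L]
  congr 1
  ext s
  by_cases hs : s ∈ Icc 0 L
  · have hs' : L - s ∈ Icc 0 L := ⟨by linarith [hs.2], by linarith [hs.1]⟩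
    rw [indicator_of_mem hs, indicator_of_mem hs']
    simp
  · rw [indicator_of_notMem hs, indicator_of_notMem]
    intro h
    exact hs ⟨by linarith [h.2], by linarith [h.1]⟩

theorem subhypEDist_comm_le (Ω : SpaceDomain n) (α : ℝ) (x y : Fin n → ℝ) :
    Ω.subhypEDist α x y ≤ Ω.subhypEDist α y x := by
  refine le_iInf₂ fun L γ => le_iInf fun h => ?_
  exact iInf₂_le_of_le L _ (iInf_le_of_le h.reverse (Ω.subhypLength_reverse α L γ).le)

theorem subhypEDist_comm (Ω : SpaceDomain n) (α : ℝ) (x y : Fin n → ℝ) :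
    Ω.subhypEDist α x y = Ω.subhypEDist α y x :=
  le_antisymm (Ω.subhypEDist_comm_le α x y) (Ω.subhypEDist_comm_le α y x)

theorem IsArcLengthCurve.concat {Ω : SpaceDomain n} {x y z : Fin n → ℝ} {L₁ L₂ : ℝ}
    {γ₁ γ₂ : ℝ → Fin n → ℝ} (h₁ : Ω.IsArcLengthCurve x y L₁ γ₁)
    (h₂ : Ω.IsArcLengthCurve y z L₂ γ₂) :
    Ω.IsArcLengthCurve x z (L₁ + L₂) (fun s => if s ≤ L₁ then γ₁ s else γ₂ (s - L₁)) := by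
  have hL₁ := h₁.nonneg
  have hL₂ := h₂.nonneg
  set γ : ℝ → Fin n → ℝ := fun s => if s ≤ L₁ then γ₁ s else γ₂ (s - L₁) with hγ
  have e₁ : ∀ s, s ≤ L₁ → γ s = γ₁ s := fun s hs => by simp [hγ, hs]
  have e₂ : ∀ s, L₁ ≤ s → γ s = γ₂ (s - L₁) := fun s hs => by
    rcases hs.eq_or_lt with rfl | hs
    · simp [hγ, h₁.target, h₂.source]
    · simp [hγ, not_le.2 hs]
  refine ⟨by linarith, ?_, ?_, ?_, ?_⟩
  · refine HasUnitSpeedOn.Icc_Icc (y := L₁) ?_ ?_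
    · intro a ha b hb
      rw [eVariationOn.congr (g := γ₁) (fun s hs => e₁ s hs.1.2)]
      exact h₁.unitSpeed ha hb
    · refine hasConstantSpeedOnWith_iff_ordered.2 fun a ha b hb hab => ?_
      have ha' : a - L₁ ∈ Icc 0 L₂ := ⟨by linarith [ha.1], by linarith [ha.2]⟩
      have hb' : b - L₁ ∈ Icc 0 L₂ := ⟨by linarith [hb.1], by linarith [hb.2]⟩
      rw [eVariationOn.congr (g := γ₂ ∘ fun s => s - L₁) (fun s hs => e₂ s hs.1.1),
        inter_eq_right.2 (Icc_subset_Icc ha.1 hb.2),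
        eVariationOn.comp_eq_of_monotoneOn γ₂ (fun s => s - L₁)
          (fun _ _ _ _ h => by simpa using h), image_sub_const_Icc]
      have h := h₂.unitSpeed ha' hb'
      rw [inter_eq_right.2 (Icc_subset_Icc ha'.1 hb'.2)] at h
      rw [h]
      congr 2
      ring
  · rw [e₁ 0 hL₁, h₁.source]
  · rw [e₂ _ (by linarith), add_sub_cancel_left, h₂.target]
  · intro s hs
    rcases le_total s L₁ with h | h
    · rw [e₁ s h]
      exact h₁.mapsTo ⟨hs.1, h⟩
    · rw [e₂ s h]
      exact h₂.mapsTo ⟨by linarith, by linarith [hs.2]⟩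

theorem subhypLength_concat_le (Ω : SpaceDomain n) (α : ℝ) {L₁ L₂ : ℝ}
    (hL₁ : 0 ≤ L₁) (hL₂ : 0 ≤ L₂) (γ₁ γ₂ : ℝ → Fin n → ℝ) :
    Ω.subhypLength α (L₁ + L₂) (fun s => if s ≤ L₁ then γ₁ s else γ₂ (s - L₁)) ≤
      Ω.subhypLength α L₁ γ₁ + Ω.subhypLength α L₂ γ₂ := by
  unfold subhypLength
  have hu : Icc 0 (L₁ + L₂) = Icc 0 L₁ ∪ Ioc L₁ (L₁ + L₂) :=
    (Icc_union_Ioc_eq_Icc hL₁ (by linarith)).symm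
  rw [hu]
  refine (lintegral_union_le _ _ _).trans (add_le_add (le_of_eq ?_) ?_)
  · refine setLIntegral_congr_fun measurableSet_Icc fun s hs => ?_
    simp [hs.2]
  · rw [← lintegral_indicator measurableSet_Icc, ← lintegral_indicator measurableSet_Ioc,
      ← lintegral_sub_right_eq_self (Set.indicator (Icc 0 L₂) _) L₁]
    refine lintegral_mono fun s => ?_
    by_cases hs : s ∈ Ioc L₁ (L₁ + L₂)
    · have hs' : s - L₁ ∈ Icc 0 L₂ := ⟨by linarith [hs.1], by linarith [hs.2]⟩
      rw [indicator_of_mem hs, indicator_of_mem hs']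
      simp [not_le.2 hs.1]
    · rw [indicator_of_notMem hs]
      exact bot_le

theorem subhypEDist_triangle (Ω : SpaceDomain n) (α : ℝ) (x y z : Fin n → ℝ) :
    Ω.subhypEDist α x z ≤ Ω.subhypEDist α x y + Ω.subhypEDist α y z := by
  conv_rhs => unfold subhypEDist
  simp only [ENNReal.iInf_add, ENNReal.add_iInf]
  refine le_iInf fun L₂ => le_iInf fun γ₂ => le_iInf fun h₂ => le_iInf fun L₁ => le_iInf fun γ₁ =>
    le_iInf fun h₁ => ?_
  exact iInf₂_le_of_le _ _ (iInf_le_of_le (h₁.concat h₂)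
    (Ω.subhypLength_concat_le α h₁.nonneg h₂.nonneg γ₁ γ₂))

theorem subhypEDist_ne_top (Ω : SpaceDomain n) {α : ℝ} (hα : α ≤ 1) {x y : Fin n → ℝ}
    (hx : x ∈ Ω.carrier) (hy : y ∈ Ω.carrier) : Ω.subhypEDist α x y ≠ ⊤ := by
  refine Ω.isConnected.isPreconnected.induction₂ (fun x y => Ω.subhypEDist α x y ≠ ⊤)
    (fun x hx => ?_) (fun x y z _ _ _ h h' => ?_) (fun x y _ _ h => ?_) hx hy
  · obtain ⟨ε, hε, hεΩ⟩ := Metric.isOpen_iff.1 Ω.isOpen x hx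
    refine mem_nhdsWithin_of_mem_nhds ?_
    filter_upwards [Metric.ball_mem_nhds x (half_pos hε)] with y hy
    rcases eq_or_ne y x with rfl | hne
    · simp [Ω.subhypEDist_self α hx]
    have hL : 0 < ‖y - x‖ := norm_pos_iff.2 (sub_ne_zero.2 hne)
    have hL' : ‖y - x‖ < ε / 2 := by simpa [dist_eq_norm] using hy
    set L := ‖y - x‖ with hLdef
    set γ : ℝ → Fin n → ℝ := fun s => x + (s / L) • (y - x) with hγ
    have hd : ∀ s ∈ Icc 0 L, dist (γ s) x < ε / 2 := fun s hs => by
      rw [dist_eq_norm, hγ]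
      simp only [add_sub_cancel_left, norm_smul, Real.norm_eq_abs, abs_div, abs_of_nonneg hs.1,
        abs_of_pos hL]
      rw [← hLdef, div_mul_cancel₀ _ hL.ne']
      linarith [hs.2]
    have hiso : Isometry γ := Isometry.of_dist_eq fun s t => by
      rw [dist_eq_norm, hγ, Real.dist_eq]
      simp only [add_sub_add_left_eq_sub, ← sub_smul, norm_smul, ← sub_div, Real.norm_eq_abs,
        abs_div, abs_of_pos hL]
      rw [← hLdef, div_mul_cancel₀ _ hL.ne']
    have hcurve : Ω.IsArcLengthCurve x y L γ := by
      refine ⟨hL.le, ?_, by simp [hγ], by simp [hγ, hL.ne'], fun s hs => hεΩ ?_⟩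
      · refine hasConstantSpeedOnWith_iff_ordered.2 fun a ha b hb hab => ?_
        rw [inter_eq_right.2 (Icc_subset_Icc ha.1 hb.2)]
        have h1 : eVariationOn γ (Icc a b) = eVariationOn (id : ℝ → ℝ) (Icc a b) := by
          simp only [eVariationOn, hiso.edist_eq, id]
        rw [h1]
        refine le_antisymm ?_ ?_ <;> simp
      · exact Metric.mem_ball.2 (by linarith [hd s hs])
    have hbound : ∀ s ∈ Icc 0 L,
        (Metric.infEDist (γ s) (frontier Ω.carrier)) ^ (α - 1) ≤
          (ENNReal.ofReal (ε / 2)) ^ (α - 1) := fun s hs => by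
      rw [← neg_sub, ENNReal.rpow_neg, ENNReal.rpow_neg]
      refine ENNReal.inv_le_inv.2 (ENNReal.rpow_le_rpow ?_ (by linarith))
      refine Metric.le_infEDist.2 fun w hw => ?_
      rw [edist_dist]
      refine ENNReal.ofReal_le_ofReal ?_
      by_contra! hlt
      have hw' : w ∈ Ω.carrier := hεΩ (Metric.mem_ball.2 (by
        have := dist_triangle w (γ s) x
        rw [dist_comm w (γ s)] at this
        linarith [hd s hs]))
      rw [Ω.isOpen.frontier_eq] at hw
      exact hw.2 hw'
    refine ne_top_of_le_ne_top ?_ (iInf₂_le_of_le L γ (iInf_le_of_le hcurve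
      (setLIntegral_mono' measurableSet_Icc hbound)))
    rw [setLIntegral_const]
    refine ENNReal.mul_ne_top (ENNReal.rpow_ne_top_of_ne_zero ?_ ENNReal.ofReal_ne_top) (by simp)
    simpa using hε
  · exact ne_top_of_le_ne_top (ENNReal.add_ne_top.2 ⟨h, h'⟩) (Ω.subhypEDist_triangle α x y z)
  · rwa [Ω.subhypEDist_comm]

/-! ### The completion of `Ω` in the metric `d_{α,Ω}(x, y) + ‖x - y‖ ^ α` -/

/-- The points of `Ω`, to be equipped with the metric `d_{α,Ω}(x, y) + ‖x - y‖ ^ α`. -/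
def Subhyp (Ω : SpaceDomain n) (_α : Ioc (0 : ℝ) 1) : Type :=
  ↥Ω.carrier

/-- A point of `Ω`, as a point of `ℝⁿ`. -/
def Subhyp.pt {Ω : SpaceDomain n} {α : Ioc (0 : ℝ) 1} (x : Ω.Subhyp α) : Fin n → ℝ :=
  Subtype.val x

theorem Subhyp.pt_mem {Ω : SpaceDomain n} {α : Ioc (0 : ℝ) 1} (x : Ω.Subhyp α) :
    x.pt ∈ Ω.carrier :=
  Subtype.property x

theorem Subhyp.subhypDist_triangle {Ω : SpaceDomain n} {α : Ioc (0 : ℝ) 1} (x y z : Ω.Subhyp α) :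
    Ω.subhypDist α x.pt z.pt ≤ Ω.subhypDist α x.pt y.pt + Ω.subhypDist α y.pt z.pt := by
  unfold subhypDist
  have h₁ := Ω.subhypEDist_ne_top α.2.2 x.pt_mem y.pt_mem
  have h₂ := Ω.subhypEDist_ne_top α.2.2 y.pt_mem z.pt_mem
  rw [← ENNReal.toReal_add h₁ h₂]
  exact ENNReal.toReal_mono (ENNReal.add_ne_top.2 ⟨h₁, h₂⟩) (Ω.subhypEDist_triangle _ _ _ _)

theorem subhypDist_comm (Ω : SpaceDomain n) (α : ℝ) (x y : Fin n → ℝ) :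
    Ω.subhypDist α x y = Ω.subhypDist α y x := by
  unfold subhypDist
  rw [subhypEDist_comm]

theorem subhypDist_nonneg (Ω : SpaceDomain n) (α : ℝ) (x y : Fin n → ℝ) :
    0 ≤ Ω.subhypDist α x y :=
  ENNReal.toReal_nonneg

/-- The metric `d_{α,Ω}(x, y) + ‖x - y‖ ^ α` on `Ω`. -/
instance (Ω : SpaceDomain n) (α : Ioc (0 : ℝ) 1) : MetricSpace (Ω.Subhyp α) where
  dist x y := Ω.subhypDist α x.pt y.pt + ‖x.pt - y.pt‖ ^ (α : ℝ)
  dist_self x := by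
    simp [subhypDist, Ω.subhypEDist_self α x.pt_mem, Real.zero_rpow α.2.1.ne']
  dist_comm x y := by rw [subhypDist_comm, norm_sub_rev]
  dist_triangle x y z := by
    have h₁ := Subhyp.subhypDist_triangle x y z
    have h₂ : ‖x.pt - z.pt‖ ^ (α : ℝ) ≤ ‖x.pt - y.pt‖ ^ (α : ℝ) + ‖y.pt - z.pt‖ ^ (α : ℝ) :=
      (Real.rpow_le_rpow (norm_nonneg _) (norm_sub_le_norm_sub_add_norm_sub _ _ _) α.2.1.le).trans
        (Real.rpow_add_le_add_rpow (norm_nonneg _) (norm_nonneg _) α.2.1.le α.2.2)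
    linarith
  eq_of_dist_eq_zero {x y} h := by
    have h₁ := Ω.subhypDist_nonneg α x.pt y.pt
    have h₂ := Real.rpow_nonneg (norm_nonneg (x.pt - y.pt)) α
    have h₃ : ‖x.pt - y.pt‖ ^ (α : ℝ) = 0 := by linarith
    rw [Real.rpow_eq_zero (norm_nonneg _) α.2.1.ne', norm_eq_zero, sub_eq_zero] at h₃
    exact Subtype.ext h₃

theorem Subhyp.dist_def {Ω : SpaceDomain n} {α : Ioc (0 : ℝ) 1} (x y : Ω.Subhyp α) :
    dist x y = Ω.subhypDist α x.pt y.pt + ‖x.pt - y.pt‖ ^ (α : ℝ) :=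
  rfl

theorem Subhyp.uniformContinuous_pt (Ω : SpaceDomain n) (α : Ioc (0 : ℝ) 1) :
    UniformContinuous (Subhyp.pt : Ω.Subhyp α → Fin n → ℝ) := by
  refine Metric.uniformContinuous_iff.2 fun ε hε =>
    ⟨ε ^ (α : ℝ), Real.rpow_pos_of_pos hε _, fun x y h => ?_⟩
  rw [Subhyp.dist_def] at h
  have h' : ‖x.pt - y.pt‖ ^ (α : ℝ) < ε ^ (α : ℝ) := by
    linarith [Ω.subhypDist_nonneg α x.pt y.pt]
  rw [dist_eq_norm]
  exact lt_of_not_ge fun hle => h'.not_ge (Real.rpow_le_rpow hε.le hle α.2.1.le)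

theorem Subhyp.uniformContinuous₂_subhypDist (Ω : SpaceDomain n) (α : Ioc (0 : ℝ) 1) :
    UniformContinuous₂ fun x y : Ω.Subhyp α => Ω.subhypDist α x.pt y.pt := by
  have key : ∀ x y : Ω.Subhyp α, Ω.subhypDist α x.pt y.pt ≤ dist x y := fun x y => by
    rw [Subhyp.dist_def]
    linarith [Real.rpow_nonneg (norm_nonneg (x.pt - y.pt)) α]
  refine Metric.uniformContinuous_iff.2 fun ε hε => ⟨ε / 2, half_pos hε, ?_⟩
  rintro ⟨a, b⟩ ⟨a', b'⟩ h
  obtain ⟨h₁, h₂⟩ := max_lt_iff.1 (Prod.dist_eq.symm.trans_lt h)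
  have ha := key a a'
  have hb := key b b'
  have t₁ := Subhyp.subhypDist_triangle a a' b
  have t₂ := Subhyp.subhypDist_triangle a' b' b
  have t₃ := Subhyp.subhypDist_triangle a' a b'
  have t₄ := Subhyp.subhypDist_triangle a b b'
  rw [Ω.subhypDist_comm α b'.pt b.pt] at t₂
  rw [Ω.subhypDist_comm α a'.pt a.pt] at t₃
  rw [Real.dist_eq]
  refine abs_lt.2 ⟨?_, ?_⟩ <;> simp only [Function.uncurry] at * <;> linarith

/-- The Cauchy completion `Ω_α` of `Ω` in the metric `d_{α,Ω}(x, y) + ‖x - y‖ ^ α`. -/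
abbrev SubhypCompletion (Ω : SpaceDomain n) (α : Ioc (0 : ℝ) 1) : Type :=
  Completion (Ω.Subhyp α)

/-- The `α`-boundary `∂_α Ω`: the boundary of `Ω` as a subset of its completion `Ω_α`. -/
def alphaBoundary (Ω : SpaceDomain n) (α : Ioc (0 : ℝ) 1) : Set (Ω.SubhypCompletion α) :=
  frontier (range ((↑) : Ω.Subhyp α → Ω.SubhypCompletion α))

/-- The limit `ℓ(ω)` in `ℝⁿ` of the Cauchy sequences that represent `ω ∈ Ω_α`: the continuous
extension to `Ω_α` of the inclusion of `Ω` in `ℝⁿ`. -/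
def limitPoint (Ω : SpaceDomain n) (α : Ioc (0 : ℝ) 1) : Ω.SubhypCompletion α → Fin n → ℝ :=
  Completion.extension (Subhyp.pt : Ω.Subhyp α → Fin n → ℝ)

/-- The extension of `d_{α,Ω}` by continuity to `Ω_α`: the limit of `d_{α,Ω}(x_i, y_i)` for
sequences `x_i → ω₁`, `y_i → ω₂`. -/
def closureDist (Ω : SpaceDomain n) (α : Ioc (0 : ℝ) 1) :
    Ω.SubhypCompletion α → Ω.SubhypCompletion α → ℝ :=
  Completion.extension₂ fun x y : Ω.Subhyp α => Ω.subhypDist α x.pt y.pt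

/-- Continuity of a function on `∂_α Ω` with respect to the completed subhyperbolic metric. -/
def IsSubhypContinuous (Ω : SpaceDomain n) (α : Ioc (0 : ℝ) 1) (f : Ω.alphaBoundary α → ℝ) :
    Prop :=
  ∀ ω : Ω.alphaBoundary α, ∀ ε > 0, ∃ δ > 0, ∀ ω' : Ω.alphaBoundary α,
    Ω.closureDist α ω ω' < δ → |f ω' - f ω| < ε

/-! ### Sobolev functions and their traces -/

/-- `g` is the distributional gradient of `F` on `Ω`. -/
def IsWeakGradient (Ω : SpaceDomain n) (F : (Fin n → ℝ) → ℝ) (g : (Fin n → ℝ) → Fin n → ℝ) :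
    Prop :=
  ∀ φ : (Fin n → ℝ) → ℝ, ContDiff ℝ (⊤ : ℕ∞) φ → HasCompactSupport φ → tsupport φ ⊆ Ω.carrier →
    ∀ i : Fin n, ∫ x in Ω.carrier, F x * fderiv ℝ φ x (Pi.single i 1) =
      -∫ x in Ω.carrier, g x i * φ x

/-- `F` is (on `Ω`) a continuous function of the homogeneous Sobolev space `L¹_p(Ω)` and `g ∈ L_p(Ω)`
is its distributional gradient. -/
structure IsSobolevWith (Ω : SpaceDomain n) (p : ℝ) (F : (Fin n → ℝ) → ℝ)
    (g : (Fin n → ℝ) → Fin n → ℝ) : Prop where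
  continuousOn : ContinuousOn F Ω.carrier
  isWeakGradient : Ω.IsWeakGradient F g
  memLp : MemLp g (ENNReal.ofReal p) (volume.restrict Ω.carrier)

/-- `f` is the trace of `F` to `∂_α Ω`: `f(ω)` is the limit of `F(x)` as `x ∈ Ω` tends to `ω`
in `Ω_α`. -/
def IsTrace (Ω : SpaceDomain n) (α : Ioc (0 : ℝ) 1) (F : (Fin n → ℝ) → ℝ)
    (f : Ω.alphaBoundary α → ℝ) : Prop :=
  ∀ ω : Ω.alphaBoundary α, Tendsto (fun x : Ω.Subhyp α => F x.pt)
    (comap ((↑) : Ω.Subhyp α → Ω.SubhypCompletion α) (𝓝 (ω : Ω.SubhypCompletion α))) (𝓝 (f ω))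

/-- `f` is the trace of a continuous function of `L¹_p(Ω)`. -/
def IsSobolevTrace (Ω : SpaceDomain n) (p : ℝ) (α : Ioc (0 : ℝ) 1)
    (f : Ω.alphaBoundary α → ℝ) : Prop :=
  ∃ F g, Ω.IsSobolevWith p F g ∧ Ω.IsTrace α F f

/-- The trace norm: the infimum of `‖∇F‖_{L_p(Ω)}` over the continuous `F ∈ L¹_p(Ω)` with
trace `f`. -/
def traceNorm (Ω : SpaceDomain n) (p : ℝ) (α : Ioc (0 : ℝ) 1) (f : Ω.alphaBoundary α → ℝ) : ℝ :=
  sInf {N : ℝ | ∃ F g, Ω.IsSobolevWith p F g ∧ Ω.IsTrace α F f ∧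
    N = (eLpNorm g (ENNReal.ofReal p) (volume.restrict Ω.carrier)).toReal}

end SpaceDomain

/-! ### Cubes and visibility -/

/-- A closed cube `Q(x, r)` with sides parallel to the axes, of positive side length `2r`. -/
structure AxisCube (n : ℕ) where
  /-- The center of the cube. -/
  center : Fin n → ℝ
  /-- Half of the side length. -/
  radius : ℝ
  radius_pos : 0 < radius

namespace AxisCube

variable {n : ℕ}

/-- The dilation `ηQ` of `Q` about its center. -/
def dilate (Q : AxisCube n) (η : ℝ) : Set (Fin n → ℝ) :=
  Metric.closedBall Q.center (η * Q.radius)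

/-- The points of the cube `Q`. -/
def toSet (Q : AxisCube n) : Set (Fin n → ℝ) :=
  Metric.closedBall Q.center Q.radius

end AxisCube

namespace SpaceDomain

variable {n : ℕ}

/-- The point `x` of the closure of `Ω` is `Q`-visible in `Ω`: for every `y ∈ Q` the semi-open
segment `(x, y]` lies in `Ω`. -/
def IsVisible (Ω : SpaceDomain n) (Q : AxisCube n) (x : Fin n → ℝ) : Prop :=
  x ∈ closure Ω.carrier ∧ ∀ y ∈ Q.toSet, AffineMap.lineMap x y '' Ioc (0 : ℝ) 1 ⊆ Ω.carrier

/-- `ω` is `(α, Q)`-visible in `Ω`: the point `ℓ(ω)` is `Q`-visible, and `ω` is represented by a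
sequence of points of the semi-open segment from `ℓ(ω)` to the center of `Q`. -/
def IsAlphaVisible (Ω : SpaceDomain n) (α : Ioc (0 : ℝ) 1) (Q : AxisCube n)
    (ω : Ω.SubhypCompletion α) : Prop :=
  Ω.IsVisible Q (Ω.limitPoint α ω) ∧
    ∃ y : ℕ → Ω.Subhyp α,
      (∀ i, (y i).pt ∈ AffineMap.lineMap (Ω.limitPoint α ω) Q.center '' Ioc (0 : ℝ) 1) ∧
      Tendsto (fun i => (y i : Ω.SubhypCompletion α)) atTop (𝓝 ω)

/-- The variational inequality with constant `lam`, for all finite families of pairwise disjoint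
cubes in `Ω` and all choices of visible boundary elements over the dilated cubes. -/
def VariationBound (Ω : SpaceDomain n) (p : ℝ) (α : Ioc (0 : ℝ) 1) (η : ℝ)
    (f : Ω.alphaBoundary α → ℝ) (lam : ℝ) : Prop :=
  ∀ (m : ℕ) (Q : Fin m → AxisCube n) (ω₁ ω₂ : Fin m → Ω.alphaBoundary α),
    (∀ i, (Q i).toSet ⊆ Ω.carrier) →
    (Pairwise fun i j => Disjoint (Q i).toSet (Q j).toSet) →
    (∀ i, Ω.IsAlphaVisible α (Q i) (ω₁ i) ∧ Ω.IsAlphaVisible α (Q i) (ω₂ i)) →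
    (∀ i, Ω.limitPoint α (ω₁ i) ∈ (Q i).dilate η ∩ frontier Ω.carrier ∧
      Ω.limitPoint α (ω₂ i) ∈ (Q i).dilate η ∩ frontier Ω.carrier) →
    ∑ i, |f (ω₁ i) - f (ω₂ i)| ^ p / Metric.diam (Q i).toSet ^ (p - n) ≤ lam

end SpaceDomain

end

/-! Necessity. If `ω` is visible from a cube `Q` of radius `r`, the whole cone with apex `ℓ(ω)` over
`Q` lies in `Ω`. Walk from the center of `Q` to `ℓ(ω)` along the axis through points with parameters
`t ^ k`, where the ball of radius `t ^ k * r / 2` is inside `Ω`. Morrey's inequality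
(`IsSobolevWith.enorm_sub_rpow_le`) bounds the `p`-th power of the `k`-th increment of `F` by a
constant times `(t ^ k * r) ^ (p - n)` times the energy in that ball. Since `p > n`, the powers of
`t` decay geometrically and the increments can be summed. For a family of disjoint cubes, the balls
of one level `k` overlap boundedly (`card_cone_ball_le`): an apex is outside `Ω`, hence outside
every other cone, which makes the radii of overlapping balls comparable. Summing over cubes and
levels compares `f(ω)` with `F` at the centers (`sum_sub_center_rpow_le`), and the two visible
elements over a cube are compared through its center. Continuity of `f` holds because on the
`α`-boundary `d_α` already dominates `‖ℓ(ω₁) - ℓ(ω₂)‖ ^ α` (`norm_limitPoint_sub_rpow_le`).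

Sufficiency. Take a Whitney-type net in `Ω`, give each net point `j` the value of `f` at a boundary
element lying over a nearest point of the complement, and interpolate by a partition of unity at the
scale `d_j` of the distance to the complement. On the cell of `j` the gradient is at most a constant
times `D_j / d_j`, where `D_j` is the largest difference of the values at `j` and a neighbour
(`norm_fderiv_extend_le`). The energy of the cell is therefore at most a constant times `D_j ^ p /
d_j ^ (p - n)`, which is a term of the variational sum for the cube of radius `d_j / 20` about `j`:
these cubes are disjoint, and each lies in the maximal ball of every neighbour, so the chosen
elements are visible from it (`exists_nearest_boundary_element`). The trace is right because near
`ω` only elements close to `ω` enter the mean (`isTrace_extend`). -/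

noncomputable section

namespace SpaceDomain

variable {n : ℕ}

/-! ### Estimates for the subhyperbolic metric -/

/-- The point `x` of `Ω`, as a point of the metric space `Ω.Subhyp α`. -/
def toSubhyp (Ω : SpaceDomain n) (α : Ioc (0 : ℝ) 1) (x : Fin n → ℝ) (hx : x ∈ Ω.carrier) :
    Ω.Subhyp α :=
  (⟨x, hx⟩ : ↥Ω.carrier)

@[simp]
theorem pt_toSubhyp (Ω : SpaceDomain n) (α : Ioc (0 : ℝ) 1) (x : Fin n → ℝ) (hx : x ∈ Ω.carrier) :
    (Ω.toSubhyp α x hx).pt = x :=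
  rfl

theorem ofReal_le_infEDist_frontier (Ω : SpaceDomain n) {x : Fin n → ℝ} {ρ : ℝ}
    (h : Metric.ball x ρ ⊆ Ω.carrier) :
    ENNReal.ofReal ρ ≤ Metric.infEDist x (frontier Ω.carrier) := by
  refine Metric.le_infEDist.2 fun w hw => ?_
  rw [edist_dist]
  refine ENNReal.ofReal_le_ofReal (le_of_not_gt fun hlt => ?_)
  rw [Ω.isOpen.frontier_eq] at hw
  exact hw.2 (h (Metric.mem_ball'.2 hlt))

theorem isArcLengthCurve_segment (Ω : SpaceDomain n) {x y : Fin n → ℝ} (hne : x ≠ y)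
    (h : ∀ u ∈ Icc (0 : ℝ) 1, AffineMap.lineMap x y u ∈ Ω.carrier) :
    Ω.IsArcLengthCurve x y ‖y - x‖ (fun s => AffineMap.lineMap x y (s / ‖y - x‖)) := by
  have hL : 0 < ‖y - x‖ := norm_pos_iff.2 (sub_ne_zero.2 hne.symm)
  have hiso : Isometry fun s : ℝ => (AffineMap.lineMap x y (s / ‖y - x‖) : Fin n → ℝ) :=
    Isometry.of_dist_eq fun s t => by
      rw [dist_lineMap_lineMap, Real.dist_eq, Real.dist_eq, ← sub_div, abs_div, abs_of_pos hL,
        dist_comm x y, dist_eq_norm, div_mul_cancel₀ _ hL.ne']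
  refine ⟨hL.le, ?_, by simp, by simp [hL.ne'], fun s hs =>
    h _ ⟨div_nonneg hs.1 hL.le, (div_le_one hL).2 hs.2⟩⟩
  refine hasConstantSpeedOnWith_iff_ordered.2 fun a ha b hb hab => ?_
  rw [inter_eq_right.2 (Icc_subset_Icc ha.1 hb.2)]
  have h1 : eVariationOn (fun s : ℝ => (AffineMap.lineMap x y (s / ‖y - x‖) : Fin n → ℝ))
      (Icc a b) = eVariationOn (id : ℝ → ℝ) (Icc a b) := by
    simp only [eVariationOn, hiso.edist_eq, id]
  rw [h1]
  refine le_antisymm ?_ ?_ <;> simp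

/-- If the `ρ`-neighbourhood of the segment `[x, y]` lies in `Ω`, then
`d_{α,Ω}(x, y) ≤ ‖y - x‖ ρ ^ (α - 1)`. -/
theorem subhypDist_le_of_ball_subset (Ω : SpaceDomain n) {α : ℝ} (hα : α ≤ 1) {x y : Fin n → ℝ}
    {ρ : ℝ} (hρ : 0 < ρ)
    (h : ∀ u ∈ Icc (0 : ℝ) 1, Metric.ball (AffineMap.lineMap x y u) ρ ⊆ Ω.carrier) :
    Ω.subhypDist α x y ≤ ‖y - x‖ * ρ ^ (α - 1) := by
  have hmem : ∀ u ∈ Icc (0 : ℝ) 1, AffineMap.lineMap x y u ∈ Ω.carrier := fun u hu =>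
    h u hu (Metric.mem_ball_self hρ)
  rcases eq_or_ne x y with rfl | hne
  · have : x ∈ Ω.carrier := by simpa using hmem 0 (by simp)
    simp [subhypDist, Ω.subhypEDist_self α this]
  have hL : 0 < ‖y - x‖ := norm_pos_iff.2 (sub_ne_zero.2 hne.symm)
  refine ENNReal.toReal_le_of_le_ofReal (by positivity) ?_
  refine iInf₂_le_of_le _ _ (iInf_le_of_le (Ω.isArcLengthCurve_segment hne hmem) ?_)
  have hbound : ∀ s ∈ Icc 0 ‖y - x‖,
      (Metric.infEDist (AffineMap.lineMap x y (s / ‖y - x‖)) (frontier Ω.carrier)) ^ (α - 1) ≤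
        ENNReal.ofReal (ρ ^ (α - 1)) := fun s hs => by
    rw [← ENNReal.ofReal_rpow_of_pos hρ, ← neg_sub 1 α, ENNReal.rpow_neg, ENNReal.rpow_neg]
    refine ENNReal.inv_le_inv.2 (ENNReal.rpow_le_rpow ?_ (by linarith))
    exact Ω.ofReal_le_infEDist_frontier
      (h _ ⟨div_nonneg hs.1 hL.le, (div_le_one hL).2 hs.2⟩)
  refine (setLIntegral_mono' measurableSet_Icc hbound).trans ?_
  rw [setLIntegral_const, Real.volume_Icc, sub_zero, mul_comm, ← ENNReal.ofReal_mul hL.le]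

theorem lineMap_lineMap_lineMap (a b : Fin n → ℝ) (s t u : ℝ) :
    AffineMap.lineMap (AffineMap.lineMap a b s : Fin n → ℝ) (AffineMap.lineMap a b t) u =
      (AffineMap.lineMap a b (s + u * (t - s)) : Fin n → ℝ) := by
  ext i
  simp only [AffineMap.lineMap_apply, vsub_eq_sub, vadd_eq_add, Pi.add_apply, Pi.smul_apply,
    Pi.sub_apply, smul_eq_mul]
  ring

/-- `Ω` contains, with the segment `(a, b]`, the balls of radius `u r` about its points
`a + u (b - a)`. -/
def ContainsCone (Ω : SpaceDomain n) (a b : Fin n → ℝ) (r : ℝ) : Prop :=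
  0 < r ∧ ∀ u ∈ Ioc (0 : ℝ) 1, Metric.ball (AffineMap.lineMap a b u) (u * r) ⊆ Ω.carrier

theorem ContainsCone.mem {Ω : SpaceDomain n} {a b : Fin n → ℝ} {r u : ℝ}
    (h : Ω.ContainsCone a b r) (hu : u ∈ Ioc (0 : ℝ) 1) :
    AffineMap.lineMap a b u ∈ Ω.carrier :=
  h.2 u hu (Metric.mem_ball_self (mul_pos hu.1 h.1))

/-- Between the parameters `u / 2` and `u` the cone leaves room `u * r / 2` around the segment, so
this piece costs at most `V * (u / 2) ^ α`. Halving repeatedly gives a geometric series of ratio `2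
^ (-α)`, whose sum produces the factor `1 / (2 ^ α - 1)`. The bound is uniform in `s`, so the
segment is Cauchy at its apex. -/
theorem ContainsCone.subhypDist_le {Ω : SpaceDomain n} (α : Ioc (0 : ℝ) 1) {a b : Fin n → ℝ}
    {r : ℝ} (h : Ω.ContainsCone a b r) {s u : ℝ} (hs : 0 < s) (hsu : s ≤ u) (hu : u ≤ 1) :
    Ω.subhypDist α (AffineMap.lineMap a b s) (AffineMap.lineMap a b u) ≤
      ‖b - a‖ * r ^ ((α : ℝ) - 1) / (2 ^ (α : ℝ) - 1) * u ^ (α : ℝ) := by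
  obtain ⟨hr, hball⟩ := id h
  have hα0 := α.2.1
  have h2 : (1 : ℝ) < 2 ^ (α : ℝ) := Real.one_lt_rpow (by norm_num) hα0
  set V := ‖b - a‖ * r ^ ((α : ℝ) - 1) with hV
  have hV0 : 0 ≤ V := by positivity
  set M := V / (2 ^ (α : ℝ) - 1) with hM
  have hMV : M * (2 ^ (α : ℝ) - 1) = V := div_mul_cancel₀ _ (by linarith)
  have hM0 : 0 ≤ M := div_nonneg hV0 (by linarith)
  have half : ∀ s u : ℝ, 0 < s → s ≤ u → u ≤ 1 → u / 2 ≤ s →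
      Ω.subhypDist α (AffineMap.lineMap a b s) (AffineMap.lineMap a b u) ≤
        V * (u / 2) ^ (α : ℝ) := by
    intro s u hs hsu hu hus
    have hu0 : 0 < u := hs.trans_le hsu
    have hur : 0 < u / 2 * r := by positivity
    refine (Ω.subhypDist_le_of_ball_subset α.2.2 hur fun v hv => ?_).trans ?_
    · rw [lineMap_lineMap_lineMap]
      have h1 : 0 ≤ v * (u - s) := mul_nonneg hv.1 (by linarith)
      have h2 : v * (u - s) ≤ 1 * (u - s) := mul_le_mul_of_nonneg_right hv.2 (by linarith)
      refine Subset.trans (Metric.ball_subset_ball ?_)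
        (hball (s + v * (u - s)) ⟨by linarith, by linarith⟩)
      exact mul_le_mul_of_nonneg_right (by linarith) hr.le
    · rw [← dist_eq_norm, dist_lineMap_lineMap, Real.dist_eq, abs_of_nonneg (by linarith),
        Real.mul_rpow (by positivity) hr.le, dist_comm a b, dist_eq_norm]
      have e : (u / 2) ^ (α : ℝ) = (u / 2) * (u / 2) ^ ((α : ℝ) - 1) := by
        rw [Real.rpow_sub_one (by positivity)]
        field_simp
      rw [e, hV]
      have : (u - s) * (‖b - a‖ * ((u / 2) ^ ((α : ℝ) - 1) * r ^ ((α : ℝ) - 1))) ≤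
          (u / 2) * (‖b - a‖ * ((u / 2) ^ ((α : ℝ) - 1) * r ^ ((α : ℝ) - 1))) :=
        mul_le_mul_of_nonneg_right (by linarith) (by positivity)
      linarith
  have e2 : ∀ u : ℝ, 0 < u → (u / 2) ^ (α : ℝ) * 2 ^ (α : ℝ) = u ^ (α : ℝ) := fun u hu => by
    rw [← Real.mul_rpow (by positivity) (by norm_num), div_mul_cancel₀ _ (by norm_num)]
  have main : ∀ (k : ℕ) (s u : ℝ), 0 < s → s ≤ u → u ≤ 1 → u / 2 ^ k ≤ s →
      Ω.subhypDist α (AffineMap.lineMap a b s) (AffineMap.lineMap a b u) ≤ M * u ^ (α : ℝ) := by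
    intro k
    induction k with
    | zero =>
      intro s u hs hsu hu hk
      have : s = u := le_antisymm hsu (by simpa using hk)
      subst this
      have h0 : 0 ≤ M * s ^ (α : ℝ) := by positivity
      simpa [subhypDist, Ω.subhypEDist_self α (h.mem ⟨hs, hu⟩)] using h0
    | succ k ih =>
      intro s u hs hsu hu hk
      have hu0 : 0 < u := hs.trans_le hsu
      have hp : 0 < (u / 2) ^ (α : ℝ) := by positivity
      have e := e2 u hu0
      rcases le_total (u / 2) s with hc | hc
      · refine (half s u hs hsu hu hc).trans ?_
        rw [← e, ← hMV]
        nlinarith [mul_nonneg hM0 hp.le]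
      · have t := Subhyp.subhypDist_triangle (α := α) (Ω.toSubhyp α _ (h.mem ⟨hs, by linarith⟩))
          (Ω.toSubhyp α _ (h.mem (u := u / 2) ⟨by linarith, by linarith⟩))
          (Ω.toSubhyp α _ (h.mem ⟨hu0, hu⟩))
        simp only [pt_toSubhyp] at t
        have t1 := ih s (u / 2) hs hc (by linarith) (by
          rw [pow_succ] at hk
          rwa [div_div, mul_comm])
        have t2 := half (u / 2) u (by linarith) (by linarith) hu le_rfl
        rw [← e]
        nlinarith
  obtain ⟨k, hk⟩ := pow_unbounded_of_one_lt (u / s) (one_lt_two (α := ℝ))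
  refine main k s u hs hsu hu ?_
  rw [div_lt_iff₀ hs] at hk
  rw [div_le_iff₀ (by positivity)]
  linarith

/-- The constant in the distance from a point of the segment `(a, b]` to its end at `a`. -/
def coneConst (α : Ioc (0 : ℝ) 1) (a b : Fin n → ℝ) (r : ℝ) : ℝ :=
  ‖b - a‖ * r ^ ((α : ℝ) - 1) / (2 ^ (α : ℝ) - 1) + ‖b - a‖ ^ (α : ℝ)

theorem ContainsCone.dist_le {Ω : SpaceDomain n} (α : Ioc (0 : ℝ) 1) {a b : Fin n → ℝ}
    {r : ℝ} (h : Ω.ContainsCone a b r) {s u : ℝ} (hs : 0 < s) (hsu : s ≤ u) (hu : u ≤ 1) :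
    dist (Ω.toSubhyp α _ (h.mem ⟨hs, hsu.trans hu⟩))
      (Ω.toSubhyp α _ (h.mem ⟨hs.trans_le hsu, hu⟩)) ≤ coneConst α a b r * u ^ (α : ℝ) := by
  rw [Subhyp.dist_def, pt_toSubhyp, pt_toSubhyp, coneConst, add_mul]
  refine add_le_add (h.subhypDist_le α hs hsu hu) ?_
  rw [← dist_eq_norm, dist_lineMap_lineMap, Real.dist_eq, abs_sub_comm,
    abs_of_nonneg (by linarith), dist_comm a b, dist_eq_norm,
    ← Real.mul_rpow (norm_nonneg _) (by linarith), mul_comm]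
  exact Real.rpow_le_rpow (mul_nonneg (norm_nonneg _) (by linarith))
    (mul_le_mul_of_nonneg_left (by linarith) (norm_nonneg _)) α.2.1.le

/-- A curve from `x` to `y` has length at least `‖x - y‖`, and on its initial piece of that length
the distance to the frontier is at most `d + ‖x - y‖`; since `α ≤ 1`, this bounds the integrand from
below. With the power on the right-hand side the inequality passes by continuity to boundary
elements, where `d = 0`. -/
theorem le_subhypDist_mul (Ω : SpaceDomain n) (α : Ioc (0 : ℝ) 1)
    (hne : (frontier Ω.carrier).Nonempty) {x y : Fin n → ℝ}
    (hx : x ∈ Ω.carrier) (hy : y ∈ Ω.carrier) :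
    ‖x - y‖ ≤ Ω.subhypDist α x y *
      (Metric.infDist x (frontier Ω.carrier) + ‖x - y‖) ^ (1 - (α : ℝ)) := by
  rcases eq_or_ne x y with rfl | hxy
  · simpa using mul_nonneg (Ω.subhypDist_nonneg α x x) (Real.rpow_nonneg Metric.infDist_nonneg _)
  set d := Metric.infDist x (frontier Ω.carrier) with hd
  set L := ‖x - y‖ with hL
  have hL0 : 0 < L := norm_pos_iff.2 (sub_ne_zero.2 hxy)
  have hd0 : 0 ≤ d := Metric.infDist_nonneg
  have hpos : 0 < d + L := by linarith
  have key : ENNReal.ofReal (L * (d + L) ^ ((α : ℝ) - 1)) ≤ Ω.subhypEDist α x y := by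
    refine le_iInf₂ fun L' γ => le_iInf fun h => ?_
    have hvar : ∀ s ∈ Icc 0 L', edist (γ 0) (γ s) ≤ ENNReal.ofReal s := fun s hs => by
      have h1 := h.unitSpeed (left_mem_Icc.2 h.nonneg) hs
      have h2 := eVariationOn.edist_le γ (s := Icc 0 L' ∩ Icc 0 s)
        ⟨left_mem_Icc.2 h.nonneg, left_mem_Icc.2 hs.1⟩ ⟨hs, right_mem_Icc.2 hs.1⟩
      rw [h1] at h2
      simpa using h2
    have hLL : L ≤ L' := by
      have h1 := hvar L' (right_mem_Icc.2 h.nonneg)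
      rw [h.source, h.target, edist_dist, dist_eq_norm] at h1
      exact (ENNReal.ofReal_le_ofReal_iff h.nonneg).1 h1
    have hpt : ∀ s ∈ Icc 0 L, ENNReal.ofReal ((d + L) ^ ((α : ℝ) - 1)) ≤
        (Metric.infEDist (γ s) (frontier Ω.carrier)) ^ ((α : ℝ) - 1) := fun s hs => by
      rw [← ENNReal.ofReal_rpow_of_pos hpos, ← neg_sub, ENNReal.rpow_neg, ENNReal.rpow_neg]
      refine ENNReal.inv_le_inv.2 (ENNReal.rpow_le_rpow ?_ (by linarith [α.2.2]))
      refine (Metric.infEDist_le_infEDist_add_edist (y := γ 0)).trans ?_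
      rw [h.source, ENNReal.ofReal_add hd0 hL0.le, hd, Metric.infDist,
        ENNReal.ofReal_toReal (Metric.infEDist_ne_top hne)]
      refine add_le_add le_rfl ?_
      have h1 := hvar s ⟨hs.1, hs.2.trans hLL⟩
      rw [h.source, edist_comm] at h1
      exact h1.trans (ENNReal.ofReal_le_ofReal hs.2)
    calc ENNReal.ofReal (L * (d + L) ^ ((α : ℝ) - 1))
        = ∫⁻ _ in Icc 0 L, ENNReal.ofReal ((d + L) ^ ((α : ℝ) - 1)) := by
          rw [setLIntegral_const, Real.volume_Icc, sub_zero, mul_comm, ← ENNReal.ofReal_mul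
            (by positivity)]
      _ ≤ ∫⁻ s in Icc 0 L, (Metric.infEDist (γ s) (frontier Ω.carrier)) ^ ((α : ℝ) - 1) :=
          setLIntegral_mono' measurableSet_Icc hpt
      _ ≤ _ := lintegral_mono_set (Icc_subset_Icc_right hLL)
  have h1 : L * (d + L) ^ ((α : ℝ) - 1) ≤ Ω.subhypDist α x y :=
    (ENNReal.ofReal_le_iff_le_toReal (Ω.subhypEDist_ne_top α.2.2 hx hy)).1 key
  calc L = L * (d + L) ^ ((α : ℝ) - 1) * (d + L) ^ (1 - (α : ℝ)) := by
        rw [mul_assoc, ← Real.rpow_add hpos]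
        simp
    _ ≤ _ := mul_le_mul_of_nonneg_right h1 (by positivity)

/-! ### The completion and the `α`-boundary -/

theorem limitPoint_coe (Ω : SpaceDomain n) (α : Ioc (0 : ℝ) 1) (x : Ω.Subhyp α) :
    Ω.limitPoint α x = x.pt :=
  Completion.extension_coe (Subhyp.uniformContinuous_pt Ω α) x

theorem continuous_limitPoint (Ω : SpaceDomain n) (α : Ioc (0 : ℝ) 1) :
    Continuous (Ω.limitPoint α) :=
  Completion.continuous_extension

theorem closureDist_coe (Ω : SpaceDomain n) (α : Ioc (0 : ℝ) 1) (x y : Ω.Subhyp α) :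
    Ω.closureDist α x y = Ω.subhypDist α x.pt y.pt :=
  Completion.extension₂_coe_coe (Subhyp.uniformContinuous₂_subhypDist Ω α) x y

theorem continuous_closureDist (Ω : SpaceDomain n) (α : Ioc (0 : ℝ) 1) :
    Continuous fun q : Ω.SubhypCompletion α × Ω.SubhypCompletion α =>
      Ω.closureDist α q.1 q.2 :=
  (Completion.uniformContinuous_extension₂ _).continuous

theorem dist_eq_closureDist_add (Ω : SpaceDomain n) (α : Ioc (0 : ℝ) 1)
    (ω₁ ω₂ : Ω.SubhypCompletion α) :
    dist ω₁ ω₂ = Ω.closureDist α ω₁ ω₂ + ‖Ω.limitPoint α ω₁ - Ω.limitPoint α ω₂‖ ^ (α : ℝ) := by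
  have hl := Ω.continuous_limitPoint α
  have hc := Ω.continuous_closureDist α
  induction ω₁, ω₂ using Completion.induction_on₂ with
  | hp =>
    refine isClosed_eq continuous_dist (hc.add (Continuous.rpow_const ?_ fun _ => Or.inr α.2.1.le))
    fun_prop
  | ih x y => rw [Completion.dist_eq, closureDist_coe, limitPoint_coe, limitPoint_coe,
      Subhyp.dist_def]

theorem closureDist_le_dist (Ω : SpaceDomain n) (α : Ioc (0 : ℝ) 1)
    (ω₁ ω₂ : Ω.SubhypCompletion α) : Ω.closureDist α ω₁ ω₂ ≤ dist ω₁ ω₂ := by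
  rw [dist_eq_closureDist_add]
  exact le_add_of_nonneg_right (Real.rpow_nonneg (norm_nonneg _) _)

theorem limitPoint_mem_closure (Ω : SpaceDomain n) (α : Ioc (0 : ℝ) 1)
    (ω : Ω.SubhypCompletion α) : Ω.limitPoint α ω ∈ closure Ω.carrier := by
  induction ω using Completion.induction_on with
  | hp => exact isClosed_closure.preimage (Ω.continuous_limitPoint α)
  | ih x => exact limitPoint_coe Ω α x ▸ subset_closure x.pt_mem

/-- In `Ω`, convergence in `ℝⁿ` implies convergence in the subhyperbolic metric. -/
theorem mem_range_of_limitPoint_mem (Ω : SpaceDomain n) (α : Ioc (0 : ℝ) 1)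
    {ω : Ω.SubhypCompletion α} (h : Ω.limitPoint α ω ∈ Ω.carrier) :
    ω ∈ range ((↑) : Ω.Subhyp α → Ω.SubhypCompletion α) := by
  set x := Ω.limitPoint α ω with hx
  obtain ⟨ε, hε, hεΩ⟩ := Metric.isOpen_iff.1 Ω.isOpen x h
  refine ⟨Ω.toSubhyp α x h, ?_⟩
  have hnb : (comap ((↑) : Ω.Subhyp α → Ω.SubhypCompletion α) (𝓝 ω)).NeBot :=
    Completion.isDenseInducing_coe.comap_nhds_neBot ω
  have t1 : Tendsto ((↑) : Ω.Subhyp α → Ω.SubhypCompletion α)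
      (comap ((↑) : Ω.Subhyp α → Ω.SubhypCompletion α) (𝓝 ω)) (𝓝 ω) := tendsto_comap
  have t2 : Tendsto (Subhyp.pt : Ω.Subhyp α → Fin n → ℝ)
      (comap ((↑) : Ω.Subhyp α → Ω.SubhypCompletion α) (𝓝 ω)) (𝓝 x) := by
    have := ((Ω.continuous_limitPoint α).tendsto ω).comp t1
    simpa [Function.comp_def, limitPoint_coe] using this
  -- For `y` within `ε / 2` of `x`, the segment to `x` keeps the `ε / 2`-ball about each of its
  -- points in `Ω`, so this expression dominates the metric.
  have t3 : Tendsto (fun y : Ω.Subhyp α => ‖y.pt - x‖ * (ε / 2) ^ ((α : ℝ) - 1) +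
      ‖y.pt - x‖ ^ (α : ℝ))
      (comap ((↑) : Ω.Subhyp α → Ω.SubhypCompletion α) (𝓝 ω)) (𝓝 0) := by
    have h0 : Tendsto (fun y : Ω.Subhyp α => ‖y.pt - x‖)
      (comap ((↑) : Ω.Subhyp α → Ω.SubhypCompletion α) (𝓝 ω)) (𝓝 0) := by
      simpa using (t2.sub_const x).norm
    have h1 := h0.rpow_const (p := (α : ℝ)) (Or.inr α.2.1.le)
    rw [Real.zero_rpow α.2.1.ne'] at h1
    simpa using (h0.mul_const _).add h1
  have t4 : Tendsto ((↑) : Ω.Subhyp α → Ω.SubhypCompletion α)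
      (comap ((↑) : Ω.Subhyp α → Ω.SubhypCompletion α) (𝓝 ω))
      (𝓝 (Ω.toSubhyp α x h : Ω.SubhypCompletion α)) := by
    rw [tendsto_iff_dist_tendsto_zero]
    refine squeeze_zero' (Eventually.of_forall fun _ => dist_nonneg) ?_ t3
    filter_upwards [t2 (Metric.ball_mem_nhds x (half_pos hε))] with y hy
    rw [Completion.dist_eq, Subhyp.dist_def, pt_toSubhyp]
    refine add_le_add ?_ le_rfl
    rw [norm_sub_rev]
    refine Ω.subhypDist_le_of_ball_subset α.2.2 (half_pos hε) fun u hu =>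
      (Metric.ball_subset_ball' ?_).trans hεΩ
    rw [dist_lineMap_right, Real.norm_eq_abs, abs_of_nonneg (by linarith [hu.2])]
    have hy' : dist y.pt x < ε / 2 := hy
    nlinarith [dist_nonneg (x := y.pt) (y := x), hu.1]
  exact tendsto_nhds_unique t4 t1

/-- The range of `Ω` is the preimage of the open set `Ω` under `ℓ`, hence open, and it is dense; its
frontier is thus its complement. -/
theorem mem_alphaBoundary_iff (Ω : SpaceDomain n) (α : Ioc (0 : ℝ) 1)
    {ω : Ω.SubhypCompletion α} :
    ω ∈ Ω.alphaBoundary α ↔ Ω.limitPoint α ω ∈ frontier Ω.carrier := by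
  rw [Ω.isOpen.frontier_eq, alphaBoundary, frontier, Completion.denseRange_coe.closure_eq]
  refine ⟨fun h => ⟨Ω.limitPoint_mem_closure α ω, fun h' => h.2 ?_⟩, fun h => ⟨mem_univ _, fun h' =>
    h.2 ?_⟩⟩
  · exact mem_interior.2 ⟨Ω.limitPoint α ⁻¹' Ω.carrier, fun ω' hω' =>
      Ω.mem_range_of_limitPoint_mem α hω', Ω.isOpen.preimage (Ω.continuous_limitPoint α), h'⟩
  · obtain ⟨x, rfl⟩ := interior_subset h'
    rw [limitPoint_coe]
    exact x.pt_mem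

/-- Over the frontier the term `d` of `le_subhypDist_mul` vanishes and a power of the norm cancels.
As a result `closureDist` and the metric of the completion are comparable on the `α`-boundary,
although only the latter contains the Euclidean term. -/
theorem norm_limitPoint_sub_rpow_le (Ω : SpaceDomain n) (α : Ioc (0 : ℝ) 1)
    (ω₁ ω₂ : Ω.alphaBoundary α) :
    ‖Ω.limitPoint α ω₁ - Ω.limitPoint α ω₂‖ ^ (α : ℝ) ≤ Ω.closureDist α ω₁ ω₂ := by
  have h₁ := (Ω.mem_alphaBoundary_iff α).1 ω₁.2
  have hne : (frontier Ω.carrier).Nonempty := ⟨_, h₁⟩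
  have hl := Ω.continuous_limitPoint α
  have hc := Ω.continuous_closureDist α
  have key : ∀ ω₁ ω₂ : Ω.SubhypCompletion α,
      ‖Ω.limitPoint α ω₁ - Ω.limitPoint α ω₂‖ ≤ Ω.closureDist α ω₁ ω₂ *
        (Metric.infDist (Ω.limitPoint α ω₁) (frontier Ω.carrier) +
          ‖Ω.limitPoint α ω₁ - Ω.limitPoint α ω₂‖) ^ (1 - (α : ℝ)) := by
    intro ω₁ ω₂
    induction ω₁, ω₂ using Completion.induction_on₂ with
    | hp =>
      refine isClosed_le (by fun_prop) (hc.mul (Continuous.rpow_const ?_ fun _ =>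
        Or.inr (by linarith [α.2.2])))
      exact ((Metric.continuous_infDist_pt _).comp (hl.comp continuous_fst)).add (by fun_prop)
    | ih x y =>
      rw [closureDist_coe, limitPoint_coe, limitPoint_coe]
      exact Ω.le_subhypDist_mul α hne x.pt_mem y.pt_mem
  have h := key ω₁ ω₂
  rw [Metric.infDist_zero_of_mem h₁, zero_add] at h
  have hcl : 0 ≤ Ω.closureDist α ω₁ ω₂ := by
    generalize (ω₁ : Ω.SubhypCompletion α) = w₁
    generalize (ω₂ : Ω.SubhypCompletion α) = w₂
    induction w₁, w₂ using Completion.induction_on₂ with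
    | hp => exact isClosed_le continuous_const hc
    | ih x y => exact closureDist_coe Ω α x y ▸ Ω.subhypDist_nonneg _ _ _
  rcases (norm_nonneg (Ω.limitPoint α ω₁ - Ω.limitPoint α ω₂)).eq_or_lt with h0 | h0
  · rw [← h0, Real.zero_rpow α.2.1.ne']
    exact hcl
  · have e : ‖Ω.limitPoint α ω₁ - Ω.limitPoint α ω₂‖ ^ (α : ℝ) *
        ‖Ω.limitPoint α ω₁ - Ω.limitPoint α ω₂‖ ^ (1 - (α : ℝ)) =
        ‖Ω.limitPoint α ω₁ - Ω.limitPoint α ω₂‖ := by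
      rw [← Real.rpow_add h0]
      simp
    exact le_of_mul_le_mul_right (e.trans_le h) (by positivity)

/-- If points of the segment `(a, b]` tend to `ω` over `a`, then all points of the segment that are
close to `a` are close to `ω`. -/
theorem ContainsCone.dist_limit_le {Ω : SpaceDomain n} {α : Ioc (0 : ℝ) 1} {a b : Fin n → ℝ}
    {r : ℝ} (h : Ω.ContainsCone a b r) {ω : Ω.SubhypCompletion α} (t : ℕ → ℝ)
    (ht : ∀ i, t i ∈ Ioc (0 : ℝ) 1) (ht0 : Tendsto t atTop (𝓝 0))
    (hω : Tendsto (fun i => (Ω.toSubhyp α _ (h.mem (ht i)) : Ω.SubhypCompletion α)) atTop (𝓝 ω))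
    {u : ℝ} (hu : u ∈ Ioc (0 : ℝ) 1) :
    dist (Ω.toSubhyp α _ (h.mem hu) : Ω.SubhypCompletion α) ω ≤
      coneConst α a b r * u ^ (α : ℝ) := by
  refine le_of_tendsto (tendsto_const_nhds.dist hω) ?_
  filter_upwards [ht0.eventually (gt_mem_nhds hu.1)] with i hi
  rw [Completion.dist_eq, dist_comm]
  exact h.dist_le α (ht i).1 hi.le hu.2

/-- The points with parameters `2 ^ (-i)` form a Cauchy sequence by `ContainsCone.dist_le`. This
creates an element of the completion over the apex of any cone. -/
theorem ContainsCone.exists_limit {Ω : SpaceDomain n} (α : Ioc (0 : ℝ) 1) {a b : Fin n → ℝ}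
    {r : ℝ} (h : Ω.ContainsCone a b r) :
    ∃ ω : Ω.SubhypCompletion α, Ω.limitPoint α ω = a ∧ ∀ u (hu : u ∈ Ioc (0 : ℝ) 1),
      dist (Ω.toSubhyp α _ (h.mem hu) : Ω.SubhypCompletion α) ω ≤
        coneConst α a b r * u ^ (α : ℝ) := by
  set t : ℕ → ℝ := fun i => (1 / 2) ^ i with htdef
  have ht : ∀ i, t i ∈ Ioc (0 : ℝ) 1 := fun i =>
    ⟨by positivity, pow_le_one₀ (by norm_num) (by norm_num)⟩
  have ht0 : Tendsto t atTop (𝓝 0) :=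
    tendsto_pow_atTop_nhds_zero_of_lt_one (by norm_num) (by norm_num)
  have hmono : ∀ i j, i ≤ j → t j ≤ t i := fun i j hij =>
    pow_le_pow_of_le_one (by norm_num) (by norm_num) hij
  have hb0 : Tendsto (fun i => coneConst α a b r * t i ^ (α : ℝ)) atTop (𝓝 0) := by
    have := (ht0.rpow_const (p := (α : ℝ)) (Or.inr α.2.1.le)).const_mul (coneConst α a b r)
    simpa [Real.zero_rpow α.2.1.ne'] using this
  have hC : CauchySeq fun i => (Ω.toSubhyp α _ (h.mem (ht i)) : Ω.SubhypCompletion α) :=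
    cauchySeq_of_le_tendsto_0' _ (fun i j hij => by
      rw [Completion.dist_eq, dist_comm]
      exact h.dist_le α (ht j).1 (hmono i j hij) (ht i).2) hb0
  obtain ⟨ω, hω⟩ := cauchySeq_tendsto_of_complete hC
  refine ⟨ω, ?_, fun u hu => h.dist_limit_le t ht ht0 hω hu⟩
  have h1 := ((Ω.continuous_limitPoint α).tendsto ω).comp hω
  simp only [Function.comp_def, limitPoint_coe, pt_toSubhyp] at h1
  have h2 : Tendsto (fun i => (AffineMap.lineMap a b (t i) : Fin n → ℝ)) atTop (𝓝 a) := by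
    have : Continuous fun s : ℝ => (AffineMap.lineMap a b s : Fin n → ℝ) :=
      AffineMap.lineMap_continuous
    simpa [Function.comp_def] using (this.tendsto 0).comp ht0
  exact tendsto_nhds_unique h1 h2

end SpaceDomain

/-! ### The Morrey inequality -/

/-- Hölder's inequality with a weight. -/
theorem lintegral_mul_le_lintegral_rpow_mul {X : Type*} [MeasurableSpace X] (μ : Measure X) {p : ℝ}
    (hp : 1 ≤ p) {h w : X → ℝ≥0∞} (hh : AEMeasurable h μ) (hw : AEMeasurable w μ) :
    ∫⁻ x, h x * w x ∂μ ≤ (∫⁻ x, h x ^ p * w x ∂μ) ^ (1 / p) * (∫⁻ x, w x ∂μ) ^ (1 - 1 / p) := by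
  have hp0 : 0 < p := by linarith
  have h1 : 1 / p ≤ 1 := (div_le_one hp0).2 hp
  refine le_trans (le_of_eq ?_) (ENNReal.lintegral_mul_norm_pow_le (f := fun x => h x ^ p * w x)
    (g := w) ((hh.pow_const p).mul hw) hw (by positivity) (sub_nonneg.2 h1) (by ring))
  refine lintegral_congr fun x => ?_
  rw [ENNReal.mul_rpow_of_nonneg _ _ (by positivity), ← ENNReal.rpow_mul,
    mul_one_div_cancel hp0.ne', ENNReal.rpow_one, mul_assoc,
    ← ENNReal.rpow_add_of_nonneg _ _ (by positivity) (sub_nonneg.2 h1), add_sub_cancel,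
    ENNReal.rpow_one]

section Smooth

variable {n : ℕ}

/-- The homothety of ratio `t` about `x` maps the convex set `B` into itself and scales volume by `t
^ n`. -/
theorem setLIntegral_comp_lineMap_le {B : Set (Fin n → ℝ)} (hB : Convex ℝ B)
    (hBm : MeasurableSet B) {x : Fin n → ℝ} (hx : x ∈ B) {H : (Fin n → ℝ) → ℝ≥0∞}
    (hH : Measurable H) {t : ℝ} (ht : t ∈ Ioc (0 : ℝ) 1) :
    ∫⁻ y in B, H (AffineMap.lineMap x y t) ≤ ENNReal.ofReal ((t ^ n)⁻¹) * ∫⁻ y in B, H y := by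
  have hm : Measurable (B.indicator H) := hH.indicator hBm
  rw [← lintegral_indicator hBm, ← lintegral_indicator hBm]
  calc ∫⁻ y, B.indicator (fun y => H (AffineMap.lineMap x y t)) y
      ≤ ∫⁻ y, B.indicator H (t • (y - x) + x) := by
        refine lintegral_mono fun y => ?_
        by_cases hy : y ∈ B
        · have : AffineMap.lineMap x y t ∈ B :=
            hB.lineMap_mem hx hy ⟨ht.1.le, ht.2⟩
          rw [indicator_of_mem hy]
          rw [AffineMap.lineMap_apply, vsub_eq_sub, vadd_eq_add] at this ⊢
          rw [indicator_of_mem this]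
        · rw [indicator_of_notMem hy]
          exact bot_le
    _ = ∫⁻ y, B.indicator H (t • y + x) :=
        lintegral_sub_right_eq_self (fun y => B.indicator H (t • y + x)) x
    _ = ∫⁻ y, B.indicator H (y + x) ∂(Measure.map (fun y : Fin n → ℝ => t • y) volume) :=
        (lintegral_map (f := fun y => B.indicator H (y + x)) (by fun_prop) (by fun_prop)).symm
    _ = ENNReal.ofReal ((t ^ n)⁻¹) * ∫⁻ y, B.indicator H y := by
        rw [Measure.map_addHaar_smul _ ht.1.ne', lintegral_smul_measure,
          lintegral_add_right_eq_self, Module.finrank_fin_fun,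
          abs_of_nonneg (inv_nonneg.2 (pow_nonneg ht.1.le n)), smul_eq_mul]

theorem enorm_sub_le_lintegral_fderiv {G : (Fin n → ℝ) → ℝ} (hG : ContDiff ℝ 1 G)
    (x y : Fin n → ℝ) :
    ‖G y - G x‖ₑ ≤ ∫⁻ t in Ioc (0 : ℝ) 1, ‖fderiv ℝ G (AffineMap.lineMap x y t)‖ₑ * ‖y - x‖ₑ := by
  have hc : Continuous fun t : ℝ => fderiv ℝ G (AffineMap.lineMap x y t) (y - x) :=
    ((hG.continuous_fderiv one_ne_zero).comp AffineMap.lineMap_continuous).clm_apply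
      continuous_const
  have hd : ∀ t ∈ uIcc (0 : ℝ) 1, HasDerivAt (fun t : ℝ => G (AffineMap.lineMap x y t))
      (fderiv ℝ G (AffineMap.lineMap x y t) (y - x)) t := fun t _ =>
    (hG.differentiable one_ne_zero _).hasFDerivAt.comp_hasDerivAt t AffineMap.hasDerivAt_lineMap
  have h := intervalIntegral.integral_eq_sub_of_hasDerivAt hd (hc.intervalIntegrable 0 1)
  simp only [AffineMap.lineMap_apply_one, AffineMap.lineMap_apply_zero] at h
  rw [← h, intervalIntegral.integral_of_le zero_le_one]
  refine (enorm_integral_le_lintegral_enorm _).trans (lintegral_mono fun t => ?_)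
  exact ContinuousLinearMap.le_opENorm _ _

theorem lintegral_rpow_neg_Ioc {q : ℝ} (hq : q < 1) :
    ∫⁻ t in Ioc (0 : ℝ) 1, ENNReal.ofReal (t ^ (-q)) = ENNReal.ofReal (1 / (1 - q)) := by
  have hi : IntegrableOn (fun t : ℝ => t ^ (-q)) (Ioc 0 1) :=
    (intervalIntegrable_iff_integrableOn_Ioc_of_le zero_le_one).1
      (intervalIntegral.intervalIntegrable_rpow' (by linarith))
  rw [← ofReal_integral_eq_lintegral_ofReal hi, ← intervalIntegral.integral_of_le zero_le_one,
    integral_rpow (Or.inl (by linarith)), Real.one_rpow, Real.zero_rpow (by linarith)]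
  · congr 1
    ring
  · filter_upwards [ae_restrict_mem measurableSet_Ioc] with t ht
    exact Real.rpow_nonneg ht.1.le _

/-- Integrate the fundamental theorem of calculus on the segments from `x`, exchange the integrals,
and apply Hölder on the ball for fixed `t`. The homothety of ratio `t` then contributes `t ^ (-n /
p)`, which is integrable on `(0, 1]` exactly because `n < p`. -/
theorem setLIntegral_enorm_sub_le {p : ℝ} (hp1 : 1 ≤ p) (hp : (n : ℝ) < p)
    {G : (Fin n → ℝ) → ℝ} (hG : ContDiff ℝ 1 G)
    {c x : Fin n → ℝ} {s : ℝ} (hx : x ∈ Metric.closedBall c s) :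
    ∫⁻ y in Metric.closedBall c s, ‖G y - G x‖ₑ ≤
      ENNReal.ofReal (2 * s) * (volume (Metric.closedBall c s)) ^ (1 - 1 / p) *
        (∫⁻ y in Metric.closedBall c s, ‖fderiv ℝ G y‖ₑ ^ p) ^ (1 / p) *
        ENNReal.ofReal (1 / (1 - n / p)) := by
  have hp0 : 0 < p := by linarith
  set B := Metric.closedBall c s with hB
  have hBm : MeasurableSet B := measurableSet_closedBall
  have hfc : Continuous fun y => ‖fderiv ℝ G y‖ₑ := (hG.continuous_fderiv one_ne_zero).enorm
  have hlc : Continuous fun q : (Fin n → ℝ) × ℝ => (AffineMap.lineMap x q.1 q.2 : Fin n → ℝ) := by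
    simp only [AffineMap.lineMap_apply]
    fun_prop
  set A := ∫⁻ y in B, ‖fderiv ℝ G y‖ₑ ^ p with hA
  calc ∫⁻ y in B, ‖G y - G x‖ₑ
      ≤ ∫⁻ y in B, ∫⁻ t in Ioc (0 : ℝ) 1,
          ENNReal.ofReal (2 * s) * ‖fderiv ℝ G (AffineMap.lineMap x y t)‖ₑ := by
        refine setLIntegral_mono' hBm fun y hy => ?_
        refine (enorm_sub_le_lintegral_fderiv hG x y).trans (lintegral_mono fun t => ?_)
        rw [mul_comm]
        refine mul_le_mul_left ?_ _
        rw [← edist_eq_enorm_sub, edist_dist]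
        refine ENNReal.ofReal_le_ofReal ?_
        have h1 := Metric.mem_closedBall.1 hx
        have h2 := Metric.mem_closedBall.1 hy
        linarith [dist_triangle_right y x c]
    _ = ∫⁻ t in Ioc (0 : ℝ) 1, ∫⁻ y in B,
          ENNReal.ofReal (2 * s) * ‖fderiv ℝ G (AffineMap.lineMap x y t)‖ₑ :=
        lintegral_lintegral_swap
          ((hfc.comp hlc).measurable.const_mul (ENNReal.ofReal (2 * s))).aemeasurable
    _ ≤ ∫⁻ t in Ioc (0 : ℝ) 1, ENNReal.ofReal (2 * s) *
          (volume B ^ (1 - 1 / p) * A ^ (1 / p)) * ENNReal.ofReal (t ^ (-(n / p))) := by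
        refine setLIntegral_mono' measurableSet_Ioc fun t ht => ?_
        have hct : Continuous fun y => (AffineMap.lineMap x y t : Fin n → ℝ) :=
          hlc.comp (Continuous.prodMk_left t)
        have hm : Measurable fun y => ‖fderiv ℝ G (AffineMap.lineMap x y t)‖ₑ :=
          (hfc.comp hct).measurable
        rw [lintegral_const_mul _ hm, mul_assoc]
        refine mul_le_mul_right ?_ _
        have h1 := lintegral_mul_le_lintegral_rpow_mul (volume.restrict B) hp1 hm.aemeasurable
          (aemeasurable_const (b := (1 : ℝ≥0∞)))
        simp only [mul_one, lintegral_const, one_mul, Measure.restrict_apply_univ] at h1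
        refine h1.trans ?_
        have h2 := setLIntegral_comp_lineMap_le (convex_closedBall c s) hBm hx
          (H := fun y => ‖fderiv ℝ G y‖ₑ ^ p) (hfc.measurable.pow_const p) ht
        rw [mul_comm, mul_assoc]
        refine mul_le_mul_right ((ENNReal.rpow_le_rpow h2 (by positivity)).trans (le_of_eq ?_)) _
        rw [ENNReal.mul_rpow_of_nonneg _ _ (by positivity), mul_comm,
          ENNReal.ofReal_rpow_of_pos (inv_pos.2 (pow_pos ht.1 n)), ← Real.rpow_natCast,
          ← Real.rpow_neg ht.1.le, ← Real.rpow_mul ht.1.le]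
        congr 3
        ring
    _ = _ := by
        rw [lintegral_const_mul _ (by fun_prop), lintegral_rpow_neg_Ioc ((div_lt_one hp0).2 hp)]
        ring

/-- The constant in the Morrey inequality for smooth functions. -/
def morreyConst (n : ℕ) (p : ℝ) : ℝ :=
  (4 * (1 / (1 - n / p))) ^ p / 2 ^ n

theorem morreyConst_nonneg {p : ℝ} (hp1 : 1 ≤ p) (hp : (n : ℝ) < p) : 0 ≤ morreyConst n p := by
  have : 0 < 1 - n / p := sub_pos.2 ((div_lt_one (by linarith)).2 hp)
  unfold morreyConst
  positivity

/-- The Morrey inequality for continuously differentiable functions. -/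
theorem enorm_sub_rpow_le_of_contDiff {p : ℝ} (hp1 : 1 ≤ p) (hp : (n : ℝ) < p)
    {G : (Fin n → ℝ) → ℝ} (hG : ContDiff ℝ 1 G)
    {c x x' : Fin n → ℝ} {s : ℝ} (hs : 0 < s) (hx : x ∈ Metric.closedBall c s)
    (hx' : x' ∈ Metric.closedBall c s) :
    ‖G x - G x'‖ₑ ^ p ≤ ENNReal.ofReal (morreyConst n p * s ^ (p - n)) *
      ∫⁻ y in Metric.closedBall c s, ‖fderiv ℝ G y‖ₑ ^ p := by
  have hp0 : 0 < p := by linarith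
  have hK : 0 < 1 / (1 - n / p) := one_div_pos.2 (sub_pos.2 ((div_lt_one hp0).2 hp))
  have hv : volume (Metric.closedBall c s) = ENNReal.ofReal ((2 * s) ^ n) := by
    rw [Real.volume_pi_closedBall c hs.le, Fintype.card_fin]
  have h1 := setLIntegral_enorm_sub_le hp1 hp hG hx
  have h2 := setLIntegral_enorm_sub_le hp1 hp hG hx'
  unfold morreyConst
  set K := 1 / (1 - n / p) with hKdef
  set B := Metric.closedBall c s with hB
  set A := ∫⁻ y in B, ‖fderiv ℝ G y‖ₑ ^ p with hA
  have hv0 : volume B ≠ 0 := by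
    rw [hv]
    simpa using by positivity
  have hvt : volume B ≠ ⊤ := hv ▸ ENNReal.ofReal_ne_top
  -- Both values are compared with `G y`, averaged over `y` in the ball.
  have h3 : ‖G x - G x'‖ₑ * volume B ≤
      ENNReal.ofReal (4 * s * K) * volume B ^ (1 - 1 / p) * A ^ (1 / p) := by
    calc ‖G x - G x'‖ₑ * volume B = ∫⁻ _ in B, ‖G x - G x'‖ₑ := by
          rw [setLIntegral_const]
      _ ≤ ∫⁻ y in B, (‖G y - G x‖ₑ + ‖G y - G x'‖ₑ) := by
          refine lintegral_mono fun y => ?_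
          have := enorm_sub_le (a := G y - G x') (b := G y - G x)
          rw [sub_sub_sub_cancel_left] at this
          rw [add_comm]
          exact this
      _ = (∫⁻ y in B, ‖G y - G x‖ₑ) + ∫⁻ y in B, ‖G y - G x'‖ₑ :=
          lintegral_add_left (hG.continuous.sub continuous_const).enorm.measurable _
      _ ≤ _ := (add_le_add h1 h2).trans (le_of_eq ?_)
    have e : ENNReal.ofReal (4 * s * K) = 2 * (ENNReal.ofReal (2 * s) * ENNReal.ofReal K) := by
      rw [← ENNReal.ofReal_mul (by positivity), ← ENNReal.ofReal_ofNat 2,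
        ← ENNReal.ofReal_mul (by positivity)]
      congr 1
      ring
    rw [e]
    ring
  have h4 : ‖G x - G x'‖ₑ ≤ ENNReal.ofReal (4 * s * K) * volume B ^ (-(1 / p)) * A ^ (1 / p) := by
    have h5 := mul_le_mul_left h3 (volume B)⁻¹
    rw [mul_assoc, ENNReal.mul_inv_cancel hv0 hvt, mul_one] at h5
    refine h5.trans (le_of_eq ?_)
    have : volume B ^ (-(1 / p)) = volume B ^ (1 - 1 / p) * (volume B)⁻¹ := by
      rw [← ENNReal.rpow_neg_one, ← ENNReal.rpow_add _ _ hv0 hvt]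
      congr 1
      ring
    rw [this]
    ring
  refine (ENNReal.rpow_le_rpow h4 hp0.le).trans (le_of_eq ?_)
  rw [ENNReal.mul_rpow_of_nonneg _ _ hp0.le, ENNReal.mul_rpow_of_nonneg _ _ hp0.le,
    ← ENNReal.rpow_mul, ← ENNReal.rpow_mul, one_div_mul_cancel hp0.ne', ENNReal.rpow_one, neg_mul,
    one_div_mul_cancel hp0.ne', hv, ENNReal.ofReal_rpow_of_pos (by positivity),
    ENNReal.ofReal_rpow_of_pos (by positivity), ← ENNReal.ofReal_mul (by positivity)]
  congr 2
  rw [Real.rpow_neg_one, mul_pow, Real.rpow_sub hs, Real.rpow_natCast,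
    show 4 * s * K = (4 * K) * s by ring, Real.mul_rpow (by positivity) hs.le]
  field_simp

end Smooth

/-! ### Mollification, and passage from smooth to continuous Sobolev functions -/

section Mollification

variable {n : ℕ}

theorem lintegral_ofReal_normed_sub_left (φ : ContDiffBump (0 : Fin n → ℝ)) (z : Fin n → ℝ) :
    ∫⁻ t, ENNReal.ofReal (φ.normed volume (z - t)) = 1 := by
  rw [lintegral_sub_left_eq_self (fun t => ENNReal.ofReal (φ.normed volume t)) z,
    ← ofReal_integral_eq_lintegral_ofReal φ.integrable_normed
      (Eventually.of_forall fun t => φ.nonneg_normed t), φ.integral_normed, ENNReal.ofReal_one]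

theorem lintegral_ofReal_normed_sub_right (φ : ContDiffBump (0 : Fin n → ℝ)) (t : Fin n → ℝ) :
    ∫⁻ z, ENNReal.ofReal (φ.normed volume (z - t)) = 1 := by
  rw [lintegral_sub_right_eq_self (fun t => ENNReal.ofReal (φ.normed volume t)) t,
    ← ofReal_integral_eq_lintegral_ofReal φ.integrable_normed
      (Eventually.of_forall fun t => φ.nonneg_normed t), φ.integral_normed, ENNReal.ofReal_one]

/-- The norm dual to the uniform norm is the `ℓ¹` norm of the coordinates, at most `n` times their
maximum. -/
theorem enorm_clm_le_of_forall_single (l : (Fin n → ℝ) →L[ℝ] ℝ) {b : ℝ≥0∞}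
    (h : ∀ i, ‖l (Pi.single i 1)‖ₑ ≤ b) : ‖l‖ₑ ≤ n * b := by
  have h1 : ‖l‖ ≤ ∑ i, ‖l (Pi.single i 1)‖ := by
    refine l.opNorm_le_bound (Finset.sum_nonneg fun _ _ => norm_nonneg _) fun v => ?_
    have e : l v = ∑ i, v i * l (Pi.single i 1) := by
      conv_lhs => rw [pi_eq_sum_univ' v]
      simp
    rw [e, Finset.sum_mul]
    refine (norm_sum_le _ _).trans (Finset.sum_le_sum fun i _ => ?_)
    rw [norm_mul, mul_comm]
    exact mul_le_mul_of_nonneg_left (norm_le_pi_norm v i) (norm_nonneg _)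
  have h2 : ‖l‖ₑ ≤ ∑ i, ‖l (Pi.single i 1)‖ₑ := by
    simp only [enorm_eq_nnnorm]
    rw [← ENNReal.ofNNReal_finsetSum, ENNReal.coe_le_coe, ← NNReal.coe_le_coe]
    simpa using h1
  refine h2.trans ((Finset.sum_le_sum fun i _ => h i).trans (le_of_eq ?_))
  simp

end Mollification

namespace SpaceDomain

variable {n : ℕ} {Ω : SpaceDomain n} {F : (Fin n → ℝ) → ℝ} {g : (Fin n → ℝ) → Fin n → ℝ}

/-- The mollification of the restriction of `F` to the set `K`. -/
def mollify (F : (Fin n → ℝ) → ℝ) (K : Set (Fin n → ℝ)) (φ : ContDiffBump (0 : Fin n → ℝ)) :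
    (Fin n → ℝ) → ℝ :=
  MeasureTheory.convolution (K.indicator F) (φ.normed volume) (ContinuousLinearMap.mul ℝ ℝ) volume

theorem locallyIntegrable_indicator_of_compact (hF : ContinuousOn F Ω.carrier)
    {K : Set (Fin n → ℝ)} (hK : IsCompact K) (hKΩ : K ⊆ Ω.carrier) :
    LocallyIntegrable (K.indicator F) volume :=
  ((integrable_indicator_iff hK.measurableSet).2
    ((hF.mono hKΩ).integrableOn_compact hK)).locallyIntegrable

theorem contDiff_mollify (hF : ContinuousOn F Ω.carrier) {K : Set (Fin n → ℝ)} (hK : IsCompact K)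
    (hKΩ : K ⊆ Ω.carrier) (φ : ContDiffBump (0 : Fin n → ℝ)) : ContDiff ℝ 1 (mollify F K φ) :=
  φ.hasCompactSupport_normed.contDiff_convolution_right (n := 1) _
    (locallyIntegrable_indicator_of_compact hF hK hKΩ) φ.contDiff_normed

theorem dist_mollify_le (hF : ContinuousOn F Ω.carrier) {K : Set (Fin n → ℝ)} (hK : IsCompact K)
    (hKΩ : K ⊆ Ω.carrier) (φ : ContDiffBump (0 : Fin n → ℝ)) {z : Fin n → ℝ} {ε : ℝ}
    (hz : Metric.ball z φ.rOut ⊆ K) (h : ∀ y ∈ Metric.ball z φ.rOut, dist (F y) (F z) ≤ ε) :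
    dist (mollify F K φ z) (F z) ≤ ε := by
  have hzK : z ∈ K := hz (Metric.mem_ball_self φ.rOut_pos)
  have h1 := φ.dist_normed_convolution_le (μ := volume) (g := K.indicator F) (x₀ := z) (ε := ε)
    (locallyIntegrable_indicator_of_compact hF hK hKΩ).aestronglyMeasurable (fun y hy => by
      rw [indicator_of_mem (hz hy), indicator_of_mem hzK]
      exact h y hy)
  rw [indicator_of_mem hzK] at h1
  convert h1 using 2
  rw [mollify, convolution_mul_swap, convolution_lsmul]
  exact integral_congr_ae (Eventually.of_forall fun t => mul_comm _ _)

/-- The weak gradient is tested against `t ↦ φ(z - t)`, whose support lies in `K`, so cutting `F`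
off outside `K` is not felt at `z`. The sign from differentiating `z - t` cancels the sign of
integration by parts. -/
theorem fderiv_mollify_single (hF : ContinuousOn F Ω.carrier) (hg : Ω.IsWeakGradient F g)
    {K : Set (Fin n → ℝ)} (hK : IsCompact K)
    (hKΩ : K ⊆ Ω.carrier) (φ : ContDiffBump (0 : Fin n → ℝ)) {z : Fin n → ℝ}
    (hz : Metric.closedBall z φ.rOut ⊆ K) (i : Fin n) :
    fderiv ℝ (mollify F K φ) z (Pi.single i 1) = ∫ t in K, g t i * φ.normed volume (z - t) := by
  have hloc := locallyIntegrable_indicator_of_compact hF hK hKΩ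
  have hφ1 : ContDiff ℝ 1 (φ.normed volume) := φ.contDiff_normed (n := 1)
  have hd := φ.hasCompactSupport_normed (μ := volume).hasFDerivAt_convolution_right
    (ContinuousLinearMap.mul ℝ ℝ) hloc hφ1 z
  have e1 : fderiv ℝ (mollify F K φ) z (Pi.single i 1) =
      ∫ t, K.indicator F t * fderiv ℝ (φ.normed volume) (z - t) (Pi.single i 1) := by
    rw [mollify, hd.fderiv, convolution_precompR_apply _ hloc
      (φ.hasCompactSupport_normed.fderiv ℝ) (hφ1.continuous_fderiv one_ne_zero)]
    rfl
  have hsub : ∀ t, z - t ∈ tsupport (φ.normed volume) → t ∈ Metric.closedBall z φ.rOut := by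
    intro t ht
    rw [φ.tsupport_normed_eq, mem_closedBall_zero_iff] at ht
    rwa [Metric.mem_closedBall, dist_comm, dist_eq_norm]
  set ψ : (Fin n → ℝ) → ℝ := fun t => φ.normed volume (z - t) with hψ
  have hψs : tsupport ψ ⊆ Metric.closedBall z φ.rOut := by
    refine closure_minimal (fun t ht => hsub t (subset_tsupport _ ht)) Metric.isClosed_closedBall
  have hψd : ∀ t, fderiv ℝ ψ t (Pi.single i 1) =
      -fderiv ℝ (φ.normed volume) (z - t) (Pi.single i 1) := by
    intro t
    have h1 : HasFDerivAt (fun t : Fin n → ℝ => z - t) (-ContinuousLinearMap.id ℝ _) t :=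
      (hasFDerivAt_id t).const_sub z
    have h2 := (hφ1.differentiable one_ne_zero (z - t)).hasFDerivAt.comp t h1
    have h3 : fderiv ℝ ψ t = _ := h2.fderiv
    rw [h3]
    simp
  have hw := hg ψ (φ.contDiff_normed.comp (contDiff_const.sub contDiff_id))
    (HasCompactSupport.of_support_subset_isCompact (isCompact_closedBall z φ.rOut)
      ((subset_tsupport _).trans hψs)) (hψs.trans (hz.trans hKΩ)) i
  have e2 : ∫ t in Ω.carrier, F t * fderiv ℝ ψ t (Pi.single i 1) =
      ∫ t in K, F t * fderiv ℝ ψ t (Pi.single i 1) := by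
    refine (setIntegral_eq_of_subset_of_forall_sdiff_eq_zero Ω.isOpen.measurableSet hKΩ
      fun t ht => ?_)
    have : fderiv ℝ ψ t = 0 := image_eq_zero_of_notMem_tsupport fun h =>
      ht.2 (hz (hψs (tsupport_fderiv_subset ℝ h)))
    simp [this]
  have e3 : ∫ t in Ω.carrier, g t i * ψ t = ∫ t in K, g t i * ψ t := by
    refine (setIntegral_eq_of_subset_of_forall_sdiff_eq_zero Ω.isOpen.measurableSet hKΩ
      fun t ht => ?_)
    have : ψ t = 0 := image_eq_zero_of_notMem_tsupport fun h => ht.2 (hz (hψs h))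
    simp [this]
  rw [e2, e3] at hw
  rw [e1, ← neg_inj, ← hw, ← integral_neg, ← integral_indicator hK.measurableSet]
  refine integral_congr_ae (Eventually.of_forall fun t => ?_)
  by_cases ht : t ∈ K
  · simp [ht, hψd]
  · simp [ht]

/-- This is Jensen's inequality for the bump, a density of mass one; `n ^ p` comes from passing from
coordinates to the operator norm. -/
theorem enorm_fderiv_mollify_rpow_le {p : ℝ} (hp1 : 1 ≤ p) (h : Ω.IsSobolevWith p F g)
    {K : Set (Fin n → ℝ)} (hK : IsCompact K) (hKΩ : K ⊆ Ω.carrier)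
    (φ : ContDiffBump (0 : Fin n → ℝ)) {z : Fin n → ℝ} (hz : Metric.closedBall z φ.rOut ⊆ K) :
    ‖fderiv ℝ (mollify F K φ) z‖ₑ ^ p ≤ ENNReal.ofReal ((n : ℝ) ^ p) *
      ∫⁻ t in K, ‖g t‖ₑ ^ p * ENNReal.ofReal (φ.normed volume (z - t)) := by
  have hp0 : 0 < p := by linarith
  have hwm : Measurable fun t => ENNReal.ofReal (φ.normed volume (z - t)) :=
    ENNReal.measurable_ofReal.comp
      (φ.continuous_normed.comp (continuous_const.sub continuous_id)).measurable
  have hgm : AEMeasurable (fun t => ‖g t‖ₑ) (volume.restrict K) :=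
    (h.memLp.aestronglyMeasurable.mono_measure (Measure.restrict_mono hKΩ le_rfl)).enorm
  have h1 : ‖fderiv ℝ (mollify F K φ) z‖ₑ ≤
      n * ∫⁻ t in K, ‖g t‖ₑ * ENNReal.ofReal (φ.normed volume (z - t)) := by
    refine enorm_clm_le_of_forall_single _ fun i => ?_
    rw [fderiv_mollify_single h.continuousOn h.isWeakGradient hK hKΩ φ hz i]
    refine (enorm_integral_le_lintegral_enorm _).trans (lintegral_mono fun t => ?_)
    rw [enorm_mul]
    refine mul_le_mul' ?_ ?_
    · exact enorm_le_iff_norm_le.2 (norm_le_pi_norm (g t) i)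
    · rw [Real.enorm_eq_ofReal (φ.nonneg_normed _)]
  have h2 := lintegral_mul_le_lintegral_rpow_mul (volume.restrict K) hp1 hgm hwm.aemeasurable
  have h3 : (∫⁻ t in K, ENNReal.ofReal (φ.normed volume (z - t))) ^ (1 - 1 / p) ≤ 1 := by
    refine ENNReal.rpow_le_one ?_ (sub_nonneg.2 ((div_le_one hp0).2 hp1))
    exact (setLIntegral_le_lintegral _ _).trans (lintegral_ofReal_normed_sub_left φ z).le
  have h4 := h2.trans (mul_le_mul_right h3 _)
  rw [mul_one] at h4
  refine (ENNReal.rpow_le_rpow (h1.trans (mul_le_mul_right h4 _)) hp0.le).trans (le_of_eq ?_)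
  rw [ENNReal.mul_rpow_of_nonneg _ _ hp0.le, ← ENNReal.rpow_mul, one_div_mul_cancel hp0.ne',
    ENNReal.rpow_one, ← ENNReal.ofReal_natCast, ENNReal.ofReal_rpow_of_nonneg (by positivity)
    hp0.le]

/-- Tonelli's theorem: the bump has mass one in `z` as well, so smoothing costs nothing beyond the
factor `n ^ p`. -/
theorem setLIntegral_fderiv_mollify_le {p : ℝ} (hp1 : 1 ≤ p) (h : Ω.IsSobolevWith p F g)
    {K B : Set (Fin n → ℝ)} (hK : IsCompact K) (hKΩ : K ⊆ Ω.carrier) (hB : MeasurableSet B)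
    (φ : ContDiffBump (0 : Fin n → ℝ)) (hBK : ∀ z ∈ B, Metric.closedBall z φ.rOut ⊆ K) :
    ∫⁻ z in B, ‖fderiv ℝ (mollify F K φ) z‖ₑ ^ p ≤
      ENNReal.ofReal ((n : ℝ) ^ p) * ∫⁻ t in K, ‖g t‖ₑ ^ p := by
  have hwc : Measurable fun q : (Fin n → ℝ) × (Fin n → ℝ) =>
      ENNReal.ofReal (φ.normed volume (q.1 - q.2)) :=
    ENNReal.measurable_ofReal.comp
      (φ.continuous_normed.comp (continuous_fst.sub continuous_snd)).measurable
  have hgm : AEMeasurable (fun t => ‖g t‖ₑ ^ p) (volume.restrict K) :=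
    (h.memLp.aestronglyMeasurable.mono_measure
      (Measure.restrict_mono hKΩ le_rfl)).enorm.pow_const p
  refine (setLIntegral_mono' hB fun z hz =>
    enorm_fderiv_mollify_rpow_le hp1 h hK hKΩ φ (hBK z hz)).trans ?_
  rw [lintegral_const_mul' _ _ ENNReal.ofReal_ne_top]
  refine mul_le_mul_right ?_ _
  have hm : AEMeasurable (Function.uncurry fun z t : Fin n → ℝ =>
      ‖g t‖ₑ ^ p * ENNReal.ofReal (φ.normed volume (z - t)))
      ((volume.restrict B).prod (volume.restrict K)) := by
    have := hgm.comp_snd (μ := volume.restrict B)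
    exact this.mul hwc.aemeasurable
  refine (lintegral_lintegral_swap hm).le.trans ?_
  refine lintegral_mono fun t => ?_
  have hwt : Measurable fun z => ENNReal.ofReal (φ.normed volume (z - t)) :=
    ENNReal.measurable_ofReal.comp
      (φ.continuous_normed.comp (continuous_id.sub continuous_const)).measurable
  have h1 : ∫⁻ z in B, ENNReal.ofReal (φ.normed volume (z - t)) ≤ 1 :=
    (setLIntegral_le_lintegral _ _).trans (lintegral_ofReal_normed_sub_right φ t).le
  calc ∫⁻ z in B, ‖g t‖ₑ ^ p * ENNReal.ofReal (φ.normed volume (z - t))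
      = ‖g t‖ₑ ^ p * ∫⁻ z in B, ENNReal.ofReal (φ.normed volume (z - t)) :=
        lintegral_const_mul _ hwt
    _ ≤ ‖g t‖ₑ ^ p * 1 := mul_le_mul_right h1 _
    _ = ‖g t‖ₑ ^ p := mul_one _

/-- The Morrey inequality for continuous Sobolev functions. -/
theorem IsSobolevWith.enorm_sub_rpow_le {p : ℝ} (h : Ω.IsSobolevWith p F g) (hp1 : 1 ≤ p)
    (hp : (n : ℝ) < p) {c x x' : Fin n → ℝ} {r : ℝ} (hr : 0 < r)
    (hc : Metric.closedBall c r ⊆ Ω.carrier) (hx : x ∈ Metric.closedBall c (r / 2))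
    (hx' : x' ∈ Metric.closedBall c (r / 2)) :
    ‖F x - F x'‖ₑ ^ p ≤ ENNReal.ofReal (morreyConst n p * (r / 2) ^ (p - n)) *
      (ENNReal.ofReal ((n : ℝ) ^ p) * ∫⁻ t in Metric.closedBall c r, ‖g t‖ₑ ^ p) := by
  have hp0 : 0 < p := by linarith
  set K := Metric.closedBall c r with hKdef
  have hK : IsCompact K := isCompact_closedBall c r
  have hsub : ∀ z ∈ Metric.closedBall c (r / 2), ∀ ρ ≤ r / 2, Metric.closedBall z ρ ⊆ K :=
    fun z hz ρ hρ => Metric.closedBall_subset_closedBall' (by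
      have := Metric.mem_closedBall.1 hz
      linarith)
  have hcont : ∀ z ∈ Metric.closedBall c (r / 2), ContinuousAt F z := fun z hz =>
    h.continuousOn.continuousAt (Ω.isOpen.mem_nhds
      (hc (hsub z hz (r / 2) le_rfl (Metric.mem_closedBall_self (by positivity)))))
  -- A bump of radius at most `r / 2` about a point of the half ball sees only `K`; this is why the
  -- points are confined to the half ball.
  have hbump : ∀ k : ℕ, ∃ φ : ContDiffBump (0 : Fin n → ℝ), φ.rOut ≤ r / 2 ∧
      dist (mollify F K φ x) (F x) ≤ 1 / (k + 1) ∧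
      dist (mollify F K φ x') (F x') ≤ 1 / (k + 1) := by
    intro k
    have hk : (0 : ℝ) < 1 / (k + 1) := by positivity
    obtain ⟨δ₁, hδ₁, h₁⟩ := Metric.continuousAt_iff.1 (hcont x hx) _ hk
    obtain ⟨δ₂, hδ₂, h₂⟩ := Metric.continuousAt_iff.1 (hcont x' hx') _ hk
    have hm : 0 < min (r / 2) (min δ₁ δ₂) := by positivity
    refine ⟨⟨min (r / 2) (min δ₁ δ₂) / 2, min (r / 2) (min δ₁ δ₂), by positivity, by linarith⟩,
      min_le_left _ _, ?_, ?_⟩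
    · refine dist_mollify_le h.continuousOn hK hc _
        (Metric.ball_subset_closedBall.trans (hsub x hx _ (min_le_left _ _))) fun y hy =>
        (h₁ ((Metric.mem_ball.1 hy).trans_le ((min_le_right _ _).trans (min_le_left _ _)))).le
    · refine dist_mollify_le h.continuousOn hK hc _
        (Metric.ball_subset_closedBall.trans (hsub x' hx' _ (min_le_left _ _))) fun y hy =>
        (h₂ ((Metric.mem_ball.1 hy).trans_le ((min_le_right _ _).trans (min_le_right _ _)))).le
  choose φ hφ hφx hφx' using hbump
  have hlim : ∀ y, (∀ k, dist (mollify F K (φ k) y) (F y) ≤ 1 / (k + 1)) →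
      Tendsto (fun k => mollify F K (φ k) y) atTop (𝓝 (F y)) := fun y hy => by
    rw [tendsto_iff_dist_tendsto_zero]
    exact squeeze_zero (fun _ => dist_nonneg) hy tendsto_one_div_add_atTop_nhds_zero_nat
  have ht := ((hlim x hφx).sub (hlim x' hφx')).enorm
  have ht' := (ENNReal.continuous_rpow_const (y := p)).continuousAt.tendsto.comp ht
  refine le_of_tendsto ht' (Eventually.of_forall fun k => ?_)
  refine (enorm_sub_rpow_le_of_contDiff hp1 hp (contDiff_mollify h.continuousOn hK hc (φ k))
    (by positivity) hx hx').trans (mul_le_mul_right ?_ _)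
  exact setLIntegral_fderiv_mollify_le hp1 h hK hc measurableSet_closedBall (φ k)
    fun z hz => hsub z hz _ (hφ k)

end SpaceDomain

/-! ### Packing and elementary inequalities for `p`-th powers -/

/-- The number of points of a `2ρ`-separated set in a ball of radius `R ρ` is bounded. -/
theorem card_le_of_pairwise_lt_dist {n : ℕ} {ι : Type*} (s : Finset ι) (x : ι → Fin n → ℝ)
    (z : Fin n → ℝ) {ρ R : ℝ} (hρ : 0 < ρ) (hR : 0 ≤ R)
    (hsep : ∀ i ∈ s, ∀ j ∈ s, i ≠ j → 2 * ρ < dist (x i) (x j))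
    (hz : ∀ i ∈ s, dist (x i) z ≤ R * ρ) : (s.card : ℝ) ≤ (R + 1) ^ n := by
  have hdisj : (s : Set ι).PairwiseDisjoint fun i => Metric.closedBall (x i) ρ :=
    fun i hi j hj hij => Metric.closedBall_disjoint_closedBall (by linarith [hsep i hi j hj hij])
  have hsub : (⋃ i ∈ s, Metric.closedBall (x i) ρ) ⊆ Metric.closedBall z ((R + 1) * ρ) :=
    iUnion₂_subset fun i hi => Metric.closedBall_subset_closedBall' (by linarith [hz i hi])
  have h := measure_mono (μ := volume) hsub
  rw [measure_biUnion_finset hdisj fun _ _ => measurableSet_closedBall,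
    Real.volume_pi_closedBall z (by positivity)] at h
  simp only [Real.volume_pi_closedBall _ hρ.le, Finset.sum_const, Fintype.card_fin,
    nsmul_eq_mul] at h
  rw [← ENNReal.ofReal_natCast, ← ENNReal.ofReal_mul (by positivity),
    ENNReal.ofReal_le_ofReal_iff (by positivity)] at h
  rw [show 2 * ((R + 1) * ρ) = (R + 1) * (2 * ρ) by ring, mul_pow (R + 1)] at h
  exact le_of_mul_le_mul_right h (by positivity)

theorem abs_add_rpow_le (p : ℝ) (hp : 0 ≤ p) (x y : ℝ) :
    |x + y| ^ p ≤ 2 ^ p * (|x| ^ p + |y| ^ p) := by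
  have h1 : |x + y| ≤ 2 * max |x| |y| := (abs_add_le x y).trans (by
    linarith [le_max_left |x| |y|, le_max_right |x| |y|])
  have h2 : (max |x| |y|) ^ p ≤ |x| ^ p + |y| ^ p := by
    have hx := Real.rpow_nonneg (abs_nonneg x) p
    have hy := Real.rpow_nonneg (abs_nonneg y) p
    rcases max_choice |x| |y| with h | h <;> rw [h] <;> linarith
  calc |x + y| ^ p ≤ (2 * max |x| |y|) ^ p := Real.rpow_le_rpow (abs_nonneg _) h1 hp
    _ = 2 ^ p * (max |x| |y|) ^ p :=
        Real.mul_rpow (by norm_num) (le_max_of_le_left (abs_nonneg x))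
    _ ≤ _ := mul_le_mul_of_nonneg_left h2 (by positivity)

/-- Summation of increments that decay geometrically. -/
theorem abs_sub_rpow_le_of_geometric {p q M : ℝ} (hp : 0 < p) (hq0 : 0 < q) (hq1 : q < 1)
    (hM : 0 ≤ M) {v a : ℕ → ℝ} (ha : ∀ k, 0 ≤ a k)
    (h : ∀ k, |v (k + 1) - v k| ^ p ≤ M * (q ^ k * q ^ k) * a k) (K : ℕ) :
    |v K - v 0| ^ p ≤ M * (1 / (1 - q ^ (1 / p))) ^ p * ∑ k ∈ Finset.range K, q ^ k * a k := by
  set A := ∑ k ∈ Finset.range K, q ^ k * a k with hA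
  have hA0 : 0 ≤ A := Finset.sum_nonneg fun k _ => mul_nonneg (by positivity) (ha k)
  set w := q ^ (1 / p) with hw
  have hw0 : 0 ≤ w := by positivity
  have hw1 : w < 1 := Real.rpow_lt_one hq0.le hq1 (by positivity)
  have hwp : ∀ k : ℕ, (w ^ k) ^ p = q ^ k := fun k => by
    rw [← Real.rpow_natCast, ← Real.rpow_mul hw0, mul_comm, Real.rpow_mul hw0, hw,
      ← Real.rpow_mul hq0.le, one_div_mul_cancel hp.ne', Real.rpow_one, Real.rpow_natCast]
  -- One factor `q ^ k` is absorbed, with `a k`, into the sum `A`; the other survives as `w ^ k` and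
  -- makes the increments summable. Keeping `A` as a weighted sum, not a supremum, is what lets the
  -- estimate be summed over cubes later.
  have hinc : ∀ k ∈ Finset.range K, |v (k + 1) - v k| ≤ (M * A) ^ (1 / p) * w ^ k := by
    intro k hk
    have h1 : q ^ k * a k ≤ A :=
      Finset.single_le_sum (f := fun k => q ^ k * a k)
        (fun k _ => mul_nonneg (by positivity) (ha k)) hk
    have h2 : |v (k + 1) - v k| ^ p ≤ ((M * A) ^ (1 / p) * w ^ k) ^ p := by
      rw [Real.mul_rpow (by positivity) (by positivity), hwp, ← Real.rpow_mul (by positivity),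
        one_div_mul_cancel hp.ne', Real.rpow_one]
      refine (h k).trans ?_
      have h3 : M * q ^ k * (q ^ k * a k) ≤ M * q ^ k * A :=
        mul_le_mul_of_nonneg_left h1 (by positivity)
      linarith
    exact (Real.rpow_le_rpow_iff (abs_nonneg _) (by positivity) hp).1 h2
  have hsum : |v K - v 0| ≤ (M * A) ^ (1 / p) * (1 / (1 - w)) := by
    rw [← Finset.sum_range_sub]
    refine (Finset.abs_sum_le_sum_abs _ _).trans ((Finset.sum_le_sum hinc).trans ?_)
    rw [← Finset.mul_sum]
    refine mul_le_mul_of_nonneg_left ?_ (by positivity)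
    rw [one_div, ← tsum_geometric_of_lt_one hw0 hw1]
    exact (summable_geometric_of_lt_one hw0 hw1).sum_le_tsum _ fun k _ => by positivity
  have hw1' : 0 < 1 - w := by linarith
  refine (Real.rpow_le_rpow (abs_nonneg _) hsum hp.le).trans (le_of_eq ?_)
  rw [Real.mul_rpow (by positivity) (by positivity), ← Real.rpow_mul (by positivity),
    one_div_mul_cancel hp.ne', Real.rpow_one]
  ring

namespace SpaceDomain

variable {n : ℕ} {Ω : SpaceDomain n} {α : Ioc (0 : ℝ) 1}

/-! ### Visible elements of the boundary -/

/-- The ball about the point with parameter `u` is the image of the interior of `Q` under the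
homothety of ratio `u` about `a`, and visibility puts the segments from `a` to the points of `Q` in
`Ω`. -/
theorem IsVisible.containsCone {Q : AxisCube n} {a : Fin n → ℝ} (h : Ω.IsVisible Q a) :
    Ω.ContainsCone a Q.center Q.radius := by
  refine ⟨Q.radius_pos, fun u hu z hz => ?_⟩
  have hy : AffineMap.lineMap a z u⁻¹ ∈ Q.toSet := by
    refine Metric.mem_closedBall.2 ?_
    have e : (AffineMap.lineMap a z u⁻¹ : Fin n → ℝ) - Q.center =
        u⁻¹ • (z - AffineMap.lineMap a Q.center u) := by
      ext i
      simp only [AffineMap.lineMap_apply, vsub_eq_sub, vadd_eq_add, Pi.add_apply, Pi.smul_apply,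
        Pi.sub_apply, smul_eq_mul]
      field_simp [hu.1.ne']
      ring
    rw [dist_eq_norm, e, norm_smul, Real.norm_eq_abs, abs_of_pos (inv_pos.2 hu.1),
      ← dist_eq_norm, inv_mul_le_iff₀ hu.1]
    exact (Metric.mem_ball.1 hz).le
  refine h.2 _ hy ⟨u, hu, ?_⟩
  ext i
  simp only [AffineMap.lineMap_apply, vsub_eq_sub, vadd_eq_add, Pi.add_apply, Pi.smul_apply,
    Pi.sub_apply, smul_eq_mul]
  field_simp [hu.1.ne']
  ring

/-- The points of the segment from `ℓ(ω)` to the center of `Q` tend to the visible element `ω`. -/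
theorem IsAlphaVisible.dist_le {Q : AxisCube n} {ω : Ω.alphaBoundary α}
    (h : Ω.IsAlphaVisible α Q ω) {u : ℝ} (hu : u ∈ Ioc (0 : ℝ) 1) :
    dist (Ω.toSubhyp α _ (h.1.containsCone.mem hu) : Ω.SubhypCompletion α) ω ≤
      coneConst α (Ω.limitPoint α ω) Q.center Q.radius * u ^ (α : ℝ) := by
  have hc := h.1.containsCone
  obtain ⟨y, hy, hyω⟩ := h.2
  choose t ht hty using hy
  have ha : Ω.limitPoint α ω ∉ Ω.carrier := by
    have := (Ω.mem_alphaBoundary_iff α).1 ω.2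
    rw [Ω.isOpen.frontier_eq] at this
    exact this.2
  have hne : 0 < dist (Ω.limitPoint α ω) Q.center := dist_pos.2 fun he => ha <| by
    have := hc.mem (u := 1) ⟨one_pos, le_rfl⟩
    rwa [AffineMap.lineMap_apply_one, ← he] at this
  have hy' : ∀ i, y i = Ω.toSubhyp α _ (hc.mem (ht i)) := fun i => Subtype.ext (hty i).symm
  -- Visibility gives a sequence on the segment without saying where it lies; applying `ℓ` shows
  -- that it tends to the apex.
  have ht0 : Tendsto t atTop (𝓝 0) := by
    have h1 := ((Ω.continuous_limitPoint α).tendsto _).comp hyω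
    simp only [Function.comp_def, limitPoint_coe] at h1
    rw [tendsto_iff_dist_tendsto_zero] at h1
    have h2 : ∀ i, dist (y i).pt (Ω.limitPoint α ω) =
        t i * dist (Ω.limitPoint α ω) Q.center := fun i => by
      rw [← hty i, dist_lineMap_left, Real.norm_eq_abs, abs_of_pos (ht i).1]
    simp only [h2] at h1
    simpa [hne.ne'] using h1.div_const (dist (Ω.limitPoint α ω) Q.center)
  simp only [hy'] at hyω
  exact hc.dist_limit_le t ht ht0 hyω hu

theorem IsTrace.tendsto_of_isAlphaVisible {F : (Fin n → ℝ) → ℝ} {f : Ω.alphaBoundary α → ℝ}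
    (hF : Ω.IsTrace α F f) {Q : AxisCube n} {ω : Ω.alphaBoundary α}
    (h : Ω.IsAlphaVisible α Q ω) {t : ℕ → ℝ} (ht : ∀ k, t k ∈ Ioc (0 : ℝ) 1)
    (ht0 : Tendsto t atTop (𝓝 0)) :
    Tendsto (fun k => F (AffineMap.lineMap (Ω.limitPoint α ω) Q.center (t k))) atTop
      (𝓝 (f ω)) := by
  have h1 : Tendsto (fun k => Ω.toSubhyp α _ (h.1.containsCone.mem (ht k))) atTop
      (comap ((↑) : Ω.Subhyp α → Ω.SubhypCompletion α) (𝓝 (ω : Ω.SubhypCompletion α))) := by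
    rw [tendsto_comap_iff, tendsto_iff_dist_tendsto_zero]
    have h2 := (ht0.rpow_const (p := (α : ℝ)) (Or.inr α.2.1.le)).const_mul
      (coneConst α (Ω.limitPoint α ω) Q.center Q.radius)
    rw [Real.zero_rpow α.2.1.ne', mul_zero] at h2
    exact squeeze_zero (fun _ => dist_nonneg) (fun k => h.dist_le (ht k)) h2
  exact (hF ω).comp h1

/-! ### The necessity of the variational condition -/

/-- The trace of a function is continuous in the completed subhyperbolic metric. -/
theorem IsTrace.isSubhypContinuous {F : (Fin n → ℝ) → ℝ} {f : Ω.alphaBoundary α → ℝ}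
    (hF : Ω.IsTrace α F f) : Ω.IsSubhypContinuous α f := by
  intro ω ε hε
  have h1 := hF ω (Metric.closedBall_mem_nhds (f ω) (half_pos hε))
  obtain ⟨U, hU, hUF⟩ := mem_comap.1 h1
  obtain ⟨δ, hδ, hδU⟩ := Metric.mem_nhds_iff.1 hU
  -- The metric of the completion is at most twice `closureDist` on the boundary, hence the half.
  refine ⟨δ / 2, half_pos hδ, fun ω' hω' => ?_⟩
  have hdist : dist (ω' : Ω.SubhypCompletion α) ω < δ := by
    rw [dist_comm, dist_eq_closureDist_add]
    linarith [Ω.norm_limitPoint_sub_rpow_le α ω ω']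
  have hnb : (comap ((↑) : Ω.Subhyp α → Ω.SubhypCompletion α)
      (𝓝 (ω' : Ω.SubhypCompletion α))).NeBot :=
    Completion.isDenseInducing_coe.comap_nhds_neBot _
  have h2 : f ω' ∈ Metric.closedBall (f ω) (ε / 2) := by
    refine Metric.isClosed_closedBall.mem_of_tendsto (hF ω') ?_
    filter_upwards [preimage_mem_comap (Metric.isOpen_ball.mem_nhds hdist)] with x hx
    exact hUF (hδU hx)
  have h3 := Metric.mem_closedBall.1 h2
  rw [Real.dist_eq] at h3
  linarith

/-- The bound of the overlap of the balls at the same level of the cones over disjoint cubes. -/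
def overlapConst (n : ℕ) (η : ℝ) : ℝ :=
  ((η + 1) * (1 + 2 * η) ^ 2 + 1) ^ n

/-- If two half-size balls of the level `u` share `z`, then `a j`, being outside `Ω`, is outside the
full ball of the cone `i`, so `dist (a j) z ≥ u * r_i / 2`; on the other hand this distance is at
most `u * (η + 1 / 2) * r_j`. The factor `u` cancels and all radii involved are comparable, with a
ratio independent of the level. Disjoint cubes of comparable radii with centers at a comparable
distance from `z` can then be counted by volume. -/
theorem card_cone_ball_le {η : ℝ} (hη : 1 ≤ η) {m : ℕ} (Q : Fin m → AxisCube n)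
    (a : Fin m → Fin n → ℝ) (hdisj : Pairwise fun i j => Disjoint (Q i).toSet (Q j).toSet)
    (hcone : ∀ i, Ω.ContainsCone (a i) (Q i).center (Q i).radius)
    (ha : ∀ i, a i ∈ (Q i).dilate η ∩ frontier Ω.carrier) {u : ℝ} (hu : u ∈ Ioc (0 : ℝ) 1)
    (z : Fin n → ℝ) (s : Finset (Fin m))
    (hs : ∀ i ∈ s, z ∈ Metric.closedBall (AffineMap.lineMap (a i) (Q i).center u)
      (u * (Q i).radius / 2)) :
    (s.card : ℝ) ≤ overlapConst n η := by
  have hη0 : 0 < η := by linarith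
  have hda : ∀ i, dist (a i) (Q i).center ≤ η * (Q i).radius := fun i => (ha i).1
  have hna : ∀ i, a i ∉ Ω.carrier := fun i => by
    have := (ha i).2
    rw [Ω.isOpen.frontier_eq] at this
    exact this.2
  have hcmp : ∀ i ∈ s, ∀ j ∈ s, (Q i).radius ≤ (1 + 2 * η) * (Q j).radius := by
    intro i hi j hj
    have hri := (Q i).radius_pos
    have h1 : u * (Q i).radius / 2 ≤ dist (a j) z := by
      by_contra! hlt
      refine hna j ((hcone i).2 u hu (Metric.mem_ball.2 ?_))
      have := Metric.mem_closedBall.1 (hs i hi)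
      linarith [dist_triangle (a j) z (AffineMap.lineMap (a i) (Q i).center u)]
    have h2 : dist (a j) z ≤ u * (η * (Q j).radius) + u * (Q j).radius / 2 := by
      have h3 := Metric.mem_closedBall.1 (hs j hj)
      have h4 : dist (a j) (AffineMap.lineMap (a j) (Q j).center u) ≤ u * (η * (Q j).radius) := by
        rw [dist_left_lineMap, Real.norm_eq_abs, abs_of_pos hu.1]
        exact mul_le_mul_of_nonneg_left (hda j) hu.1.le
      linarith [dist_triangle_right (a j) z (AffineMap.lineMap (a j) (Q j).center u)]
    have h5 : u * (Q i).radius ≤ u * ((1 + 2 * η) * (Q j).radius) := by linarith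
    exact le_of_mul_le_mul_left h5 hu.1
  rcases s.eq_empty_or_nonempty with rfl | ⟨i₀, hi₀⟩
  · simp only [Finset.card_empty, Nat.cast_zero, overlapConst]
    positivity
  have hr₀ := (Q i₀).radius_pos
  have hc0 : 0 < 1 + 2 * η := by linarith
  refine card_le_of_pairwise_lt_dist s (fun i => (Q i).center) z
    (ρ := (Q i₀).radius / (1 + 2 * η)) (div_pos hr₀ hc0) (by positivity) ?_ ?_
  · intro i hi j hj hij
    have h1 := (disjoint_closedBall_closedBall_iff (Q i).radius_pos.le (Q j).radius_pos.le).1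
      (hdisj hij)
    have h2 : (Q i₀).radius / (1 + 2 * η) ≤ (Q i).radius :=
      (div_le_iff₀' hc0).2 (hcmp i₀ hi₀ i hi)
    have h3 : (Q i₀).radius / (1 + 2 * η) ≤ (Q j).radius :=
      (div_le_iff₀' hc0).2 (hcmp i₀ hi₀ j hj)
    linarith
  · intro i hi
    have hri := (Q i).radius_pos
    have e : (η + 1) * (1 + 2 * η) ^ 2 * ((Q i₀).radius / (1 + 2 * η)) =
        (η + 1) * ((1 + 2 * η) * (Q i₀).radius) := by
      field_simp
    rw [e]
    have h1 : dist (Q i).center z ≤ (η + 1) * (Q i).radius := by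
      have h3 := Metric.mem_closedBall'.1 (hs i hi)
      have h4 : dist (Q i).center (AffineMap.lineMap (a i) (Q i).center u) ≤
          (1 - u) * (η * (Q i).radius) := by
        rw [dist_right_lineMap, Real.norm_eq_abs, abs_of_nonneg (by linarith [hu.2])]
        exact mul_le_mul_of_nonneg_left (hda i) (by linarith [hu.2])
      have h5 : (1 - u) * (η * (Q i).radius) ≤ 1 * (η * (Q i).radius) :=
        mul_le_mul_of_nonneg_right (by linarith [hu.1]) (by positivity)
      have h6 : u * (Q i).radius ≤ 1 * (Q i).radius :=
        mul_le_mul_of_nonneg_right hu.2 hri.le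
      linarith [dist_triangle (Q i).center (AffineMap.lineMap (a i) (Q i).center u) z]
    exact h1.trans (mul_le_mul_of_nonneg_left (hcmp i hi i₀ hi₀) (by positivity))

/-- The sum of the indicators of the balls is the counting function bounded by `card_cone_ball_le`.
-/
theorem sum_setLIntegral_cone_ball_le {η : ℝ} (hη : 1 ≤ η) {m : ℕ} (Q : Fin m → AxisCube n)
    (a : Fin m → Fin n → ℝ) (hdisj : Pairwise fun i j => Disjoint (Q i).toSet (Q j).toSet)
    (hcone : ∀ i, Ω.ContainsCone (a i) (Q i).center (Q i).radius)
    (ha : ∀ i, a i ∈ (Q i).dilate η ∩ frontier Ω.carrier) {u : ℝ} (hu : u ∈ Ioc (0 : ℝ) 1)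
    {h : (Fin n → ℝ) → ℝ≥0∞} (hm : AEMeasurable h (volume.restrict Ω.carrier)) :
    ∑ i, ∫⁻ z in Metric.closedBall (AffineMap.lineMap (a i) (Q i).center u)
      (u * (Q i).radius / 2), h z ≤
      ENNReal.ofReal (overlapConst n η) * ∫⁻ z in Ω.carrier, h z := by
  classical
  set B : Fin m → Set (Fin n → ℝ) := fun i =>
    Metric.closedBall (AffineMap.lineMap (a i) (Q i).center u) (u * (Q i).radius / 2) with hB
  have hBΩ : ∀ i, B i ⊆ Ω.carrier := fun i => by
    have := mul_pos hu.1 (Q i).radius_pos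
    exact (Metric.closedBall_subset_ball (by linarith)).trans ((hcone i).2 u hu)
  have e : ∀ i, ∫⁻ z in B i, h z = ∫⁻ z in Ω.carrier, (B i).indicator h z := fun i => by
    rw [lintegral_indicator measurableSet_closedBall, Measure.restrict_restrict
      measurableSet_closedBall, inter_eq_left.2 (hBΩ i)]
  rw [Finset.sum_congr rfl fun i _ => e i,
    ← lintegral_finsetSum' _ fun i _ => hm.indicator measurableSet_closedBall,
    ← lintegral_const_mul' _ _ ENNReal.ofReal_ne_top]
  refine lintegral_mono fun z => ?_
  simp only [indicator_apply, ← Finset.sum_filter, Finset.sum_const, nsmul_eq_mul]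
  refine mul_le_mul_left ?_ _
  rw [← ENNReal.ofReal_natCast]
  refine ENNReal.ofReal_le_ofReal (card_cone_ball_le hη Q a hdisj hcone ha hu z _ fun i hi => ?_)
  exact (Finset.mem_filter.1 hi).2

end SpaceDomain

/-! ### Oscillation of Sobolev functions over disjoint cones -/

namespace SpaceDomain

variable {n : ℕ} {Ω : SpaceDomain n} {α : Ioc (0 : ℝ) 1} {F : (Fin n → ℝ) → ℝ}
  {g : (Fin n → ℝ) → Fin n → ℝ} {p : ℝ}

theorem IsSobolevWith.setLIntegral_ne_top (h : Ω.IsSobolevWith p F g) (hp : 0 < p) :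
    ∫⁻ z in Ω.carrier, ‖g z‖ₑ ^ p ≠ ⊤ := by
  have h1 := lintegral_rpow_enorm_lt_top_of_eLpNorm_lt_top (by simpa using hp)
    ENNReal.ofReal_ne_top h.memLp.2
  rw [ENNReal.toReal_ofReal hp.le] at h1
  exact h1.ne

theorem IsSobolevWith.abs_sub_rpow_le (h : Ω.IsSobolevWith p F g) (hp1 : 1 ≤ p)
    (hp : (n : ℝ) < p) {c x x' : Fin n → ℝ} {r : ℝ} (hr : 0 < r)
    (hc : Metric.closedBall c r ⊆ Ω.carrier) (hx : x ∈ Metric.closedBall c (r / 2))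
    (hx' : x' ∈ Metric.closedBall c (r / 2)) :
    |F x - F x'| ^ p ≤ morreyConst n p * (r / 2) ^ (p - n) *
      ((n : ℝ) ^ p * (∫⁻ t in Metric.closedBall c r, ‖g t‖ₑ ^ p).toReal) := by
  have hp0 : 0 < p := by linarith
  have hfin : ∫⁻ t in Metric.closedBall c r, ‖g t‖ₑ ^ p ≠ ⊤ :=
    ne_top_of_le_ne_top (h.setLIntegral_ne_top hp0) (lintegral_mono_set hc)
  have h1 := h.enorm_sub_rpow_le hp1 hp hr hc hx hx'
  have h2 := ENNReal.toReal_mono (ENNReal.mul_ne_top ENNReal.ofReal_ne_top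
    (ENNReal.mul_ne_top ENNReal.ofReal_ne_top hfin)) h1
  have hC := morreyConst_nonneg hp1 hp
  rw [ENNReal.toReal_mul, ENNReal.toReal_mul, ENNReal.toReal_ofReal (by positivity),
    ENNReal.toReal_ofReal (by positivity), ← ENNReal.toReal_rpow, toReal_enorm,
    Real.norm_eq_abs] at h2
  exact h2

/-- The ratio of the geometric series in the estimate of the trace along a cone. -/
def coneRatio (n : ℕ) (p η : ℝ) : ℝ :=
  -- Half of the decay exponent `p - n`: the Morrey factor of the level `k` is then `q ^ k * q ^ k`,
  -- as `abs_sub_rpow_le_of_geometric` requires.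
  (1 - 1 / (4 * η)) ^ ((p - n) / 2)

/-- The constant in the estimate of the oscillation of a Sobolev function over disjoint cones. -/
def coneSumConst (n : ℕ) (p η : ℝ) : ℝ :=
  morreyConst n p * (1 / 4) ^ (p - n) * (n : ℝ) ^ p *
    (1 / (1 - coneRatio n p η ^ (1 / p))) ^ p * (overlapConst n η * (1 / (1 - coneRatio n p η)))

/-- For each cube the increments of `F` along the axis of the cone are summed geometrically;
exchanging the sums over cubes and levels, the energies of each level add up to at most the overlap
constant times the total energy. The trace enters only in the limit of the finite chains. -/
theorem sum_sub_center_rpow_le (h : Ω.IsSobolevWith p F g) (hp1 : 1 ≤ p) (hp : (n : ℝ) < p)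
    {f : Ω.alphaBoundary α → ℝ} (hF : Ω.IsTrace α F f) {η : ℝ} (hη : 1 ≤ η) {m : ℕ}
    (Q : Fin m → AxisCube n) (ω : Fin m → Ω.alphaBoundary α)
    (hdisj : Pairwise fun i j => Disjoint (Q i).toSet (Q j).toSet)
    (hvis : ∀ i, Ω.IsAlphaVisible α (Q i) (ω i))
    (hω : ∀ i, Ω.limitPoint α (ω i) ∈ (Q i).dilate η ∩ frontier Ω.carrier) :
    ∑ i, |f (ω i) - F (Q i).center| ^ p / (Q i).radius ^ (p - n) ≤
      coneSumConst n p η * (∫⁻ z in Ω.carrier, ‖g z‖ₑ ^ p).toReal := by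
  have hp0 : 0 < p := by linarith
  have hη0 : 0 < η := by linarith
  have hC := morreyConst_nonneg hp1 hp
  have hpn : 0 < p - n := by linarith
  unfold coneSumConst
  -- The apex is at distance at most `η r` from the center, so with this ratio consecutive points
  -- are at most `t ^ k * r / 4` apart, within the half ball in which Morrey's inequality is
  -- available.
  set t : ℝ := 1 - 1 / (4 * η) with ht
  have hinv : 1 / (4 * η) ≤ 1 / 4 := one_div_le_one_div_of_le (by norm_num) (by linarith)
  have hinv0 : 0 < 1 / (4 * η) := by positivity
  have ht0 : 0 < t := by linarith
  have ht1 : t < 1 := by linarith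
  set q := coneRatio n p η with hq
  have hqdef : q = t ^ ((p - n) / 2) := rfl
  have hq0 : 0 < q := Real.rpow_pos_of_pos ht0 _
  have hq1 : q < 1 := Real.rpow_lt_one ht0.le ht1 (by positivity)
  set M := morreyConst n p * (1 / 4) ^ (p - n) * (n : ℝ) ^ p with hM
  have hM0 : 0 ≤ M := by positivity
  set W := (1 / (1 - q ^ (1 / p))) ^ p with hW
  have hW0 : 0 ≤ W := by
    have : q ^ (1 / p) < 1 := Real.rpow_lt_one hq0.le hq1 (by positivity)
    have : 0 < 1 - q ^ (1 / p) := by linarith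
    positivity
  set N := overlapConst n η with hN
  have hN0 : 0 ≤ N := by
    rw [hN, overlapConst]
    positivity
  set I := (∫⁻ z in Ω.carrier, ‖g z‖ₑ ^ p).toReal with hI
  have hI0 : 0 ≤ I := ENNReal.toReal_nonneg
  have hIfin := h.setLIntegral_ne_top hp0
  have htk : ∀ k : ℕ, t ^ k ∈ Ioc (0 : ℝ) 1 := fun k =>
    ⟨by positivity, pow_le_one₀ ht0.le ht1.le⟩
  set c : Fin m → ℕ → Fin n → ℝ := fun i k =>
    AffineMap.lineMap (Ω.limitPoint α (ω i)) (Q i).center (t ^ k) with hc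
  have hcone := fun i => (hvis i).1.containsCone
  set B : Fin m → ℕ → Set (Fin n → ℝ) := fun i k =>
    Metric.closedBall (c i k) (t ^ k * (Q i).radius / 2) with hB
  have hBΩ : ∀ i k, B i k ⊆ Ω.carrier := fun i k => by
    have := mul_pos (htk k).1 (Q i).radius_pos
    exact (Metric.closedBall_subset_ball (by linarith)).trans ((hcone i).2 _ (htk k))
  set a : Fin m → ℕ → ℝ := fun i k => (∫⁻ z in B i k, ‖g z‖ₑ ^ p).toReal with ha
  have hBfin : ∀ i k, ∫⁻ z in B i k, ‖g z‖ₑ ^ p ≠ ⊤ := fun i k =>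
    ne_top_of_le_ne_top hIfin (lintegral_mono_set (hBΩ i k))
  have hgm : AEMeasurable (fun z => ‖g z‖ₑ ^ p) (volume.restrict Ω.carrier) :=
    h.memLp.aestronglyMeasurable.enorm.pow_const p
  have hlevel : ∀ k, ∑ i, a i k ≤ N * I := fun k => by
    have h1 := sum_setLIntegral_cone_ball_le hη Q (fun i => Ω.limitPoint α (ω i)) hdisj hcone hω
      (htk k) hgm
    have h2 := ENNReal.toReal_mono (ENNReal.mul_ne_top ENNReal.ofReal_ne_top hIfin) h1
    rw [ENNReal.toReal_mul, ENNReal.toReal_ofReal hN0, ENNReal.toReal_sum fun i _ => hBfin i k]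
      at h2
    exact h2
  have hstep : ∀ i k, |F (c i (k + 1)) - F (c i k)| ^ p ≤
      M * (Q i).radius ^ (p - n) * (q ^ k * q ^ k) * a i k := by
    intro i k
    have hr := (Q i).radius_pos
    have hk := (htk k).1
    have h1 := h.abs_sub_rpow_le hp1 hp (c := c i k) (x := c i (k + 1)) (x' := c i k)
      (r := t ^ k * (Q i).radius / 2) (by positivity) (hBΩ i k) ?_
      (Metric.mem_closedBall_self (by positivity))
    · refine h1.trans (le_of_eq ?_)
      have e1 : q ^ k * q ^ k = (t ^ k) ^ (p - n) := by
        rw [← mul_pow, hqdef, ← Real.rpow_add ht0, add_halves, ← Real.rpow_natCast,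
          ← Real.rpow_natCast, ← Real.rpow_mul ht0.le, ← Real.rpow_mul ht0.le, mul_comm]
      have e2 : (t ^ k * (Q i).radius / 2 / 2) ^ (p - n) =
          (t ^ k) ^ (p - n) * (Q i).radius ^ (p - n) * (1 / 4) ^ (p - n) := by
        rw [← Real.mul_rpow (by positivity) hr.le, ← Real.mul_rpow (by positivity) (by norm_num)]
        congr 1
        ring
      rw [e1, e2, hM]
      ring
    · rw [Metric.mem_closedBall, hc]
      simp only
      rw [dist_lineMap_lineMap, Real.dist_eq, abs_sub_comm, abs_of_nonneg (by
        rw [pow_succ]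
        nlinarith)]
      have h2 : dist (Ω.limitPoint α (ω i)) (Q i).center ≤ η * (Q i).radius := (hω i).1
      have h3 : t ^ k - t ^ (k + 1) = t ^ k * (1 / (4 * η)) := by
        rw [pow_succ, ht]
        ring
      rw [h3]
      calc t ^ k * (1 / (4 * η)) * dist (Ω.limitPoint α (ω i)) (Q i).center
          ≤ t ^ k * (1 / (4 * η)) * (η * (Q i).radius) :=
            mul_le_mul_of_nonneg_left h2 (by positivity)
        _ = t ^ k * (Q i).radius / 2 / 2 := by
            field_simp
            ring
  have hc0 : ∀ i, c i 0 = (Q i).center := fun i => by simp [hc]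
  have hfinite : ∀ K, ∑ i, |F (c i K) - F (Q i).center| ^ p / (Q i).radius ^ (p - n) ≤
      M * W * (N * (1 / (1 - q))) * I := by
    intro K
    have h1 : ∀ i, |F (c i K) - F (Q i).center| ^ p / (Q i).radius ^ (p - n) ≤
        ∑ k ∈ Finset.range K, M * W * (q ^ k * a i k) := by
      intro i
      have hr := (Q i).radius_pos
      rw [div_le_iff₀ (by positivity), ← hc0 i, ← Finset.mul_sum]
      have h2 := abs_sub_rpow_le_of_geometric hp0 hq0 hq1
        (M := M * (Q i).radius ^ (p - n)) (by positivity) (v := fun k => F (c i k)) (a := a i)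
        (fun k => ENNReal.toReal_nonneg) (hstep i) K
      refine h2.trans (le_of_eq ?_)
      ring
    refine (Finset.sum_le_sum fun i _ => h1 i).trans ?_
    rw [Finset.sum_comm]
    simp only [← Finset.mul_sum]
    have h3 : ∑ k ∈ Finset.range K, q ^ k * ∑ i, a i k ≤ N * (1 / (1 - q)) * I := by
      calc ∑ k ∈ Finset.range K, q ^ k * ∑ i, a i k
          ≤ ∑ k ∈ Finset.range K, q ^ k * (N * I) :=
            Finset.sum_le_sum fun k _ => mul_le_mul_of_nonneg_left (hlevel k) (by positivity)
        _ = (∑ k ∈ Finset.range K, q ^ k) * (N * I) := (Finset.sum_mul _ _ _).symm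
        _ ≤ (1 / (1 - q)) * (N * I) := by
            refine mul_le_mul_of_nonneg_right ?_ (by positivity)
            rw [one_div, ← tsum_geometric_of_lt_one hq0.le hq1]
            exact (summable_geometric_of_lt_one hq0.le hq1).sum_le_tsum _ fun k _ => by positivity
        _ = N * (1 / (1 - q)) * I := by ring
    calc M * W * ∑ k ∈ Finset.range K, q ^ k * ∑ i, a i k
        ≤ M * W * (N * (1 / (1 - q)) * I) := mul_le_mul_of_nonneg_left h3 (by positivity)
      _ = _ := by ring
  have hlim : Tendsto
      (fun K => ∑ i, |F (c i K) - F (Q i).center| ^ p / (Q i).radius ^ (p - n)) atTop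
      (𝓝 (∑ i, |f (ω i) - F (Q i).center| ^ p / (Q i).radius ^ (p - n))) := by
    refine tendsto_finsetSum _ fun i _ => ?_
    have h1 := hF.tendsto_of_isAlphaVisible (hvis i) htk
      (tendsto_pow_atTop_nhds_zero_of_lt_one ht0.le ht1)
    exact ((h1.sub_const _).abs.rpow_const (Or.inr hp0.le)).div_const _
  exact le_of_tendsto hlim (Eventually.of_forall hfinite)

/-- The constant in the variational inequality for the trace of a Sobolev function. -/
def variationConst (n : ℕ) (p η : ℝ) : ℝ :=
  2 ^ p * 2 * coneSumConst n p η

/-- Traces of Sobolev functions satisfy the variational inequality. -/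
theorem IsTrace.variationBound (h : Ω.IsSobolevWith p F g) (hn : 1 ≤ n)
    (hp : (n : ℝ) < p) {f : Ω.alphaBoundary α → ℝ} (hF : Ω.IsTrace α F f) {η : ℝ} (hη : 1 ≤ η)
    {lam : ℝ} (hlam : variationConst n p η * (∫⁻ z in Ω.carrier, ‖g z‖ₑ ^ p).toReal ≤ lam) :
    Ω.VariationBound p α η f lam := by
  have hp1 : 1 ≤ p := (Nat.one_le_cast.2 hn).trans hp.le
  have hp0 : 0 < p := by linarith
  intro m Q ω₁ ω₂ _ hdisj hvis hω
  have h₁ := sum_sub_center_rpow_le h hp1 hp hF hη Q ω₁ hdisj (fun i => (hvis i).1)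
    fun i => (hω i).1
  have h₂ := sum_sub_center_rpow_le h hp1 hp hF hη Q ω₂ hdisj (fun i => (hvis i).2)
    fun i => (hω i).2
  refine le_trans ?_ hlam
  have : Nonempty (Fin n) := ⟨⟨0, hn⟩⟩
  have hdiam : ∀ i, (Q i).radius ≤ Metric.diam (Q i).toSet := fun i => by
    have hr := (Q i).radius_pos
    rw [AxisCube.toSet, Metric.diam_closedBall_eq _ hr.le]
    linarith
  calc ∑ i, |f (ω₁ i) - f (ω₂ i)| ^ p / Metric.diam (Q i).toSet ^ (p - n)
      ≤ ∑ i, 2 ^ p * (|f (ω₁ i) - F (Q i).center| ^ p / (Q i).radius ^ (p - n) +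
          |f (ω₂ i) - F (Q i).center| ^ p / (Q i).radius ^ (p - n)) := by
        refine Finset.sum_le_sum fun i _ => ?_
        have hr := (Q i).radius_pos
        rw [← add_div, ← mul_div_assoc]
        refine div_le_div₀ (by positivity) ?_ (by positivity)
          (Real.rpow_le_rpow hr.le (hdiam i) (by linarith))
        have h3 := abs_add_rpow_le p hp0.le (f (ω₁ i) - F (Q i).center)
          (F (Q i).center - f (ω₂ i))
        rwa [sub_add_sub_cancel, abs_sub_comm (F (Q i).center)] at h3
    _ = 2 ^ p * (∑ i, |f (ω₁ i) - F (Q i).center| ^ p / (Q i).radius ^ (p - n) +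
          ∑ i, |f (ω₂ i) - F (Q i).center| ^ p / (Q i).radius ^ (p - n)) := by
        rw [← Finset.mul_sum, Finset.sum_add_distrib]
    _ ≤ 2 ^ p * (coneSumConst n p η * (∫⁻ z in Ω.carrier, ‖g z‖ₑ ^ p).toReal +
          coneSumConst n p η * (∫⁻ z in Ω.carrier, ‖g z‖ₑ ^ p).toReal) :=
        mul_le_mul_of_nonneg_left (add_le_add h₁ h₂) (by positivity)
    _ = _ := by
        rw [variationConst]
        ring

end SpaceDomain

/-! ### Weighted means -/

theorem abs_weightedMean_sub_le {ι : Type*} (T : Finset ι) {w v : ι → ℝ} {c D : ℝ}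
    (hw : ∀ i ∈ T, 0 ≤ w i) (hW : 0 < ∑ i ∈ T, w i)
    (hv : ∀ i ∈ T, w i ≠ 0 → |v i - c| ≤ D) :
    |(∑ i ∈ T, w i * v i) / (∑ i ∈ T, w i) - c| ≤ D := by
  have e : (∑ i ∈ T, w i * v i) / (∑ i ∈ T, w i) - c =
      (∑ i ∈ T, w i * (v i - c)) / ∑ i ∈ T, w i := by
    simp only [mul_sub, Finset.sum_sub_distrib, ← Finset.sum_mul]
    field_simp
  rw [e, abs_div, abs_of_pos hW, div_le_iff₀ hW, Finset.mul_sum]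
  refine (Finset.abs_sum_le_sum_abs _ _).trans (Finset.sum_le_sum fun i hi => ?_)
  rw [abs_mul, abs_of_nonneg (hw i hi), mul_comm]
  rcases eq_or_ne (w i) 0 with h | h
  · simp [h]
  · exact mul_le_mul_of_nonneg_right (hv i hi h) (hw i hi)

/-- With `m` the mean for `w`, the sum of `w i * (v i - m)` vanishes, so the numerator of the
difference is the sum of `(w' i - w i) * (v i - m)`: only the change of the weights and the
deviation of the values matter. The bound is linear in that change and serves as a derivative
estimate. -/
theorem abs_weightedMean_sub_weightedMean_le {ι : Type*} (T : Finset ι) {w w' v : ι → ℝ} {c D : ℝ}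
    (hw : ∀ i ∈ T, 0 ≤ w i) (hW : 1 ≤ ∑ i ∈ T, w i) (hW' : 1 ≤ ∑ i ∈ T, w' i)
    (hv : ∀ i ∈ T, |v i - c| ≤ D) (hD : 0 ≤ D) :
    |(∑ i ∈ T, w' i * v i) / (∑ i ∈ T, w' i) - (∑ i ∈ T, w i * v i) / (∑ i ∈ T, w i)| ≤
      2 * D * ∑ i ∈ T, |w' i - w i| := by
  set W := ∑ i ∈ T, w i with hWdef
  set W' := ∑ i ∈ T, w' i with hWdef'
  have hW0 : 0 < W := by linarith
  have hW0' : 0 < W' := by linarith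
  set m := (∑ i ∈ T, w i * v i) / W with hm
  have hmc : |m - c| ≤ D := abs_weightedMean_sub_le T hw hW0 fun i hi _ => hv i hi
  have hmW : m * W = ∑ i ∈ T, w i * v i := div_mul_cancel₀ _ hW0.ne'
  have e : (∑ i ∈ T, w' i * v i) / W' - m =
      (∑ i ∈ T, (w' i - w i) * (v i - c) - (m - c) * ∑ i ∈ T, (w' i - w i)) / W' := by
    rw [eq_div_iff hW0'.ne', sub_mul, div_mul_cancel₀ _ hW0'.ne']
    simp only [sub_mul, mul_sub, Finset.sum_sub_distrib, ← Finset.sum_mul, ← hWdef, ← hWdef']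
    linarith
  rw [e, abs_div, abs_of_pos hW0', div_le_iff₀ hW0']
  have h1 : |∑ i ∈ T, (w' i - w i) * (v i - c)| ≤ D * ∑ i ∈ T, |w' i - w i| := by
    rw [Finset.mul_sum]
    refine (Finset.abs_sum_le_sum_abs _ _).trans (Finset.sum_le_sum fun i hi => ?_)
    rw [abs_mul, mul_comm]
    exact mul_le_mul_of_nonneg_right (hv i hi) (abs_nonneg _)
  have h2 : |(m - c) * ∑ i ∈ T, (w' i - w i)| ≤ D * ∑ i ∈ T, |w' i - w i| := by
    rw [abs_mul]
    exact mul_le_mul hmc (Finset.abs_sum_le_sum_abs _ _) (abs_nonneg _) hD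
  have h3 : 0 ≤ 2 * D * ∑ i ∈ T, |w' i - w i| :=
    mul_nonneg (by positivity) (Finset.sum_nonneg fun _ _ => abs_nonneg _)
  calc |∑ i ∈ T, (w' i - w i) * (v i - c) - (m - c) * ∑ i ∈ T, (w' i - w i)|
      ≤ 2 * D * ∑ i ∈ T, |w' i - w i| := (abs_sub _ _).trans (by linarith)
    _ ≤ _ := le_mul_of_one_le_right h3 hW'

theorem dist_lineMap_le_combination {n : ℕ} (a y x : Fin n → ℝ) {u : ℝ} (hu : u ∈ Icc (0 : ℝ) 1) :
    dist (AffineMap.lineMap a y u : Fin n → ℝ) x ≤ (1 - u) * dist a x + u * dist y x := by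
  have e : (AffineMap.lineMap a y u : Fin n → ℝ) - x = (1 - u) • (a - x) + u • (y - x) := by
    ext i
    simp only [AffineMap.lineMap_apply, vsub_eq_sub, vadd_eq_add, Pi.add_apply, Pi.smul_apply,
      Pi.sub_apply, smul_eq_mul]
    ring
  rw [dist_eq_norm, e, dist_eq_norm, dist_eq_norm]
  refine (norm_add_le _ _).trans ?_
  rw [norm_smul, norm_smul, Real.norm_eq_abs, Real.norm_eq_abs, abs_of_nonneg hu.1,
    abs_of_nonneg (by linarith [hu.2])]

namespace SpaceDomain

variable {n : ℕ} {Ω : SpaceDomain n} {α : Ioc (0 : ℝ) 1}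

/-! ### The distance to the complement and the nearest boundary elements -/

/-- The distance to the complement of `Ω`. -/
def bdist (Ω : SpaceDomain n) (x : Fin n → ℝ) : ℝ :=
  Metric.infDist x Ω.carrierᶜ

theorem bdist_pos (hne : Ω.carrierᶜ.Nonempty) {x : Fin n → ℝ} (hx : x ∈ Ω.carrier) :
    0 < Ω.bdist x :=
  (Ω.isOpen.isClosed_compl.notMem_iff_infDist_pos hne).1 fun h => h hx

theorem ball_bdist_subset (Ω : SpaceDomain n) (x : Fin n → ℝ) :
    Metric.ball x (Ω.bdist x) ⊆ Ω.carrier := by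
  have h : Disjoint (Metric.ball x (Ω.bdist x)) Ω.carrierᶜ := Metric.disjoint_ball_infDist
  exact disjoint_compl_right_iff_subset.1 h

theorem bdist_le_add_dist (Ω : SpaceDomain n) (x y : Fin n → ℝ) :
    Ω.bdist x ≤ Ω.bdist y + dist x y :=
  Metric.infDist_le_infDist_add_dist

theorem bdist_le_dist_of_mem_frontier {a : Fin n → ℝ} (ha : a ∈ frontier Ω.carrier) (x : Fin n → ℝ) :
    Ω.bdist x ≤ dist x a := by
  rw [Ω.isOpen.frontier_eq] at ha
  exact Metric.infDist_le_dist_of_mem ha.2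

/-- Every point `x` of `Ω` has a nearest element of the `α`-boundary, which is visible from
every cube in the largest ball about `x` in `Ω`. -/
theorem exists_nearest_boundary_element (α : Ioc (0 : ℝ) 1) (hne : Ω.carrierᶜ.Nonempty)
    {x : Fin n → ℝ} (hx : x ∈ Ω.carrier) :
    ∃ ω : Ω.alphaBoundary α, dist x (Ω.limitPoint α ω) = Ω.bdist x ∧
      dist (Ω.toSubhyp α x hx : Ω.SubhypCompletion α) ω ≤
        (1 / (2 ^ (α : ℝ) - 1) + 1) * Ω.bdist x ^ (α : ℝ) ∧
      ∀ Q : AxisCube n, dist x Q.center + Q.radius < Ω.bdist x → Ω.IsAlphaVisible α Q ω := by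
  obtain ⟨a, haΩ, hxa⟩ := Ω.isOpen.isClosed_compl.exists_infDist_eq_dist hne x
  have hd : dist x a = Ω.bdist x := hxa.symm
  have hd0 := bdist_pos hne hx
  set d := Ω.bdist x with hddef
  have hcone : Ω.ContainsCone a x d := by
    refine ⟨hd0, fun u hu => (Metric.ball_subset_ball' ?_).trans (Ω.ball_bdist_subset x)⟩
    have := dist_lineMap_le_combination a x x (u := u) ⟨hu.1.le, hu.2⟩
    rw [dist_self, dist_comm a x, hd] at this
    linarith
  obtain ⟨ω, hωa, hω⟩ := hcone.exists_limit α
  have haf : a ∈ frontier Ω.carrier := by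
    rw [Ω.isOpen.frontier_eq]
    exact ⟨hωa ▸ Ω.limitPoint_mem_closure α ω, haΩ⟩
  have hωb : ω ∈ Ω.alphaBoundary α := (Ω.mem_alphaBoundary_iff α).2 (hωa ▸ haf)
  have hCeq : coneConst α a x d = (1 / (2 ^ (α : ℝ) - 1) + 1) * d ^ (α : ℝ) := by
    rw [coneConst, ← dist_eq_norm, hd, Real.rpow_sub_one hd0.ne']
    field_simp
  refine ⟨⟨ω, hωb⟩, hωa ▸ hd, ?_, fun Q hQ => ?_⟩
  · have h1 := hω 1 ⟨one_pos, le_rfl⟩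
    rw [Real.one_rpow, mul_one, hCeq] at h1
    simpa using h1
  have hQr := Q.radius_pos
  -- The boundary point `a` lies on the sphere about `x`, so convexity of the norm leaves room `u *
  -- (d - dist y x)` inside the maximal ball.
  have hball : ∀ y, dist y x < d → ∀ u ∈ Ioc (0 : ℝ) 1, ∀ z,
      dist z (AffineMap.lineMap a y u) < u * (d - dist y x) → z ∈ Ω.carrier := by
    intro y hy u hu z hz
    refine Ω.ball_bdist_subset x (Metric.mem_ball.2 ?_)
    have h1 := dist_lineMap_le_combination a y x (u := u) ⟨hu.1.le, hu.2⟩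
    rw [dist_comm a x, hd] at h1
    linarith [dist_triangle z (AffineMap.lineMap a y u) x]
  have hvis : Ω.IsVisible Q a := by
    refine ⟨hωa ▸ Ω.limitPoint_mem_closure α ω, ?_⟩
    rintro y hy _ ⟨u, hu, rfl⟩
    have hyx : dist y x < d := by
      have := Metric.mem_closedBall.1 hy
      linarith [dist_triangle y Q.center x, dist_comm x Q.center]
    refine hball y hyx u hu _ ?_
    rw [dist_self]
    exact mul_pos hu.1 (by linarith)
  change Ω.IsVisible Q (Ω.limitPoint α ω) ∧ ∃ y : ℕ → Ω.Subhyp α,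
    (∀ i, (y i).pt ∈ AffineMap.lineMap (Ω.limitPoint α ω) Q.center '' Ioc (0 : ℝ) 1) ∧
      Tendsto (fun i => (y i : Ω.SubhypCompletion α)) atTop (𝓝 ω)
  rw [hωa]
  refine ⟨hvis, ?_⟩
  set t : ℕ → ℝ := fun k => 1 / ((k : ℝ) + 1) with ht
  have ht1 : ∀ k, t k ∈ Ioc (0 : ℝ) 1 := fun k =>
    ⟨by positivity, (div_le_one (by positivity)).2 (by linarith [k.cast_nonneg (α := ℝ)])⟩
  have ht0 : Tendsto t atTop (𝓝 0) := tendsto_one_div_add_atTop_nhds_zero_nat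
  have hQc := hvis.containsCone
  refine ⟨fun k => Ω.toSubhyp α _ (hQc.mem (ht1 k)), fun k => ⟨t k, ht1 k, rfl⟩, ?_⟩
  set l := dist x Q.center with hl
  set ρ := d - l with hρ
  have hρ0 : 0 < ρ := by linarith
  have hl0 : 0 ≤ l := dist_nonneg
  -- The element `ω` was built along the segment to `x`, while visibility asks for the segment to
  -- the center of `Q`. Points of equal parameter `t` on the two are `t * l` apart, joined by a
  -- segment with room `t * ρ`, so their distance is of order `t ^ α`.
  have hbound : ∀ k, dist (Ω.toSubhyp α _ (hQc.mem (ht1 k)) : Ω.SubhypCompletion α) ω ≤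
      (l * ρ ^ ((α : ℝ) - 1) + l ^ (α : ℝ) + coneConst α a x d) * t k ^ (α : ℝ) := by
    intro k
    have hk := ht1 k
    refine (dist_triangle _ (Ω.toSubhyp α _ (hcone.mem hk) : Ω.SubhypCompletion α) _).trans ?_
    rw [add_mul]
    refine add_le_add ?_ (hω _ hk)
    have hnorm : ‖(AffineMap.lineMap a x (t k) : Fin n → ℝ) -
        AffineMap.lineMap a Q.center (t k)‖ = t k * l := by
      have e : (AffineMap.lineMap a x (t k) : Fin n → ℝ) - AffineMap.lineMap a Q.center (t k) =
          t k • (x - Q.center) := by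
        ext i
        simp only [AffineMap.lineMap_apply, vsub_eq_sub, vadd_eq_add, Pi.add_apply, Pi.smul_apply,
          Pi.sub_apply, smul_eq_mul]
        ring
      rw [e, norm_smul, Real.norm_eq_abs, abs_of_pos hk.1, hl, dist_eq_norm]
    rw [Completion.dist_eq, Subhyp.dist_def, pt_toSubhyp, pt_toSubhyp, add_mul,
      norm_sub_rev, hnorm, Real.mul_rpow hk.1.le hl0, mul_comm (l ^ (α : ℝ))]
    refine add_le_add ?_ le_rfl
    refine (Ω.subhypDist_le_of_ball_subset α.2.2 (mul_pos hk.1 hρ0) fun v hv => ?_).trans ?_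
    · intro z hz
      have e : AffineMap.lineMap (AffineMap.lineMap a Q.center (t k) : Fin n → ℝ)
          (AffineMap.lineMap a x (t k)) v =
          (AffineMap.lineMap a (AffineMap.lineMap Q.center x v : Fin n → ℝ) (t k) :
            Fin n → ℝ) := by
        ext i
        simp only [AffineMap.lineMap_apply, vsub_eq_sub, vadd_eq_add, Pi.add_apply, Pi.smul_apply,
          Pi.sub_apply, smul_eq_mul]
        ring
      rw [e] at hz
      have h1 : dist (AffineMap.lineMap Q.center x v : Fin n → ℝ) x ≤ l := by
        have := dist_lineMap_le_combination Q.center x x hv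
        rw [dist_self, dist_comm Q.center x] at this
        nlinarith [hv.1]
      refine hball _ (by linarith) _ hk z ((Metric.mem_ball.1 hz).trans_le ?_)
      exact mul_le_mul_of_nonneg_left (by linarith) hk.1.le
    · rw [hnorm, Real.mul_rpow hk.1.le hρ0.le, Real.rpow_sub_one hk.1.ne']
      refine le_of_eq ?_
      have := hk.1
      field_simp
  rw [tendsto_iff_dist_tendsto_zero]
  have hlim := (ht0.rpow_const (p := (α : ℝ)) (Or.inr α.2.1.le)).const_mul
    (l * ρ ^ ((α : ℝ) - 1) + l ^ (α : ℝ) + coneConst α a x d)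
  rw [Real.zero_rpow α.2.1.ne', mul_zero] at hlim
  exact squeeze_zero (fun _ => dist_nonneg) hbound hlim

/-! ### Nets of Whitney type -/

/-- A maximal set of points of `Ω` that are separated at the scale of the distance to the
complement. -/
structure WhitneyNet (Ω : SpaceDomain n) where
  /-- The points of the net. -/
  pts : Set (Fin n → ℝ)
  subset : pts ⊆ Ω.carrier
  -- This makes the cubes of radius `bdist / 20` about the points disjoint. Maximality then covers
  -- `Ω` within `2 / 19 < 1 / 9` of `bdist y`, since `bdist` is 1-Lipschitz.
  separated : ∀ x ∈ pts, ∀ y ∈ pts, x ≠ y → (Ω.bdist x + Ω.bdist y) / 20 < dist x y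
  cover : ∀ x ∈ Ω.carrier, ∃ y ∈ pts, dist x y ≤ Ω.bdist y / 9

theorem exists_whitneyNet (Ω : SpaceDomain n) : Nonempty Ω.WhitneyNet := by
  set S : Set (Set (Fin n → ℝ)) := {J | J ⊆ Ω.carrier ∧
    ∀ x ∈ J, ∀ y ∈ J, x ≠ y → (Ω.bdist x + Ω.bdist y) / 20 < dist x y} with hS
  obtain ⟨J, hJ⟩ : ∃ J, Maximal (· ∈ S) J := by
    refine zorn_subset S fun c hcS hc => ⟨⋃₀ c, ⟨sUnion_subset fun J hJ => (hcS hJ).1, ?_⟩,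
      fun J hJ => subset_sUnion_of_mem hJ⟩
    rintro x ⟨J, hJ, hxJ⟩ y ⟨J', hJ', hyJ'⟩ hxy
    rcases hc.total hJ hJ' with h | h
    · exact (hcS hJ').2 x (h hxJ) y hyJ' hxy
    · exact (hcS hJ).2 x hxJ y (h hyJ') hxy
  refine ⟨⟨J, hJ.prop.1, hJ.prop.2, fun x hx => ?_⟩⟩
  by_contra! hcon
  have hb : ∀ y ∈ J, (Ω.bdist x + Ω.bdist y) / 20 < dist x y := fun y hy => by
    have h1 := hcon y hy
    have h2 := Ω.bdist_le_add_dist x y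
    have h3 : 0 ≤ Ω.bdist y := Metric.infDist_nonneg
    linarith
  have hmem : insert x J ∈ S := by
    refine ⟨insert_subset hx hJ.prop.1, ?_⟩
    rintro y (rfl | hy) z (rfl | hz) hyz
    · exact absurd rfl hyz
    · exact hb z hz
    · rw [dist_comm, add_comm]
      exact hb y hy
    · exact hJ.prop.2 y hy z hz hyz
  have hxJ : x ∈ J := hJ.le_of_ge hmem (subset_insert x J) (mem_insert x J)
  have h1 := hcon x hxJ
  rw [dist_self] at h1
  have h3 : 0 ≤ Ω.bdist x := Metric.infDist_nonneg
  linarith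

namespace WhitneyNet

variable (J : Ω.WhitneyNet)

theorem bdist_pos (hne : Ω.carrierᶜ.Nonempty) (j : J.pts) : 0 < Ω.bdist j :=
  SpaceDomain.bdist_pos hne (J.subset j.2)

/-- The neighbours of a point of the net. -/
def nbhd (j : J.pts) : Set J.pts :=
  -- If the balls of radii `bdist / 8` about `i` and `j` meet, then `dist i j < (2 * bdist j + dist
  -- i j) / 8`, which gives `2 / 7`.
  {i | dist (i : Fin n → ℝ) j ≤ 2 / 7 * Ω.bdist j}

theorem card_le_of_subset_nbhd (hne : Ω.carrierᶜ.Nonempty) (j : J.pts) (s : Finset J.pts)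
    (hs : ∀ i ∈ s, i ∈ J.nbhd j) : (s.card : ℝ) ≤ 9 ^ n := by
  have hd := J.bdist_pos hne j
  -- Neighbours have `bdist` at least `5 / 7` of that of `j`, so they are separated by `bdist j / 14
  -- = 2 * ρ`, and `2 / 7 = 8 / 28` gives `R = 8`.
  have h := card_le_of_pairwise_lt_dist s (fun i : J.pts => (i : Fin n → ℝ)) j
    (ρ := Ω.bdist j / 28) (R := 8) (by positivity) (by norm_num) ?_ ?_
  · norm_num at h
    exact_mod_cast h
  · have hlow : ∀ i ∈ s, 5 / 7 * Ω.bdist j ≤ Ω.bdist i := fun i hi => by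
      have h1 : dist (i : Fin n → ℝ) j ≤ 2 / 7 * Ω.bdist j := hs i hi
      have h2 := Ω.bdist_le_add_dist j i
      rw [dist_comm] at h2
      linarith
    intro i hi i' hi' hii
    have h1 := J.separated i i.2 i' i'.2 fun h => hii (Subtype.ext h)
    linarith [hlow i hi, hlow i' hi']
  · intro i hi
    have h1 : dist (i : Fin n → ℝ) j ≤ 2 / 7 * Ω.bdist j := hs i hi
    linarith

theorem finite_nbhd (hne : Ω.carrierᶜ.Nonempty) (j : J.pts) : (J.nbhd j).Finite := by
  by_contra hinf
  obtain ⟨s, hs, hcard⟩ := Set.Infinite.exists_subset_card_eq hinf (9 ^ n + 1)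
  have h := J.card_le_of_subset_nbhd hne j s fun i hi => hs hi
  rw [hcard] at h
  push_cast at h
  linarith

theorem mem_nbhd_of_dist_lt {i j : J.pts} {x : Fin n → ℝ}
    (hi : dist x i < Ω.bdist i / 8) (hj : dist x j < Ω.bdist j / 8) : i ∈ J.nbhd j := by
  have h1 := Ω.bdist_le_add_dist i j
  have h2 := dist_triangle_left (i : Fin n → ℝ) j x
  change dist (i : Fin n → ℝ) j ≤ 2 / 7 * Ω.bdist j
  linarith

theorem self_mem_nbhd (j : J.pts) : j ∈ J.nbhd j := by
  have h3 : 0 ≤ Ω.bdist j := Metric.infDist_nonneg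
  change dist (j : Fin n → ℝ) j ≤ 2 / 7 * Ω.bdist j
  rw [dist_self]
  positivity

theorem countable (hne : Ω.carrierᶜ.Nonempty) : Countable J.pts := by
  refine Set.PairwiseDisjoint.countable_of_isOpen (s := fun x => Metric.ball x (Ω.bdist x / 20))
    (a := J.pts) ?_ (fun x _ => Metric.isOpen_ball) fun x hx =>
    Metric.nonempty_ball.2 (by linarith [J.bdist_pos hne ⟨x, hx⟩])
  intro x hx y hy hxy
  exact Metric.ball_disjoint_ball (by linarith [J.separated x hx y hy hxy])

end WhitneyNet

end SpaceDomain

/-! ### Bump functions and weak gradients of continuously differentiable functions -/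

/-- The bump function that generates the partitions of unity. -/
def whitneyBump (n : ℕ) : ContDiffBump (0 : Fin n → ℝ) :=
  -- The inner radius is the covering radius of the net, so the weights sum to at least one; the
  -- outer radius is the one behind the neighbourhoods with `2 / 7`.
  ⟨1 / 9, 1 / 8, by norm_num, by norm_num⟩

namespace SpaceDomain

variable {n : ℕ} {Ω : SpaceDomain n} {α : Ioc (0 : ℝ) 1}

theorem isWeakGradient_of_contDiffOn {F : (Fin n → ℝ) → ℝ} (hF : ContDiffOn ℝ 1 F Ω.carrier) :
    Ω.IsWeakGradient F fun x i => fderiv ℝ F x (Pi.single i 1) := by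
  intro φ hφ hφc hφΩ i
  have hint : ∀ h : (Fin n → ℝ) → ℝ, ContinuousOn h Ω.carrier →
      Function.support h ⊆ tsupport φ → Integrable h := fun h hc hs =>
    (integrableOn_iff_integrable_of_support_subset hs).1
      ((hc.mono hφΩ).integrableOn_compact hφc)
  have hφ1 : ContDiff ℝ 1 φ := hφ.of_le (by exact_mod_cast le_top)
  have hdF : ContinuousOn (fun x => fderiv ℝ F x (Pi.single i 1)) Ω.carrier :=
    (hF.continuousOn_fderiv_of_isOpen Ω.isOpen le_rfl).clm_apply continuousOn_const
  have hdφ : Continuous fun x => fderiv ℝ φ x (Pi.single i 1) :=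
    (hφ1.continuous_fderiv one_ne_zero).clm_apply continuous_const
  have hsφ : ∀ x, x ∉ tsupport φ → φ x = 0 := fun x hx => image_eq_zero_of_notMem_tsupport hx
  have hsdφ : ∀ x, x ∉ tsupport φ → fderiv ℝ φ x (Pi.single i 1) = 0 := fun x hx => by
    have : fderiv ℝ φ x = 0 := image_eq_zero_of_notMem_tsupport fun h =>
      hx (tsupport_fderiv_subset ℝ h)
    simp [this]
  rw [setIntegral_eq_integral_of_forall_compl_eq_zero fun x hx => by
      rw [hsdφ x fun h => hx (hφΩ h), mul_zero],
    setIntegral_eq_integral_of_forall_compl_eq_zero fun x hx => by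
      rw [hsφ x fun h => hx (hφΩ h), mul_zero]]
  refine integral_mul_fderiv_eq_neg_fderiv_mul_of_integrable ?_ ?_ ?_ ?_ ?_
  · exact hint _ (hdF.mul hφ.continuous.continuousOn) fun x hx => by
      by_contra h
      exact hx (by simp [hsφ x h])
  · exact hint _ (hF.continuousOn.mul hdφ.continuousOn) fun x hx => by
      by_contra h
      exact hx (by simp [hsdφ x h])
  · exact hint _ (hF.continuousOn.mul hφ.continuous.continuousOn) fun x hx => by
      by_contra h
      exact hx (by simp [hsφ x h])
  · exact fun x hx => (hF.differentiableOn one_ne_zero).differentiableAt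
      (Ω.isOpen.mem_nhds (hφΩ hx))
  · exact fun x _ => hφ1.differentiable one_ne_zero x

namespace WhitneyNet

variable (J : Ω.WhitneyNet)

/-! ### The extension operator -/

/-- The bump function at the point `j` of the net, at the scale of the distance to the
complement. -/
def weight (j : J.pts) (x : Fin n → ℝ) : ℝ :=
  whitneyBump n ((Ω.bdist j)⁻¹ • (x - j))

theorem weight_nonneg (j : J.pts) (x : Fin n → ℝ) : 0 ≤ J.weight j x :=
  (whitneyBump n).nonneg

theorem contDiff_weight (j : J.pts) : ContDiff ℝ 1 (J.weight j) :=
  (whitneyBump n).contDiff.comp ((contDiff_id.sub contDiff_const).const_smul _)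

theorem norm_scaled (hne : Ω.carrierᶜ.Nonempty) (j : J.pts) (x : Fin n → ℝ) :
    ‖(Ω.bdist j)⁻¹ • (x - j)‖ = dist x j / Ω.bdist j := by
  rw [norm_smul, norm_inv, Real.norm_eq_abs, abs_of_pos (J.bdist_pos hne j), ← dist_eq_norm]
  ring

theorem weight_eq_one (hne : Ω.carrierᶜ.Nonempty) {j : J.pts} {x : Fin n → ℝ}
    (h : dist x j ≤ Ω.bdist j / 9) : J.weight j x = 1 := by
  have hd := J.bdist_pos hne j
  refine (whitneyBump n).one_of_mem_closedBall (mem_closedBall_zero_iff.2 ?_)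
  rw [J.norm_scaled hne, div_le_iff₀ hd]
  change dist x j ≤ 1 / 9 * Ω.bdist j
  linarith

theorem dist_lt_of_weight_ne_zero (hne : Ω.carrierᶜ.Nonempty) {j : J.pts} {x : Fin n → ℝ}
    (h : J.weight j x ≠ 0) : dist x j < Ω.bdist j / 8 := by
  have hd := J.bdist_pos hne j
  have h1 : (Ω.bdist j)⁻¹ • (x - j) ∈ Function.support (whitneyBump n) := h
  rw [(whitneyBump n).support_eq, mem_ball_zero_iff, J.norm_scaled hne, div_lt_iff₀ hd] at h1
  change dist x j < 1 / 8 * Ω.bdist j at h1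
  linarith

theorem abs_weight_sub_le (hne : Ω.carrierᶜ.Nonempty) {L : NNReal}
    (hL : LipschitzWith L (whitneyBump n)) (j : J.pts) (x y : Fin n → ℝ) :
    |J.weight j y - J.weight j x| ≤ L / Ω.bdist j * ‖y - x‖ := by
  have h := hL.dist_le_mul ((Ω.bdist j)⁻¹ • (y - j)) ((Ω.bdist j)⁻¹ • (x - j))
  rw [dist_smul₀, dist_sub_right, norm_inv, Real.norm_eq_abs, abs_of_pos (J.bdist_pos hne j),
    dist_eq_norm y x] at h
  calc |J.weight j y - J.weight j x| ≤ L * ((Ω.bdist j)⁻¹ * ‖y - x‖) := h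
    _ = _ := by ring

/-- The extension to `Ω` of a function on the net by means of a partition of unity. -/
def extend (v : J.pts → ℝ) (x : Fin n → ℝ) : ℝ :=
  (∑ᶠ i, J.weight i x * v i) / ∑ᶠ i, J.weight i x

/-- The neighbours of a point of the net, as a finite set. -/
def nbrs (hne : Ω.carrierᶜ.Nonempty) (j : J.pts) : Finset J.pts :=
  (J.finite_nbhd hne j).toFinset

variable {J}

theorem mem_nbrs (hne : Ω.carrierᶜ.Nonempty) {i j : J.pts} :
    i ∈ J.nbrs hne j ↔ dist (i : Fin n → ℝ) j ≤ 2 / 7 * Ω.bdist j := by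
  rw [nbrs, Set.Finite.mem_toFinset]
  rfl

theorem mem_nbrs_of_weight_ne_zero (hne : Ω.carrierᶜ.Nonempty) {i j : J.pts} {x : Fin n → ℝ}
    (hj : dist x j < Ω.bdist j / 8) (hi : J.weight i x ≠ 0) : i ∈ J.nbrs hne j := by
  rw [nbrs, Set.Finite.mem_toFinset]
  exact J.mem_nbhd_of_dist_lt (J.dist_lt_of_weight_ne_zero hne hi) hj

/-- The same finite index set serves for the whole ball about `j`, so the quotient can be
differentiated there. -/
theorem extend_eq (hne : Ω.carrierᶜ.Nonempty) (v : J.pts → ℝ) {j : J.pts} {x : Fin n → ℝ}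
    (hj : dist x j < Ω.bdist j / 8) :
    J.extend v x = (∑ i ∈ J.nbrs hne j, J.weight i x * v i) / ∑ i ∈ J.nbrs hne j, J.weight i x := by
  rw [extend, finsum_eq_sum_of_support_subset, finsum_eq_sum_of_support_subset]
  · exact fun i hi => mem_nbrs_of_weight_ne_zero hne hj hi
  · exact fun i hi => mem_nbrs_of_weight_ne_zero hne hj (left_ne_zero_of_mul hi)

theorem one_le_sum_weight (hne : Ω.carrierᶜ.Nonempty) {j : J.pts} {x : Fin n → ℝ}
    (hj : dist x j < Ω.bdist j / 8) : 1 ≤ ∑ i ∈ J.nbrs hne j, J.weight i x := by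
  have hd := J.bdist_pos hne j
  have hx : x ∈ Ω.carrier := Ω.ball_bdist_subset j (Metric.mem_ball.2 (by linarith))
  obtain ⟨i, hi, hxi⟩ := J.cover x hx
  have h1 : J.weight ⟨i, hi⟩ x = 1 := J.weight_eq_one hne hxi
  have hmem : (⟨i, hi⟩ : J.pts) ∈ J.nbrs hne j :=
    mem_nbrs_of_weight_ne_zero hne hj (by rw [h1]; exact one_ne_zero)
  rw [← h1]
  exact Finset.single_le_sum (f := fun i => J.weight i x) (fun i _ => J.weight_nonneg i x) hmem

theorem exists_dist_lt (hne : Ω.carrierᶜ.Nonempty) {x : Fin n → ℝ} (hx : x ∈ Ω.carrier) :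
    ∃ j : J.pts, dist x j ≤ Ω.bdist j / 9 ∧ dist x j < Ω.bdist j / 8 := by
  obtain ⟨j, hj, hxj⟩ := J.cover x hx
  exact ⟨⟨j, hj⟩, hxj, by linarith [J.bdist_pos hne ⟨j, hj⟩]⟩

theorem contDiffOn_extend (hne : Ω.carrierᶜ.Nonempty) (v : J.pts → ℝ) :
    ContDiffOn ℝ 1 (J.extend v) Ω.carrier := by
  intro x hx
  obtain ⟨j, -, hj⟩ := exists_dist_lt (J := J) hne hx
  refine ContDiffAt.contDiffWithinAt ?_
  have hev : J.extend v =ᶠ[𝓝 x] fun y =>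
      (∑ i ∈ J.nbrs hne j, J.weight i y * v i) / ∑ i ∈ J.nbrs hne j, J.weight i y := by
    filter_upwards [Metric.isOpen_ball.mem_nhds (Metric.mem_ball.2 hj)] with y hy
    exact extend_eq hne v hy
  refine ContDiffAt.congr_of_eventuallyEq ?_ hev
  refine ContDiffAt.div ?_ ?_ (by linarith [one_le_sum_weight hne hj])
  · exact ContDiffAt.sum fun i _ => (J.contDiff_weight i).contDiffAt.mul contDiffAt_const
  · exact ContDiffAt.sum fun i _ => (J.contDiff_weight i).contDiffAt

/-- At most `9 ^ n` weights are active, each with Lipschitz constant at most `2 * L / bdist j`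
because neighbours have comparable `bdist`; the weighted-mean estimate supplies the factor `2 * D`.
-/
theorem norm_fderiv_extend_le (hne : Ω.carrierᶜ.Nonempty) (v : J.pts → ℝ) {L : NNReal}
    (hL : LipschitzWith L (whitneyBump n)) {j : J.pts} {D : ℝ} (hD : 0 ≤ D)
    (hv : ∀ i ∈ J.nbrs hne j, |v i - v j| ≤ D) {x : Fin n → ℝ} (hx : dist x j ≤ Ω.bdist j / 9) :
    ‖fderiv ℝ (J.extend v) x‖ ≤ 4 * L * 9 ^ n * (D / Ω.bdist j) := by
  have hd := J.bdist_pos hne j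
  have hj : dist x j < Ω.bdist j / 8 := by linarith
  refine norm_fderiv_le_of_lip' ℝ (by positivity) ?_
  filter_upwards [Metric.isOpen_ball.mem_nhds (Metric.mem_ball.2 hj)] with y hy
  rw [extend_eq hne v hy, extend_eq hne v hj, Real.norm_eq_abs]
  refine (abs_weightedMean_sub_weightedMean_le _ (fun i _ => J.weight_nonneg i x)
    (one_le_sum_weight hne hj) (one_le_sum_weight hne hy) hv hD).trans ?_
  have h1 : ∀ i ∈ J.nbrs hne j, |J.weight i y - J.weight i x| ≤
      2 * L / Ω.bdist j * ‖y - x‖ := fun i hi => by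
    refine (J.abs_weight_sub_le hne hL i x y).trans (mul_le_mul_of_nonneg_right ?_ (norm_nonneg _))
    have h2 := (mem_nbrs hne).1 hi
    have h3 := Ω.bdist_le_add_dist j i
    rw [dist_comm] at h3
    have h4 : Ω.bdist j / 2 ≤ Ω.bdist i := by linarith
    calc (L : ℝ) / Ω.bdist i ≤ L / (Ω.bdist j / 2) :=
          div_le_div_of_nonneg_left L.2 (by positivity) h4
      _ = 2 * L / Ω.bdist j := by
          field_simp
  have h2 : ∑ i ∈ J.nbrs hne j, |J.weight i y - J.weight i x| ≤
      9 ^ n * (2 * L / Ω.bdist j * ‖y - x‖) := by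
    refine (Finset.sum_le_card_nsmul _ _ _ h1).trans ?_
    rw [nsmul_eq_mul]
    refine mul_le_mul_of_nonneg_right (J.card_le_of_subset_nbhd hne j _ fun i hi => ?_)
      (by positivity)
    exact (mem_nbrs hne).1 hi
  calc 2 * D * ∑ i ∈ J.nbrs hne j, |J.weight i y - J.weight i x|
      ≤ 2 * D * (9 ^ n * (2 * L / Ω.bdist j * ‖y - x‖)) :=
        mul_le_mul_of_nonneg_left h2 (by positivity)
    _ = _ := by
        field_simp
        ring

/-- The cube about a point of the net; different points have disjoint cubes. -/
def cube (J : Ω.WhitneyNet) (hne : Ω.carrierᶜ.Nonempty) (j : J.pts) : AxisCube n :=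
  ⟨j, Ω.bdist j / 20, by linarith [J.bdist_pos hne j]⟩

theorem cube_subset (hne : Ω.carrierᶜ.Nonempty) (j : J.pts) :
    (J.cube hne j).toSet ⊆ Ω.carrier := by
  have hd := J.bdist_pos hne j
  refine (Metric.closedBall_subset_ball ?_).trans (Ω.ball_bdist_subset j)
  change Ω.bdist j / 20 < Ω.bdist j
  linarith

theorem disjoint_cube (hne : Ω.carrierᶜ.Nonempty) {i j : J.pts} (hij : i ≠ j) :
    Disjoint (J.cube hne i).toSet (J.cube hne j).toSet := by
  refine Metric.closedBall_disjoint_closedBall ?_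
  have := J.separated i i.2 j j.2 fun h => hij (Subtype.ext h)
  change Ω.bdist i / 20 + Ω.bdist j / 20 < dist (i : Fin n → ℝ) j
  linarith

end WhitneyNet

theorem VariationBound.sum_le {p η : ℝ} {f : Ω.alphaBoundary α → ℝ} {lam : ℝ}
    (h : Ω.VariationBound p α η f lam) {ι : Type*} (s : Finset ι) (Q : ι → AxisCube n)
    (ω₁ ω₂ : ι → Ω.alphaBoundary α) (hQ : ∀ i ∈ s, (Q i).toSet ⊆ Ω.carrier)
    (hdisj : ∀ i ∈ s, ∀ j ∈ s, i ≠ j → Disjoint (Q i).toSet (Q j).toSet)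
    (hvis : ∀ i ∈ s, Ω.IsAlphaVisible α (Q i) (ω₁ i) ∧ Ω.IsAlphaVisible α (Q i) (ω₂ i))
    (hω : ∀ i ∈ s, Ω.limitPoint α (ω₁ i) ∈ (Q i).dilate η ∩ frontier Ω.carrier ∧
      Ω.limitPoint α (ω₂ i) ∈ (Q i).dilate η ∩ frontier Ω.carrier) :
    ∑ i ∈ s, |f (ω₁ i) - f (ω₂ i)| ^ p / Metric.diam (Q i).toSet ^ (p - n) ≤ lam := by
  set e := s.equivFin.symm with he
  have h1 := h s.card (fun k => Q (e k)) (fun k => ω₁ (e k)) (fun k => ω₂ (e k))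
    (fun k => hQ _ (e k).2) (fun k l hkl => hdisj _ (e k).2 _ (e l).2 fun heq =>
      hkl (e.injective (Subtype.ext heq))) (fun k => hvis _ (e k).2) fun k => hω _ (e k).2
  rw [← Finset.sum_coe_sort s, ← e.sum_comp]
  exact h1

end SpaceDomain

namespace SpaceDomain

variable {n : ℕ} {Ω : SpaceDomain n} {α : Ioc (0 : ℝ) 1}

/-! ### The sufficiency of the variational condition -/

theorem norm_pi_fderiv_single_le (F : (Fin n → ℝ) → ℝ) (x : Fin n → ℝ) :
    ‖fun i => fderiv ℝ F x (Pi.single i 1)‖ ≤ ‖fderiv ℝ F x‖ := by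
  refine (pi_norm_le_iff_of_nonneg (norm_nonneg _)).2 fun i => ?_
  refine ((fderiv ℝ F x).le_opNorm _).trans (le_of_eq ?_)
  rw [Pi.norm_single, norm_one, mul_one]

theorem eLpNorm_ofReal_eq {g : (Fin n → ℝ) → Fin n → ℝ} {p : ℝ} (hp : 0 < p)
    (μ : Measure (Fin n → ℝ)) :
    eLpNorm g (ENNReal.ofReal p) μ = (∫⁻ x, ‖g x‖ₑ ^ p ∂μ) ^ (1 / p) := by
  rw [eLpNorm_eq_lintegral_rpow_enorm_toReal (by simpa using hp) ENNReal.ofReal_ne_top,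
    ENNReal.toReal_ofReal hp.le]

/-- Points of `Ω` near a point of the net are close to the element nearest to that point. -/
theorem dist_le_of_dist_lt_bdist (hne : Ω.carrierᶜ.Nonempty) {x j : Fin n → ℝ}
    (hx : x ∈ Ω.carrier) (hj : j ∈ Ω.carrier) (hxj : dist x j < Ω.bdist j / 8)
    {ω : Ω.SubhypCompletion α} {A : ℝ}
    (hω : dist (Ω.toSubhyp α j hj : Ω.SubhypCompletion α) ω ≤ A * Ω.bdist j ^ (α : ℝ)) :
    dist (Ω.toSubhyp α x hx : Ω.SubhypCompletion α) ω ≤ (A + 2) * Ω.bdist j ^ (α : ℝ) := by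
  have hd := bdist_pos hne hj
  have h1 : Ω.subhypDist α x j ≤ Ω.bdist j ^ (α : ℝ) := by
    refine (Ω.subhypDist_le_of_ball_subset α.2.2 (half_pos hd) fun u hu =>
      (Metric.ball_subset_ball' ?_).trans (Ω.ball_bdist_subset j)).trans ?_
    · have h2 := dist_lineMap_le_combination x j j hu
      rw [dist_self] at h2
      nlinarith [hu.1, hu.2, dist_nonneg (x := x) (y := j)]
    · rw [norm_sub_rev, ← dist_eq_norm]
      calc dist x j * (Ω.bdist j / 2) ^ ((α : ℝ) - 1)
          ≤ (Ω.bdist j / 2) * (Ω.bdist j / 2) ^ ((α : ℝ) - 1) :=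
            mul_le_mul_of_nonneg_right (by linarith) (by positivity)
        _ = (Ω.bdist j / 2) ^ (α : ℝ) := by
            rw [Real.rpow_sub_one (by positivity)]
            field_simp
        _ ≤ Ω.bdist j ^ (α : ℝ) :=
            Real.rpow_le_rpow (by positivity) (by linarith) α.2.1.le
  have h2 : ‖x - j‖ ^ (α : ℝ) ≤ Ω.bdist j ^ (α : ℝ) :=
    Real.rpow_le_rpow (norm_nonneg _) (by rw [← dist_eq_norm]; linarith) α.2.1.le
  have h3 := dist_triangle (Ω.toSubhyp α x hx : Ω.SubhypCompletion α) (Ω.toSubhyp α j hj) ω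
  rw [Completion.dist_eq, Subhyp.dist_def, pt_toSubhyp, pt_toSubhyp] at h3
  linarith

/-- If the weight of `i` is nonzero at `x`, then `bdist i ≤ 2 * bdist x ≤ 2 * dist x ℓ(ω)`. Hence `w
i` is close to `x` in the completion, and to `ω` when `x` is; a mean of values of `f` near `f ω` is
near `f ω`. -/
theorem isTrace_extend (hne : Ω.carrierᶜ.Nonempty) (J : Ω.WhitneyNet)
    {f : Ω.alphaBoundary α → ℝ} (hf : Ω.IsSubhypContinuous α f) (w : J.pts → Ω.alphaBoundary α)
    {A : ℝ} (hA : 0 ≤ A)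
    (hw : ∀ j : J.pts, dist (Ω.toSubhyp α j (J.subset j.2) : Ω.SubhypCompletion α) (w j) ≤
      A * Ω.bdist j ^ (α : ℝ)) :
    Ω.IsTrace α (J.extend fun j => f (w j)) f := by
  intro ω
  rw [Metric.tendsto_nhds]
  intro ε hε
  obtain ⟨δ, hδ, hδf⟩ := hf ω (ε / 2) (half_pos hε)
  have hωf := (Ω.mem_alphaBoundary_iff α).1 ω.2
  -- At a point `x` of `Ω` this bounds the distance from `ω` to every `w i` active at `x`; it is
  -- continuous and vanishes at `ω`.
  set φ : Ω.SubhypCompletion α → ℝ := fun w => dist (ω : Ω.SubhypCompletion α) w +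
    (A + 2) * (2 * dist (Ω.limitPoint α w) (Ω.limitPoint α ω)) ^ (α : ℝ) with hφ
  have hcont : Continuous φ := by
    have hl := Ω.continuous_limitPoint α
    refine (continuous_const.dist continuous_id).add (continuous_const.mul
      (Continuous.rpow_const ?_ fun _ => Or.inr α.2.1.le))
    exact continuous_const.mul (hl.dist continuous_const)
  have hφ0 : φ ω < δ := by
    simpa [hφ, Real.zero_rpow α.2.1.ne'] using hδ
  have hev : ∀ᶠ x : Ω.Subhyp α in comap ((↑) : Ω.Subhyp α → Ω.SubhypCompletion α)
      (𝓝 (ω : Ω.SubhypCompletion α)), φ x < δ :=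
    tendsto_comap.eventually (hcont.continuousAt.eventually_lt_const hφ0)
  filter_upwards [hev] with x hx
  obtain ⟨j, -, hj⟩ := WhitneyNet.exists_dist_lt (J := J) hne x.pt_mem
  rw [WhitneyNet.extend_eq hne _ hj, Real.dist_eq]
  refine lt_of_le_of_lt (abs_weightedMean_sub_le _ (D := ε / 2)
    (fun i _ => J.weight_nonneg i x.pt)
    (by linarith [WhitneyNet.one_le_sum_weight hne hj]) fun i _ hi => ?_) (half_lt_self hε)
  have hxi := J.dist_lt_of_weight_ne_zero hne hi
  refine (hδf (w i) ((Ω.closureDist_le_dist α _ _).trans_lt (lt_of_le_of_lt ?_ hx))).le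
  refine (dist_triangle (ω : Ω.SubhypCompletion α) (x : Ω.SubhypCompletion α) _).trans
    (add_le_add le_rfl ?_)
  refine (dist_le_of_dist_lt_bdist hne x.pt_mem (J.subset i.2) hxi (hw i)).trans
    (mul_le_mul_of_nonneg_left ?_ (by linarith))
  refine Real.rpow_le_rpow (J.bdist_pos hne i).le ?_ α.2.1.le
  rw [limitPoint_coe]
  have h1 := Ω.bdist_le_add_dist i x.pt
  have h2 := bdist_le_dist_of_mem_frontier hωf x.pt
  have h3 := SpaceDomain.bdist_pos hne x.pt_mem
  rw [dist_comm] at h1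
  linarith

/-- The energy of one cell of the partition. -/
theorem cell_energy_le {p C D d : ℝ} (hp : (n : ℝ) < p) (hC : 0 ≤ C) (hD : 0 ≤ D) (hd : 0 < d) :
    (C * (D / d)) ^ p * (2 * (d / 9)) ^ n ≤ C ^ p * (D ^ p / (2 * (d / 20)) ^ (p - n)) := by
  have h1 : (2 * (d / 9)) ^ n ≤ d ^ n := pow_le_pow_left₀ (by positivity) (by linarith) n
  have h2 : (2 * (d / 20)) ^ (p - n) ≤ d ^ (p - n) :=
    Real.rpow_le_rpow (by positivity) (by linarith) (by linarith)
  calc (C * (D / d)) ^ p * (2 * (d / 9)) ^ n ≤ (C * (D / d)) ^ p * d ^ n :=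
        mul_le_mul_of_nonneg_left h1 (by positivity)
    _ = C ^ p * (D ^ p / d ^ (p - n)) := by
        rw [Real.mul_rpow hC (by positivity), Real.div_rpow hD hd.le, Real.rpow_sub hd,
          Real.rpow_natCast]
        field_simp
    _ ≤ _ := by
        refine mul_le_mul_of_nonneg_left ?_ (by positivity)
        exact div_le_div_of_nonneg_left (by positivity) (by positivity) h2

theorem exists_extension_of_variationBound_of_nonempty (hn : 1 ≤ n) {p : ℝ} (hp : (n : ℝ) < p)
    {η : ℝ} (hη : 41 ≤ η) {L : NNReal} (hL : LipschitzWith L (whitneyBump n))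
    (hne : Ω.carrierᶜ.Nonempty) {f : Ω.alphaBoundary α → ℝ} {lam : ℝ}
    (hf : Ω.IsSubhypContinuous α f) (hlam : Ω.VariationBound p α η f lam) :
    ∃ F g, Ω.IsSobolevWith p F g ∧ Ω.IsTrace α F f ∧
      ∫⁻ x in Ω.carrier, ‖g x‖ₑ ^ p ≤ ENNReal.ofReal ((4 * L * 9 ^ n) ^ p * lam) := by
  have hp0 : 0 < p := lt_of_le_of_lt (Nat.cast_nonneg n) hp
  obtain ⟨J⟩ := Ω.exists_whitneyNet
  have hcount := J.countable hne
  choose w hwd hwdist hwvis using fun j : J.pts =>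
    exists_nearest_boundary_element α hne (J.subset j.2)
  set v : J.pts → ℝ := fun j => f (w j) with hv
  have hself : ∀ j, j ∈ J.nbrs hne j := fun j =>
    (WhitneyNet.mem_nbrs hne).2 (J.self_mem_nbhd j)
  -- The variational sum admits one pair of elements per cube, so the oscillation over the
  -- neighbours is represented by a single worst neighbour.
  choose k hk hkmax using fun j : J.pts =>
    (J.nbrs hne j).exists_max_image (fun i => |v i - v j|) ⟨j, hself j⟩
  set D : J.pts → ℝ := fun j => |v (k j) - v j| with hD
  set C : ℝ := 4 * L * 9 ^ n with hC
  have hC0 : 0 ≤ C := by positivity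
  -- Visibility: `2 / 7 + 1 / 20 < 5 / 7`, so the cube lies in the maximal ball about `i`. Position:
  -- `bdist i + dist i j` is at most `11 / 7 * bdist j`, below `41 / 20 * bdist j`.
  have hvis : ∀ j, ∀ i ∈ J.nbrs hne j, Ω.IsAlphaVisible α (J.cube hne j) (w i) ∧
      Ω.limitPoint α (w i) ∈ (J.cube hne j).dilate η ∩ frontier Ω.carrier := by
    intro j i hi
    have hdj := J.bdist_pos hne j
    have h1 := (WhitneyNet.mem_nbrs hne).1 hi
    have h2 := Ω.bdist_le_add_dist j i
    have h3 := Ω.bdist_le_add_dist i j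
    rw [dist_comm] at h2
    refine ⟨hwvis i _ ?_, ?_, (Ω.mem_alphaBoundary_iff α).1 (w i).2⟩
    · change dist (i : Fin n → ℝ) j + Ω.bdist j / 20 < Ω.bdist i
      linarith
    · change dist (Ω.limitPoint α (w i)) j ≤ η * (Ω.bdist j / 20)
      have h4 := dist_triangle_left (Ω.limitPoint α (w i)) j i
      have h5 : 41 * (Ω.bdist j / 20) ≤ η * (Ω.bdist j / 20) :=
        mul_le_mul_of_nonneg_right hη (by positivity)
      linarith [hwd i]
  have : Nonempty (Fin n) := ⟨⟨0, hn⟩⟩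
  have hdiam : ∀ j, Metric.diam (J.cube hne j).toSet = 2 * (Ω.bdist j / 20) := fun j =>
    Metric.diam_closedBall_eq _ (J.cube hne j).radius_pos.le
  have hsum : ∀ s : Finset J.pts,
      ∑ j ∈ s, D j ^ p / (2 * (Ω.bdist j / 20)) ^ (p - n) ≤ lam := fun s => by
    have h := hlam.sum_le s (J.cube hne) (fun j => w (k j)) w
      (fun j _ => WhitneyNet.cube_subset hne j)
      (fun i _ j _ hij => WhitneyNet.disjoint_cube hne hij)
      (fun j _ => ⟨(hvis j _ (hk j)).1, (hvis j j (hself j)).1⟩)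
      (fun j _ => ⟨(hvis j _ (hk j)).2, (hvis j j (hself j)).2⟩)
    simpa only [hdiam] using h
  set F := J.extend v with hF
  set g : (Fin n → ℝ) → Fin n → ℝ := fun x i => fderiv ℝ F x (Pi.single i 1) with hg
  have hFd : ContDiffOn ℝ 1 F Ω.carrier := WhitneyNet.contDiffOn_extend hne v
  have hcell : ∀ j : J.pts, ∫⁻ x in Metric.closedBall (j : Fin n → ℝ) (Ω.bdist j / 9), ‖g x‖ₑ ^ p ≤
      ENNReal.ofReal (C ^ p * (D j ^ p / (2 * (Ω.bdist j / 20)) ^ (p - n))) := by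
    intro j
    have hdj := J.bdist_pos hne j
    have hDj : 0 ≤ D j := abs_nonneg _
    have hpt : ∀ x ∈ Metric.closedBall (j : Fin n → ℝ) (Ω.bdist j / 9),
        ‖g x‖ₑ ^ p ≤ ENNReal.ofReal ((C * (D j / Ω.bdist j)) ^ p) := fun x hx => by
      rw [← ENNReal.ofReal_rpow_of_nonneg (by positivity) hp0.le]
      refine ENNReal.rpow_le_rpow ?_ hp0.le
      rw [← ofReal_norm]
      refine ENNReal.ofReal_le_ofReal ((norm_pi_fderiv_single_le F x).trans ?_)
      exact WhitneyNet.norm_fderiv_extend_le hne v hL hDj (hkmax j) hx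
    refine (setLIntegral_mono' measurableSet_closedBall hpt).trans ?_
    rw [setLIntegral_const, Real.volume_pi_closedBall _ (by positivity), Fintype.card_fin,
      ← ENNReal.ofReal_mul (by positivity)]
    exact ENNReal.ofReal_le_ofReal (cell_energy_le hp hC0 hDj hdj)
  have hcover : Ω.carrier ⊆ ⋃ j : J.pts, Metric.closedBall (j : Fin n → ℝ) (Ω.bdist j / 9) :=
    fun x hx => by
      obtain ⟨j, hj, -⟩ := WhitneyNet.exists_dist_lt (J := J) hne hx
      exact mem_iUnion.2 ⟨j, hj⟩
  have henergy : ∫⁻ x in Ω.carrier, ‖g x‖ₑ ^ p ≤ ENNReal.ofReal (C ^ p * lam) := by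
    refine (lintegral_mono_set hcover).trans ((lintegral_iUnion_le _ _).trans
      ((ENNReal.tsum_le_tsum hcell).trans ?_))
    -- The variational bound concerns finite families, with a constant independent of the family;
    -- this controls the infinite sum.
    rw [ENNReal.tsum_eq_iSup_sum]
    refine iSup_le fun s => ?_
    rw [← ENNReal.ofReal_sum_of_nonneg fun j _ => by
      have := J.bdist_pos hne j
      have hDj : 0 ≤ D j := abs_nonneg _
      positivity]
    refine ENNReal.ofReal_le_ofReal ?_
    rw [← Finset.mul_sum]
    exact mul_le_mul_of_nonneg_left (hsum s) (by positivity)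
  have hgm : Measurable g := measurable_pi_lambda _ fun i => measurable_fderiv_apply_const ℝ F _
  have h2 : (1 : ℝ) < 2 ^ (α : ℝ) := Real.one_lt_rpow (by norm_num) α.2.1
  refine ⟨F, g, ⟨hFd.continuousOn, isWeakGradient_of_contDiffOn hFd, hgm.aestronglyMeasurable, ?_⟩,
    isTrace_extend hne J hf w (A := 1 / (2 ^ (α : ℝ) - 1) + 1) ?_ hwdist, henergy⟩
  · rw [eLpNorm_ofReal_eq hp0]
    exact ENNReal.rpow_lt_top_of_nonneg (by positivity)
      (ne_top_of_le_ne_top ENNReal.ofReal_ne_top henergy)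
  · have : 0 < (2 : ℝ) ^ (α : ℝ) - 1 := by linarith
    positivity

/-- A function that satisfies the variational inequality has an extension with controlled
energy. -/
theorem exists_extension_of_variationBound (hn : 1 ≤ n) {p : ℝ} (hp : (n : ℝ) < p)
    {η : ℝ} (hη : 41 ≤ η) {L : NNReal} (hL : LipschitzWith L (whitneyBump n))
    {f : Ω.alphaBoundary α → ℝ} {lam : ℝ} (hlam0 : 0 < lam)
    (hf : Ω.IsSubhypContinuous α f) (hlam : Ω.VariationBound p α η f lam) :
    ∃ F g, Ω.IsSobolevWith p F g ∧ Ω.IsTrace α F f ∧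
      (eLpNorm g (ENNReal.ofReal p) (volume.restrict Ω.carrier)).toReal ≤
        4 * L * 9 ^ n * lam ^ (1 / p) := by
  have hp0 : 0 < p := lt_of_le_of_lt (Nat.cast_nonneg n) hp
  -- If `Ω` is the whole space, the `α`-boundary is empty and the zero function will do.
  rcases Ω.carrierᶜ.eq_empty_or_nonempty with he | hne
  · have hfr : frontier Ω.carrier = ∅ := by rw [compl_empty_iff.1 he, frontier_univ]
    refine ⟨fun _ => 0, fun _ => 0, ⟨continuousOn_const, fun φ _ _ _ i => by simp,
      MemLp.zero⟩, fun ω => ?_, ?_⟩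
    · have := (Ω.mem_alphaBoundary_iff α).1 ω.2
      rw [hfr] at this
      exact this.elim
    · rw [show (fun _ : Fin n → ℝ => (0 : Fin n → ℝ)) = 0 from rfl, eLpNorm_zero,
        ENNReal.toReal_zero]
      positivity
  · obtain ⟨F, g, hFg, hF, henergy⟩ :=
      exists_extension_of_variationBound_of_nonempty hn hp hη hL hne hf hlam
    refine ⟨F, g, hFg, hF, ENNReal.toReal_le_of_le_ofReal (by positivity) ?_⟩
    rw [eLpNorm_ofReal_eq hp0]
    refine (ENNReal.rpow_le_rpow henergy (by positivity)).trans (le_of_eq ?_)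
    rw [ENNReal.ofReal_rpow_of_nonneg (by positivity) (by positivity),
      Real.mul_rpow (by positivity) hlam0.le, ← Real.rpow_mul (by positivity),
      mul_one_div_cancel hp0.ne', Real.rpow_one]

end SpaceDomain

end

/-! ### The trace criterion and the equivalence of norms -/

theorem theorem5p1 (n : ℕ) (hn : 1 ≤ n) (p : ℝ) (hp : (n : ℝ) < p)
    (α : Set.Ioc (0 : ℝ) 1) (hα : (α : ℝ) = (p - n) / (p - 1)) (η : ℝ) (hη : 41 ≤ η) :
    ∃ C : ℝ, 1 ≤ C ∧ ∀ (Ω : SpaceDomain n) (f : Ω.alphaBoundary α → ℝ),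
      (Ω.IsSobolevTrace p α f ↔
        Ω.IsSubhypContinuous α f ∧ ∃ lam : ℝ, 0 < lam ∧ Ω.VariationBound p α η f lam) ∧
      (Ω.IsSobolevTrace p α f →
        C⁻¹ * sInf {t : ℝ | ∃ lam : ℝ, 0 < lam ∧ Ω.VariationBound p α η f lam ∧
            t = lam ^ (1 / p)} ≤ Ω.traceNorm p α f ∧
        Ω.traceNorm p α f ≤ C * sInf {t : ℝ | ∃ lam : ℝ, 0 < lam ∧
            Ω.VariationBound p α η f lam ∧ t = lam ^ (1 / p)}) := by
  have hp0 : 0 < p := lt_of_le_of_lt (Nat.cast_nonneg n) hp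
  have hη1 : 1 ≤ η := by linarith
  obtain ⟨L, hL⟩ := ContDiff.lipschitzWith_of_hasCompactSupport (𝕂 := ℝ)
    (whitneyBump n).hasCompactSupport ((whitneyBump n).contDiff (n := 1)) one_ne_zero
  set A : ℝ := max (SpaceDomain.variationConst n p η) 1 with hA
  have hA1 : 1 ≤ A := le_max_right _ _
  set C : ℝ := max (A ^ (1 / p)) (4 * L * 9 ^ n) with hC
  have hC1 : 1 ≤ C := le_max_of_le_left (Real.one_le_rpow hA1 (by positivity))
  refine ⟨C, hC1, fun Ω f => ?_⟩
  have hnec : ∀ F g, Ω.IsSobolevWith p F g → Ω.IsTrace α F f → ∀ lam : ℝ,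
      A * (∫⁻ z in Ω.carrier, ‖g z‖ₑ ^ p).toReal ≤ lam → Ω.VariationBound p α η f lam :=
    fun F g hFg hF lam hlam => SpaceDomain.IsTrace.variationBound hFg hn hp hF hη1
      ((mul_le_mul_of_nonneg_right (le_max_left _ _) ENNReal.toReal_nonneg).trans hlam)
  have hiff : Ω.IsSobolevTrace p α f ↔
      Ω.IsSubhypContinuous α f ∧ ∃ lam : ℝ, 0 < lam ∧ Ω.VariationBound p α η f lam := by
    constructor
    · rintro ⟨F, g, hFg, hF⟩
      refine ⟨hF.isSubhypContinuous, A * (∫⁻ z in Ω.carrier, ‖g z‖ₑ ^ p).toReal + 1, ?_,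
        hnec F g hFg hF _ (by linarith)⟩
      have : 0 ≤ A * (∫⁻ z in Ω.carrier, ‖g z‖ₑ ^ p).toReal :=
        mul_nonneg (by linarith) ENNReal.toReal_nonneg
      linarith
    · rintro ⟨hf, lam, hlam0, hlam⟩
      obtain ⟨F, g, hFg, hF, -⟩ :=
        SpaceDomain.exists_extension_of_variationBound hn hp hη hL hlam0 hf hlam
      exact ⟨F, g, hFg, hF⟩
  refine ⟨hiff, fun htr => ?_⟩
  obtain ⟨hf, lam₀, hlam₀, hlamV⟩ := hiff.1 htr
  set S := {t : ℝ | ∃ lam : ℝ, 0 < lam ∧ Ω.VariationBound p α η f lam ∧ t = lam ^ (1 / p)} with hS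
  have hSne : S.Nonempty := ⟨_, lam₀, hlam₀, hlamV, rfl⟩
  have hSbdd : BddBelow S := ⟨0, by
    rintro t ⟨lam, hlam, -, rfl⟩
    positivity⟩
  set N := {N : ℝ | ∃ F g, Ω.IsSobolevWith p F g ∧ Ω.IsTrace α F f ∧
    N = (eLpNorm g (ENNReal.ofReal p) (volume.restrict Ω.carrier)).toReal} with hN
  have hNbdd : BddBelow N := ⟨0, by
    rintro t ⟨F, g, -, -, rfl⟩
    exact ENNReal.toReal_nonneg⟩
  constructor
  · obtain ⟨F, g, hFg, hF⟩ := htr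
    refine le_csInf ⟨_, F, g, hFg, hF, rfl⟩ ?_
    rintro _ ⟨F, g, hFg, hF, rfl⟩
    rw [inv_mul_le_iff₀ (by linarith), SpaceDomain.eLpNorm_ofReal_eq hp0, ← ENNReal.toReal_rpow]
    set I := (∫⁻ z in Ω.carrier, ‖g z‖ₑ ^ p).toReal with hI
    have hI0 : 0 ≤ I := ENNReal.toReal_nonneg
    -- Admissible constants must be positive while the energy `I` may vanish, so the bound is
    -- reached as `ε` tends to `0`.
    have hle : ∀ ε : ℝ, 0 < ε → sInf S ≤ (A * I + ε) ^ (1 / p) := fun ε hε =>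
      csInf_le hSbdd ⟨A * I + ε, by positivity, hnec F g hFg hF _ (by linarith), rfl⟩
    have hlim : Tendsto (fun ε : ℝ => (A * I + ε) ^ (1 / p)) (𝓝[>] 0)
        (𝓝 ((A * I + 0) ^ (1 / p))) :=
      ((tendsto_const_nhds.add tendsto_id).rpow_const (Or.inr (by positivity))).mono_left
        nhdsWithin_le_nhds
    have h1 : sInf S ≤ (A * I + 0) ^ (1 / p) :=
      ge_of_tendsto hlim (by filter_upwards [self_mem_nhdsWithin] with ε hε using hle ε hε)
    rw [add_zero, Real.mul_rpow (by linarith) hI0] at h1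
    exact h1.trans (mul_le_mul_of_nonneg_right (le_max_left _ _) (by positivity))
  · have h1 : Ω.traceNorm p α f / C ≤ sInf S := by
      refine le_csInf hSne ?_
      rintro _ ⟨lam, hlam0, hlam, rfl⟩
      obtain ⟨F, g, hFg, hF, hnorm⟩ :=
        SpaceDomain.exists_extension_of_variationBound hn hp hη hL hlam0 hf hlam
      rw [div_le_iff₀' (by linarith)]
      have h2 : Ω.traceNorm p α f ≤ _ := csInf_le hNbdd ⟨F, g, hFg, hF, rfl⟩
      exact h2.trans (hnorm.trans (mul_le_mul_of_nonneg_right (le_max_right _ _) (by positivity)))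
    rwa [div_le_iff₀' (by linarith)] at h1
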